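/- Proposition 3.5 (Isometry). Let $1\le k\le n$. Consider the following five models of the Grassmannian $\mathrm{Gr}(k,n)$, each of which is a smooth manifold of dimension $k(n-k)$ with a Riemannian metric: (1) the orthogonal model $\mathrm{O}(n)/(\mathrm{O}(k)\times \mathrm{O}(n-k))$, with $[\![V]\!]=\{V\operatorname{diag}(Q_1,Q_2): Q_1\in\mathrm{O}(k),\,Q_2\in\mathrm{O}(n-k)\}$ and the quotient metric of the metric $\tfrac12\operatorname{tr}(X^{\mathsf T}Y)$ on $\mathrm{O}(n)$; that is, the horizontal tangent vectors at $V$ are $V\begin{bmatrix}0&B\\-B^{\mathsf T}&0\end{bmatrix}$ with $B\in\mathbb{R}^{k\times(n-k)}$, and the inner product of those given by $B_1,B_2$ is $\operatorname{tr}(B_1^{\mathsf T}B_2)$; (2) the Stiefel model $\mathrm{V}(k,n)/\mathrm{O}(k)$, where $\mathrm{V}(k,n)=\{Y\in\mathbb{R}^{n\times k}:Y^{\mathsf T}Y=I\}$, with the quotient metric of the metric $\operatorname{tr}(X^{\mathsf T}Y)$ on $\mathrm{V}(k,n)$; (3) the full-rank model $\mathbb{R}^{n\times k}_k/\mathrm{GL}(k)$,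 where $\mathbb{R}^{n\times k}_k=\{A\in\mathbb{R}^{n\times k}:\operatorname{rank}A=k\}$, with the quotient metric of the metric $\operatorname{tr}((A^{\mathsf T}A)^{-1}X^{\mathsf T}Y)$ at $A\in\mathbb{R}^{n\times k}_k$; (4) the projection model $\{P\in\mathbb{R}^{n\times n}:P^{\mathsf T}=P=P^2,\ \operatorname{tr}P=k\}$, with the metric $\operatorname{tr}(XY)$; (5) the involution model $\{Q\in\mathrm{O}(n):Q^{\mathsf T}=Q,\ \operatorname{tr}Q=2k-n\}$, with the metric $\langle X,Y\rangle_Q=\operatorname{tr}(XY)$. Here $\mathrm{O}(n)$, $\mathrm{V}(k,n)$, $\mathbb{R}^{n\times k}_k$ and the models (4), (5) are embedded submanifolds of spaces of matrices. The models (1)–(3) carry the quotient topology and the smooth structure for which the quotient map is a smooth submersion, and "quotient metric" means the metric that makes the quotient map a Riemannian submersion. All these structures exist. Then all five models are, up to constant positive factors, pairwise isometric as Riemannian manifolds. More precisely, the following maps to the involution model are well-defined diffeomorphisms, and each pulls the metric of the involution model back to the stated constant times the metric of its domain: - $\varphi_1([\![V]\!])=V\operatorname{diag}(I_k,-I_{n-k})V^{\mathsf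 T}$ on the orthogonal model, with constant $8$; - $\varphi_2(P)=2P-I$ on the projection model, with constant $4$; - $\varphi_3([\![Y]\!])=2YY^{\mathsf T}-I$ on the Stiefel model, with constant $8$; - $\varphi_4([\![A]\!])=2YY^{\mathsf T}-I$ on the full-rank model, where $A=YR$ with $Y\in\mathrm{V}(k,n)$ and $R\in\mathbb{R}^{k\times k}$ (for example a QR factorization), with constant $8$. -/

import Mathlib

open scoped Manifold ContDiff Matrix

/-! ### Riemannian manifolds -/

/-- A structure of smooth `d`-dimensional Riemannian manifold (without boundary) on a topological
space `M`: a smooth atlas compatible with the given topology, and a smooth Riemannian metric. -/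
structure RiemannianStructure (d : ℕ) (M : Type) [TopologicalSpace M] where
  charted : ChartedSpace (EuclideanSpace ℝ (Fin d)) M
  isManifold : IsManifold (𝓡 d) ∞ M
  metric : Bundle.ContMDiffRiemannianMetric (𝓡 d) ∞ (EuclideanSpace ℝ (Fin d))
    (fun x : M ↦ TangentSpace (𝓡 d) x)

/-- `ι : M → E` realizes `M` as a smoothly embedded submanifold of the normed space `E`, and the
Riemannian metric of `M` at `x`, on tangent vectors regarded as elements of `E` through the
differential of `ι`, is the bilinear form `G (ι x)`. -/
def RiemannianStructure.IsInduced {d : ℕ} {M : Type} [TopologicalSpace M]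
    (R : RiemannianStructure d M) {E : Type} [NormedAddCommGroup E] [NormedSpace ℝ E]
    (ι : M → E) (G : E → E → E → ℝ) : Prop :=
  letI := R.charted
  letI := R.isManifold
  Manifold.IsSmoothEmbedding (𝓡 d) 𝓘(ℝ, E) ∞ ι ∧
    ∀ (x : M) (u v : TangentSpace (𝓡 d) x),
      R.metric.inner x u v = G (ι x) (mfderiv (𝓡 d) 𝓘(ℝ, E) ι x u) (mfderiv (𝓡 d) 𝓘(ℝ, E) ι x v)

/-- A tangent vector `u` of `M` at `x` is horizontal for `π : M → N` if it is orthogonal to the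
kernel of the differential of `π`. -/
def RiemannianStructure.IsHorizontal {d e : ℕ} {M N : Type} [TopologicalSpace M]
    [TopologicalSpace N] (R : RiemannianStructure d M) (S : RiemannianStructure e N)
    (π : M → N) (x : M) (u : EuclideanSpace ℝ (Fin d)) : Prop :=
  letI := R.charted
  letI := R.isManifold
  letI := S.charted
  letI := S.isManifold
  ∀ w : TangentSpace (𝓡 d) x, mfderiv (𝓡 d) (𝓡 e) π x w = 0 → R.metric.inner x u w = 0

/-- `π` is a Riemannian submersion: a smooth submersion whose differential preserves inner
products of horizontal vectors. -/
def RiemannianStructure.IsRiemannianSubmersion {d e : ℕ} {M N : Type} [TopologicalSpace M]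
    [TopologicalSpace N] (R : RiemannianStructure d M) (S : RiemannianStructure e N)
    (π : M → N) : Prop :=
  letI := R.charted
  letI := R.isManifold
  letI := S.charted
  letI := S.isManifold
  Manifold.IsSubmersion (𝓡 d) (𝓡 e) ∞ π ∧
    ∀ (x : M) (u v : TangentSpace (𝓡 d) x), R.IsHorizontal S π x u → R.IsHorizontal S π x v →
      S.metric.inner (π x) (mfderiv (𝓡 d) (𝓡 e) π x u) (mfderiv (𝓡 d) (𝓡 e) π x v) =
        R.metric.inner x u v

/-- `f` is an isometry up to the constant factor `c`: a diffeomorphism with `f^* g_N = c g_M`. -/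
def RiemannianStructure.IsScaledIsometry {d e : ℕ} {M N : Type} [TopologicalSpace M]
    [TopologicalSpace N] (R : RiemannianStructure d M) (S : RiemannianStructure e N)
    (c : ℝ) (f : M → N) : Prop :=
  letI := R.charted
  letI := R.isManifold
  letI := S.charted
  letI := S.isManifold
  (∃ Φ : M ≃ₘ^∞⟮𝓡 d, 𝓡 e⟯ N, ⇑Φ = f) ∧
    ∀ (x : M) (u v : TangentSpace (𝓡 d) x),
      S.metric.inner (f x) (mfderiv (𝓡 d) (𝓡 e) f x u) (mfderiv (𝓡 d) (𝓡 e) f x v) =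
        c * R.metric.inner x u v

/-- A `d`-dimensional Riemannian manifold, bundled. -/
structure RiemannianMfd (d : ℕ) where
  carrier : Type
  [top : TopologicalSpace carrier]
  str : RiemannianStructure d carrier

/-- Two Riemannian manifolds are isometric up to a (positive) constant factor. -/
def RiemannianMfd.IsometricUpToConstant {d : ℕ} (M N : RiemannianMfd d) : Prop :=
  letI := M.top
  letI := N.top
  ∃ c : ℝ, 0 < c ∧ ∃ f : M.carrier → N.carrier, M.str.IsScaledIsometry N.str c f

/-! ### The five models as topological spaces -/

/-- The matrix `diag(Q₁, Q₂)`, for `Q₁` of size `k` and `Q₂` of size `n - k`. -/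
def blockDiag {n k : ℕ} (h : k ≤ n) (Q₁ : Matrix (Fin k) (Fin k) ℝ)
    (Q₂ : Matrix (Fin (n - k)) (Fin (n - k)) ℝ) : Matrix (Fin n) (Fin n) ℝ :=
  Matrix.reindexAlgEquiv ℝ ℝ (finSumFinEquiv.trans (finCongr (Nat.add_sub_cancel' h)))
    (Matrix.fromBlocks Q₁ 0 0 Q₂)

/-- The matrix `I_{k,n-k} = diag(1,…,1,-1,…,-1)` with `k` entries `1` and `n - k` entries `-1`. -/
def signatureMatrix (n k : ℕ) : Matrix (Fin n) (Fin n) ℝ :=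
  Matrix.diagonal fun i ↦ if (i : ℕ) < k then 1 else -1

theorem blockDiag_mul {n k : ℕ} (h : k ≤ n) (A A' : Matrix (Fin k) (Fin k) ℝ)
    (B B' : Matrix (Fin (n - k)) (Fin (n - k)) ℝ) :
    blockDiag h (A * A') (B * B') = blockDiag h A B * blockDiag h A' B' := by
  simp only [blockDiag]
  rw [← map_mul, Matrix.fromBlocks_multiply]
  simp

theorem blockDiag_one {n k : ℕ} (h : k ≤ n) : blockDiag h 1 1 = 1 := by
  simp only [blockDiag]
  rw [Matrix.fromBlocks_one, map_one]

theorem blockDiag_transpose {n k : ℕ} (h : k ≤ n) (A : Matrix (Fin k) (Fin k) ℝ)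
    (B : Matrix (Fin (n - k)) (Fin (n - k)) ℝ) :
    (blockDiag h A B)ᵀ = blockDiag h Aᵀ Bᵀ := by
  simp [blockDiag, Matrix.transpose_submatrix, Matrix.fromBlocks_transpose]

/-- The subgroup `O(k) × O(n-k)` of `O(n)`, consisting of the matrices `diag(Q₁, Q₂)`. -/
def blockSubgroup {n k : ℕ} (h : k ≤ n) : Subgroup (Matrix.orthogonalGroup (Fin n) ℝ) where
  carrier := {V | ∃ Q₁ ∈ Matrix.orthogonalGroup (Fin k) ℝ,
    ∃ Q₂ ∈ Matrix.orthogonalGroup (Fin (n - k)) ℝ, (V : Matrix _ _ ℝ) = blockDiag h Q₁ Q₂}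
  mul_mem' := by
    rintro _ _ ⟨A, hA, B, hB, h₁⟩ ⟨A', hA', B', hB', h₂⟩
    refine ⟨A * A', mul_mem hA hA', B * B', mul_mem hB hB', ?_⟩
    rw [blockDiag_mul, ← h₁, ← h₂]
    rfl
  one_mem' := ⟨1, one_mem _, 1, one_mem _, (blockDiag_one h).symm⟩
  inv_mem' := by
    rintro V ⟨A, hA, B, hB, h₁⟩
    refine ⟨star A, Unitary.star_mem hA, star B, Unitary.star_mem hB, ?_⟩
    have h₂ : ((V⁻¹ : Matrix.orthogonalGroup (Fin n) ℝ) : Matrix _ _ ℝ) =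
      (V : Matrix (Fin n) (Fin n) ℝ)ᵀ := rfl
    rw [h₂, h₁, blockDiag_transpose]
    rfl

/-- The orthogonal model `O(n) / (O(k) × O(n-k))`, with the quotient topology; the class of `V` is
the left coset `{V diag(Q₁, Q₂)}`. -/
abbrev OrthogonalModel {n k : ℕ} (h : k ≤ n) : Type :=
  Matrix.orthogonalGroup (Fin n) ℝ ⧸ blockSubgroup h

/-- The Stiefel manifold `V(k,n)` of `n × k` matrices with orthonormal columns. -/
def stiefel (n k : ℕ) : Set (Matrix (Fin n) (Fin k) ℝ) := {Y | Yᵀ * Y = 1}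

/-- Two elements `Y, Y'` of `V(k,n)` are equivalent if `Y' = Y Q` for some `Q ∈ O(k)`. -/
def stiefelSetoid (n k : ℕ) : Setoid (stiefel n k) where
  r Y Y' := ∃ Q ∈ Matrix.orthogonalGroup (Fin k) ℝ, Y'.1 = Y.1 * Q
  iseqv :=
    { refl := fun Y ↦ ⟨1, one_mem _, (Matrix.mul_one _).symm⟩
      symm := by
        rintro Y Y' ⟨Q, hQ, h⟩
        refine ⟨star Q, Unitary.star_mem hQ, ?_⟩
        rw [h, Matrix.mul_assoc, Unitary.mul_star_self_of_mem hQ, Matrix.mul_one]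
      trans := by
        rintro Y Y' Y'' ⟨Q, hQ, h⟩ ⟨Q', hQ', h'⟩
        exact ⟨Q * Q', mul_mem hQ hQ', by rw [h', h, Matrix.mul_assoc]⟩ }

/-- The Stiefel model `V(k,n) / O(k)`, with the quotient topology. -/
abbrev StiefelModel (n k : ℕ) : Type := Quotient (stiefelSetoid n k)

/-- The set of `n × k` real matrices of rank `k`. -/
def fullRank (n k : ℕ) : Set (Matrix (Fin n) (Fin k) ℝ) := {A | A.rank = k}

/-- Two `n × k` matrices `A, A'` of rank `k` are equivalent if `A' = A X` for some `X ∈ GL(k)`. -/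
def fullRankSetoid (n k : ℕ) : Setoid (fullRank n k) where
  r A A' := ∃ X : GL (Fin k) ℝ, A'.1 = A.1 * X.1
  iseqv :=
    { refl := fun A ↦ ⟨1, (Matrix.mul_one _).symm⟩
      symm := by
        rintro A A' ⟨X, h⟩
        exact ⟨X⁻¹, by rw [h, Matrix.mul_assoc, Units.mul_inv, Matrix.mul_one]⟩
      trans := by
        rintro A A' A'' ⟨X, h⟩ ⟨X', h'⟩
        exact ⟨X * X', by rw [h', h, Matrix.mul_assoc, Units.val_mul]⟩ }

/-- The full-rank model: `n × k` matrices of rank `k` modulo `GL(k)`, with the quotient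
topology. -/
abbrev FullRankModel (n k : ℕ) : Type := Quotient (fullRankSetoid n k)

/-- The projection model. -/
def projectionModel (n k : ℕ) : Set (Matrix (Fin n) (Fin n) ℝ) :=
  {P | Pᵀ = P ∧ P ^ 2 = P ∧ P.trace = k}

/-- The involution model. -/
def involutionModel (n k : ℕ) : Set (Matrix (Fin n) (Fin n) ℝ) :=
  {Q | Q ∈ Matrix.orthogonalGroup (Fin n) ℝ ∧ Qᵀ = Q ∧ Q.trace = 2 * (k : ℝ) - n}

/-! ### The Riemannian structures of the five models -/

section

/-
Spaces of matrices are regarded as manifolds through a norm. All norms define the same smooth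
structure, and no metric below is derived from the norm.
-/
attribute [local instance] Matrix.normedAddCommGroup Matrix.normedSpace

/-- The standard Riemannian structure of the orthogonal model: the quotient metric of the metric
`½ tr(Xᵀ Y)` on `O(n)`. Horizontal vectors at `V` are the `V [0, B; -Bᵀ, 0]`, and the inner
product of two of them, given by `B₁` and `B₂`, is `tr(B₁ᵀ B₂)`. -/
def IsOrthogonalMetric {n k : ℕ} (h : k ≤ n)
    (R : RiemannianStructure (k * (n - k)) (OrthogonalModel h)) : Prop :=
  ∃ (d : ℕ) (T : RiemannianStructure d (Matrix.orthogonalGroup (Fin n) ℝ)),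
    T.IsInduced (fun V ↦ (V : Matrix (Fin n) (Fin n) ℝ))
      (fun _ X Y ↦ (1 / 2 : ℝ) * (Xᵀ * Y).trace) ∧
    T.IsRiemannianSubmersion R (fun V ↦ (V : OrthogonalModel h))

/-- The standard Riemannian structure of the Stiefel model: the quotient metric of the metric
`tr(Xᵀ Y)` on `V(k,n)`. -/
def IsStiefelMetric {n k : ℕ} (R : RiemannianStructure (k * (n - k)) (StiefelModel n k)) : Prop :=
  ∃ (d : ℕ) (T : RiemannianStructure d (stiefel n k)),
    T.IsInduced (fun Y ↦ (Y : Matrix (Fin n) (Fin k) ℝ)) (fun _ X Y ↦ (Xᵀ * Y).trace) ∧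
    T.IsRiemannianSubmersion R (fun Y ↦ (⟦Y⟧ : StiefelModel n k))

/-- The standard Riemannian structure of the full-rank model: the quotient metric of the metric
`tr((Aᵀ A)⁻¹ Xᵀ Y)` at `A` on the manifold of `n × k` matrices of rank `k`. -/
def IsFullRankMetric {n k : ℕ} (R : RiemannianStructure (k * (n - k)) (FullRankModel n k)) :
    Prop :=
  ∃ (d : ℕ) (T : RiemannianStructure d (fullRank n k)),
    T.IsInduced (fun A ↦ (A : Matrix (Fin n) (Fin k) ℝ))
      (fun A X Y ↦ ((Aᵀ * A)⁻¹ * (Xᵀ * Y)).trace) ∧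
    T.IsRiemannianSubmersion R (fun A ↦ (⟦A⟧ : FullRankModel n k))

/-- The standard Riemannian structure of the projection model: the embedded submanifold, with the
metric `tr(X Y)`. -/
def IsProjectionMetric {n k : ℕ} (R : RiemannianStructure (k * (n - k)) (projectionModel n k)) :
    Prop :=
  R.IsInduced (fun P ↦ (P : Matrix (Fin n) (Fin n) ℝ)) (fun _ X Y ↦ (X * Y).trace)

/-- The Riemannian structure of the involution model: the embedded submanifold, with the metric
`tr(X Y)`. -/
def IsInvolutionMetric {n k : ℕ} (R : RiemannianStructure (k * (n - k)) (involutionModel n k)) :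
    Prop :=
  R.IsInduced (fun Q ↦ (Q : Matrix (Fin n) (Fin n) ℝ)) (fun _ X Y ↦ (X * Y).trace)

end

/-! ### Local normal forms of smooth maps: immersions, submersions, local sections. -/

section SmoothMaps

open Manifold Set Topology Function

variable {E F : Type*} [NormedAddCommGroup E] [NormedSpace ℝ E] [NormedAddCommGroup F]
  [NormedSpace ℝ F]

/-! Every model is compared with the involution model `I`. A symmetric orthogonal `Q` is `2P - 1`
for an orthogonal projection `P`, and the trace condition says that `P` has rank `k`; this affine
change of variable doubles tangent vectors, hence the constant 4 for the projection model.

Each quotient model is `π : X → M` with `X` a manifold of matrices, and there is an explicit map `ψ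
: X → I` whose fibres are exactly those of `π` (`orthogonalToInvolution_eq_iff`,
`stiefelToInvolution_eq_iff`, `fullRankToInvolution_eq_iff`). So `ψ = φ ∘ π` with `φ` bijective.
Left multiplication by `O(n)` on `X` becomes conjugation on `I`, and every tangent vector of `I` is
the velocity of a conjugation orbit, so `ψ` is a submersion (`submersion_of_equivariant`). Local
sections of submersions then make `φ` and its inverse smooth, and horizontal vectors for `π` and `ψ`
coincide. It remains to compute `dψ` on horizontal vectors, which are orthogonal to the velocities
of curves inside a fibre (the `_form` lemmas).

For `O(n)`, a horizontal `H` at `V` has `Ω = VᵀH` skew and anticommuting with `J = diag(I, -I)`, and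
`dψ(H) = 2HJVᵀ`; hence 4 times `tr(HᵀK)`, which is 8 times the metric. For the other two, a
horizontal `H` at `A` satisfies `AᵀH = 0`. With `N = (AᵀA)⁻¹`, the projection varies by `HNAᵀ +
ANHᵀ`, two orthogonal pieces of equal norm; the factor 2 in `2P - 1` gives `4 · 2 = 8`.

Existence of the quotient metrics uses the same data backwards: `φ` is a homeomorphism, and 1/8 of
the metric of `I` pulled back along `φ` makes `π` a Riemannian submersion
(`RiemannianStructure.exists_isRiemannianSubmersion`). Smooth structures on the matrix manifolds
come from local parametrizations: graph coordinates for projections, a regular level set for the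
Stiefel manifold and `O(n)`, an open set for full-rank matrices. Pairwise isometry follows by
passing through `I`. -/

/-- The inverse function theorem, giving a local diffeomorphism onto an open set. -/
theorem exists_openPartialHomeomorph_of_hasFDerivAt_equiv [CompleteSpace E] {f : E → F} {U : Set E}
    (hU : IsOpen U) {x : E} (hx : x ∈ U) (hf : ContDiffOn ℝ ∞ f U) (f' : E ≃L[ℝ] F)
    (hf' : HasFDerivAt f (f' : E →L[ℝ] F) x) :
    ∃ Φ : OpenPartialHomeomorph E F, x ∈ Φ.source ∧ Φ.source ⊆ U ∧ (∀ y, Φ y = f y) ∧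
      ContDiffOn ℝ ∞ Φ.symm Φ.target := by
  have hfx : ContDiffAt ℝ ∞ f x := hf.contDiffAt (hU.mem_nhds hx)
  let Φ := hfx.toOpenPartialHomeomorph f hf' (by simp)
  -- The inverse function theorem gives a smooth inverse near `f x` only. Shrinking to the open set
  -- where the derivative is invertible makes the inverse smooth on its whole domain.
  let W : Set E := U ∩ fderiv ℝ f ⁻¹' range ((↑) : (E ≃L[ℝ] F) → E →L[ℝ] F)
  have hW : IsOpen W :=
    (hf.continuousOn_fderiv_of_isOpen hU (by simp)).isOpen_inter_preimage hU
      (ContinuousLinearEquiv.isOpen)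
  have hxW : x ∈ W := ⟨hx, f', hf'.fderiv.symm⟩
  refine ⟨Φ.restrOpen W hW, ⟨hfx.mem_toOpenPartialHomeomorph_source hf' (by simp), hxW⟩,
    fun y hy ↦ hy.2.1, fun y ↦ rfl, fun y hy ↦ ContDiffAt.contDiffWithinAt ?_⟩
  have hyW : (Φ.restrOpen W hW).symm y ∈ W := ((Φ.restrOpen W hW).map_target hy).2
  obtain ⟨g', hg'⟩ := hyW.2
  have hc : ContDiffAt ℝ ∞ f ((Φ.restrOpen W hW).symm y) :=
    hf.contDiffAt (hU.mem_nhds hyW.1)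
  refine (Φ.restrOpen W hW).contDiffAt_symm (f₀' := g') hy ?_ hc
  rw [hg']
  exact (hc.differentiableAt (by simp)).hasFDerivAt

theorem OpenPartialHomeomorph.mem_maximalAtlas_self {Φ : OpenPartialHomeomorph E E}
    (h : ContDiffOn ℝ ∞ Φ Φ.source) (h' : ContDiffOn ℝ ∞ Φ.symm Φ.target) :
    Φ ∈ IsManifold.maximalAtlas 𝓘(ℝ, E) ∞ E :=
  Φ.mem_maximalAtlas_of_contMDiffOn h.contMDiffOn h'.contMDiffOn

/-- Composing a chart of the maximal atlas with a diffeomorphism gives a chart of the maximal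
atlas. -/
theorem OpenPartialHomeomorph.trans_mem_maximalAtlas {M : Type*} [TopologicalSpace M]
    [ChartedSpace E M] [IsManifold 𝓘(ℝ, E) ∞ M] {e : OpenPartialHomeomorph M E}
    (he : e ∈ IsManifold.maximalAtlas 𝓘(ℝ, E) ∞ M) {Φ : OpenPartialHomeomorph E E}
    (h : ContDiffOn ℝ ∞ Φ Φ.source) (h' : ContDiffOn ℝ ∞ Φ.symm Φ.target) :
    e.trans Φ ∈ IsManifold.maximalAtlas 𝓘(ℝ, E) ∞ M := by
  refine OpenPartialHomeomorph.mem_maximalAtlas_of_contMDiffOn _ ?_ ?_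
  · exact h.contMDiffOn.comp ((contMDiffOn_of_mem_maximalAtlas he).mono (by simp)) (by simp)
  · exact (contMDiffOn_symm_of_mem_maximalAtlas he).comp (h'.contMDiffOn.mono (by simp)) (by simp)

variable [FiniteDimensional ℝ E] [FiniteDimensional ℝ F]

/-- An injective linear map is, up to a linear equivalence, the inclusion of a factor. -/
theorem LinearMap.exists_equiv_of_injective {C : Type*} [NormedAddCommGroup C] [NormedSpace ℝ C]
    [FiniteDimensional ℝ C] (A : E →L[ℝ] F) (hA : Injective A)
    (hC : Module.finrank ℝ E + Module.finrank ℝ C = Module.finrank ℝ F) :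
    ∃ T : (E × C) ≃L[ℝ] F, ∀ u, T (u, 0) = A u := by
  obtain ⟨K, hK⟩ := Submodule.exists_isCompl (LinearMap.range A.toLinearMap)
  have h1 : Module.finrank ℝ (LinearMap.range A.toLinearMap) = Module.finrank ℝ E :=
    LinearMap.finrank_range_of_inj hA
  have h2 := Submodule.finrank_add_eq_of_isCompl hK
  have h3 : Module.finrank ℝ C = Module.finrank ℝ K := by omega
  let e1 := LinearEquiv.ofInjective A.toLinearMap hA
  let e2 := LinearEquiv.ofFinrankEq C K h3
  let T := (e1.prodCongr e2).trans (Submodule.prodEquivOfIsCompl _ _ hK)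
  refine ⟨T.toContinuousLinearEquiv, fun u ↦ ?_⟩
  simp [T, e1]

/-- A surjective linear map is, up to a linear equivalence, the projection to a factor. -/
theorem LinearMap.exists_equiv_of_surjective {C : Type*} [NormedAddCommGroup C] [NormedSpace ℝ C]
    [FiniteDimensional ℝ C] (A : E →L[ℝ] F) (hA : Surjective A)
    (hC : Module.finrank ℝ F + Module.finrank ℝ C = Module.finrank ℝ E) :
    ∃ T : E ≃L[ℝ] (F × C), ∀ u, (T u).1 = A u := by
  obtain ⟨K, hK⟩ := Submodule.exists_isCompl (LinearMap.ker A.toLinearMap)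
  have h1 := LinearMap.finrank_range_add_finrank_ker A.toLinearMap
  rw [LinearMap.range_eq_top.2 hA, finrank_top] at h1
  have h3 : Module.finrank ℝ (LinearMap.ker A.toLinearMap) = Module.finrank ℝ C := by omega
  let e := LinearEquiv.ofFinrankEq _ C h3
  let p := e.toLinearMap ∘ₗ (LinearMap.ker A.toLinearMap).projectionOnto K hK
  have hbij : Injective (A.toLinearMap.prod p) := by
    rw [← LinearMap.ker_eq_bot, LinearMap.ker_eq_bot']
    intro u hu
    have hu1 : A u = 0 := congrArg Prod.fst hu
    have hu2 : e ((LinearMap.ker A.toLinearMap).projectionOnto K hK u) = 0 := congrArg Prod.snd hu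
    have hu3 := (map_eq_zero_iff e e.injective).1 hu2
    rw [Submodule.projectionOnto_apply_eq_zero_iff] at hu3
    exact (Submodule.disjoint_def.1 hK.disjoint) u hu1 hu3
  let T := LinearEquiv.ofInjectiveOfFinrankEq (A.toLinearMap.prod p) hbij
    (by rw [Module.finrank_prod]; omega)
  exact ⟨T.toContinuousLinearEquiv, fun u ↦ rfl⟩

variable {M N : Type*} [TopologicalSpace M] [ChartedSpace E M] [IsManifold 𝓘(ℝ, E) ∞ M]
  [TopologicalSpace N] [ChartedSpace F N] [IsManifold 𝓘(ℝ, F) ∞ N]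

omit [FiniteDimensional ℝ E] [FiniteDimensional ℝ F] in
/-- A smooth map, read in the preferred charts. -/
theorem ContMDiff.exists_local {f : M → N} (hf : ContMDiff 𝓘(ℝ, E) 𝓘(ℝ, F) ∞ f) (x : M) :
    let g := chartAt F (f x) ∘ f ∘ (chartAt E x).symm
    let U := (chartAt E x).target ∩ (chartAt E x).symm ⁻¹' (f ⁻¹' (chartAt F (f x)).source)
    IsOpen U ∧ chartAt E x x ∈ U ∧ ContDiffOn ℝ ∞ g U ∧
      ∃ A : E →L[ℝ] F, A = mfderiv 𝓘(ℝ, E) 𝓘(ℝ, F) f x ∧ HasFDerivAt g A (chartAt E x x) := by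
  intro g U
  have hU : IsOpen U := (chartAt E x).isOpen_inter_preimage_symm
    ((chartAt F (f x)).open_source.preimage hf.continuous)
  have hx : chartAt E x x ∈ U := by simp [U]
  refine ⟨hU, hx, ?_, mfderiv 𝓘(ℝ, E) 𝓘(ℝ, F) f x, rfl, ?_⟩
  · exact ((contMDiffOn_chart (I := 𝓘(ℝ, F)) (n := ∞) (x := f x)).comp
      ((hf.comp_contMDiffOn (contMDiffOn_chart_symm (I := 𝓘(ℝ, E)) (n := ∞) (x := x))).mono
        inter_subset_left) (fun y hy ↦ hy.2)).contDiffOn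
  · have h := ((hf x).mdifferentiableAt (by simp)).hasMFDerivAt.2
    rw [ModelWithCorners.range_eq_univ] at h
    refine hasFDerivWithinAt_univ.1 ?_
    exact h

/-- A smooth map with injective differential is an immersion. -/
theorem ContMDiff.isImmersionAtOfComplement {C : Type*} [NormedAddCommGroup C] [NormedSpace ℝ C]
    [FiniteDimensional ℝ C] {f : M → F} (hf : ContMDiff 𝓘(ℝ, E) 𝓘(ℝ, F) ∞ f) {x : M}
    (hinj : Injective (mfderiv 𝓘(ℝ, E) 𝓘(ℝ, F) f x))
    (hC : Module.finrank ℝ E + Module.finrank ℝ C = Module.finrank ℝ F) :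
    IsImmersionAtOfComplement C 𝓘(ℝ, E) 𝓘(ℝ, F) ∞ f x := by
  obtain ⟨hU, hxU, hg, A, hA, hg'⟩ := hf.exists_local x
  set g := chartAt F (f x) ∘ f ∘ (chartAt E x).symm
  set U := (chartAt E x).target ∩ (chartAt E x).symm ⁻¹' (f ⁻¹' (chartAt F (f x)).source)
  obtain ⟨T, hT⟩ := LinearMap.exists_equiv_of_injective (C := C) A (hA ▸ hinj) hC
  -- Thickening `g` by a complement of the image of its differential gives a map whose derivative at
  -- the base point is `T`. Its local inverse straightens the image of `g`.
  have hΨ : ContDiffOn ℝ ∞ (fun p : E × C ↦ g p.1 + T (0, p.2)) (U ×ˢ univ) :=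
    (hg.comp contDiff_fst.contDiffOn (fun p hp ↦ hp.1)).add
      (by fun_prop : ContDiff ℝ ∞ fun p : E × C ↦ T (0, p.2)).contDiffOn
  have hΨ' : HasFDerivAt (fun p : E × C ↦ g p.1 + T (0, p.2)) (T : E × C →L[ℝ] F)
      (chartAt E x x, 0) := by
    have h1 : HasFDerivAt (g ∘ Prod.fst) (A ∘L ContinuousLinearMap.fst ℝ E C)
        (chartAt E x x, (0 : C)) :=
      HasFDerivAt.comp (g := g) (chartAt E x x, (0 : C)) hg' hasFDerivAt_fst
    have h2 : HasFDerivAt (fun p : E × C ↦ T (0, p.2)) ((T : E × C →L[ℝ] F) ∘L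
        (ContinuousLinearMap.inr ℝ E C) ∘L (ContinuousLinearMap.snd ℝ E C))
        (chartAt E x x, (0 : C)) :=
      ((T : E × C →L[ℝ] F) ∘L (ContinuousLinearMap.inr ℝ E C) ∘L
        (ContinuousLinearMap.snd ℝ E C)).hasFDerivAt
    refine (h1.add h2).congr_fderiv ?_
    ext p
    · simp [hT]
    · simp
  obtain ⟨Φ, hxΦ, hΦU, hΦ, hΦsymm⟩ := exists_openPartialHomeomorph_of_hasFDerivAt_equiv
    (hU.prod isOpen_univ) (mk_mem_prod hxU (mem_univ (0 : C))) hΨ T hΨ'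
  have hΦfun : ContDiffOn ℝ ∞ Φ Φ.source := (hΨ.mono hΦU).congr fun y _ ↦ hΦ y
  have hfx : f x = Φ (chartAt E x x, 0) := by
    have : T (0, 0) = 0 := map_zero T
    simp [hΦ, g, this]
    rfl
  -- The domain chart is shrunk to the points whose slice `(u, 0)` lies where `Φ` is invertible; the
  -- codomain chart is `T ∘ Φ.symm`.
  let W : Set E := (fun u ↦ (u, (0 : C))) ⁻¹' Φ.source
  have hW : IsOpen W := Φ.open_source.preimage (by fun_prop)
  refine IsImmersionAtOfComplement.mk_of_continuousAt (hf.continuous.continuousAt) T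
    ((chartAt E x).trans (OpenPartialHomeomorph.ofSet W hW))
    (Φ.symm.trans T.toHomeomorph.toOpenPartialHomeomorph) ?_ ?_ ?_ ?_ ?_
  · simpa [W] using hxΦ
  · simpa [hfx] using Φ.map_source hxΦ
  · exact OpenPartialHomeomorph.trans_mem_maximalAtlas (IsManifold.chart_mem_maximalAtlas x)
      contDiff_id.contDiffOn contDiff_id.contDiffOn
  · refine OpenPartialHomeomorph.mem_maximalAtlas_self ?_ ?_
    · exact T.contDiff.comp_contDiffOn (hΦsymm.mono (by simp))
    · refine hΦfun.comp T.symm.contDiff.contDiffOn (fun y hy ↦ ?_)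
      simpa using hy
  · intro u hu
    have huW : (u, (0 : C)) ∈ Φ.source := by
      have : u ∈ (chartAt E x).target ∩ W := by simpa [W, and_comm] using hu
      exact this.2
    have h0 : T (0, 0) = 0 := map_zero T
    have h1 : f ((chartAt E x).symm u) = Φ (u, 0) := by
      simp [hΦ, h0, g]
      rfl
    have h2 : Φ.symm (f ((chartAt E x).symm u)) = (u, 0) := by rw [h1, Φ.left_inv huW]
    simp [h2]

/-- A smooth map with surjective differential is a submersion. -/
theorem ContMDiff.isSubmersionAtOfComplement {C : Type*} [NormedAddCommGroup C] [NormedSpace ℝ C]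
    [FiniteDimensional ℝ C] {f : M → N} (hf : ContMDiff 𝓘(ℝ, E) 𝓘(ℝ, F) ∞ f) {x : M}
    (hsurj : Surjective (mfderiv 𝓘(ℝ, E) 𝓘(ℝ, F) f x))
    (hC : Module.finrank ℝ F + Module.finrank ℝ C = Module.finrank ℝ E) :
    IsSubmersionAtOfComplement C 𝓘(ℝ, E) 𝓘(ℝ, F) ∞ f x := by
  obtain ⟨hU, hxU, hg, A, hA, hg'⟩ := hf.exists_local x
  set g := chartAt F (f x) ∘ f ∘ (chartAt E x).symm
  set U := (chartAt E x).target ∩ (chartAt E x).symm ⁻¹' (f ⁻¹' (chartAt F (f x)).source)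
  obtain ⟨T, hT⟩ := LinearMap.exists_equiv_of_surjective (C := C) A (hA ▸ hsurj) hC
  -- New coordinates on the source: replace the first component of `T u` by `g u`. The derivative at
  -- the base point is the identity, and in these coordinates `g` is a projection.
  have hΨ : ContDiffOn ℝ ∞ (fun u : E ↦ T.symm (g u, (T u).2)) U :=
    T.symm.contDiff.comp_contDiffOn
      (hg.prodMk (by fun_prop : ContDiff ℝ ∞ fun u : E ↦ (T u).2).contDiffOn)
  have hΨ' : HasFDerivAt (fun u : E ↦ T.symm (g u, (T u).2))
      ((ContinuousLinearEquiv.refl ℝ E : E ≃L[ℝ] E) : E →L[ℝ] E) (chartAt E x x) := by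
    have h2 : HasFDerivAt (fun u : E ↦ (T u).2) _ (chartAt E x x) :=
      ((ContinuousLinearMap.snd ℝ F C) ∘L (T : E →L[ℝ] F × C)).hasFDerivAt
    refine ((T.symm : F × C →L[ℝ] E).hasFDerivAt.comp _ (hg'.prodMk h2)).congr_fderiv ?_
    ext u
    apply T.injective
    ext
    · simp [hT]
    · simp
  obtain ⟨Φ, hxΦ, hΦU, hΦ, hΦsymm⟩ := exists_openPartialHomeomorph_of_hasFDerivAt_equiv
    hU hxU hΨ _ hΨ'
  have hΦfun : ContDiffOn ℝ ∞ Φ Φ.source := (hΨ.mono hΦU).congr fun y _ ↦ hΦ y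
  refine IsSubmersionAtOfComplement.mk_of_continuousAt (hf.continuous.continuousAt) T
    ((chartAt E x).trans Φ) (chartAt F (f x)) (by simp [hxΦ]) (mem_chart_source _ _)
    (OpenPartialHomeomorph.trans_mem_maximalAtlas (IsManifold.chart_mem_maximalAtlas x)
      hΦfun hΦsymm) (IsManifold.chart_mem_maximalAtlas _) ?_
  intro v hv
  have hv' : v ∈ Φ.target := by
    simp at hv
    exact hv.1
  have h1 : (T v).1 = g (Φ.symm v) := by
    conv_lhs => rw [← Φ.right_inv hv', hΦ]
    simp
  simp [h1, g]

/-- A smooth map with surjective differential everywhere is a submersion. -/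
theorem ContMDiff.isSubmersion {d e : ℕ} {M N : Type*} [TopologicalSpace M]
    [ChartedSpace (EuclideanSpace ℝ (Fin d)) M] [IsManifold (𝓡 d) ∞ M]
    [TopologicalSpace N] [ChartedSpace (EuclideanSpace ℝ (Fin e)) N] [IsManifold (𝓡 e) ∞ N]
    {f : M → N} (hf : ContMDiff (𝓡 d) (𝓡 e) ∞ f)
    (hsurj : ∀ x, Surjective (mfderiv (𝓡 d) (𝓡 e) f x)) : IsSubmersion (𝓡 d) (𝓡 e) ∞ f := by
  -- The truncated subtraction is harmless: surjectivity at a point `x` forces `e ≤ d`, and without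
  -- points there is nothing to check.
  refine ⟨EuclideanSpace ℝ (Fin (d - e)), inferInstance, inferInstance, fun x ↦ ?_⟩
  refine hf.isSubmersionAtOfComplement (hsurj x) ?_
  let A : EuclideanSpace ℝ (Fin d) →L[ℝ] EuclideanSpace ℝ (Fin e) := mfderiv (𝓡 d) (𝓡 e) f x
  have h := LinearMap.finrank_le_finrank_of_surjective (f := A.toLinearMap) (hsurj x)
  simp only [finrank_euclideanSpace, Fintype.card_fin] at h ⊢
  omega

omit [FiniteDimensional ℝ E] [FiniteDimensional ℝ F] [IsManifold 𝓘(ℝ, E) ∞ M]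
  [IsManifold 𝓘(ℝ, F) ∞ N] in
/-- A submersion has smooth local sections. -/
theorem Manifold.IsSubmersion.exists_localSection {f : M → N}
    (hf : IsSubmersion 𝓘(ℝ, E) 𝓘(ℝ, F) ∞ f) (x : M) :
    ∃ σ : N → M, σ (f x) = x ∧ ContMDiffAt 𝓘(ℝ, F) 𝓘(ℝ, E) ∞ σ (f x) ∧
      ∀ᶠ y in 𝓝 (f x), f (σ y) = y := by
  have h := hf.isSubmersionOfComplement_complement x
  set φ := h.domChart
  set ψ := h.codChart
  -- In adapted charts the section keeps the complementary coordinate frozen at its value at `x`.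
  let s : F → E := fun w ↦ h.equiv.symm (w, (h.equiv (φ x)).2)
  have hs : ContDiff ℝ ∞ s := by fun_prop
  have hx : x ∈ φ.source := h.mem_domChart_source
  have hfx : f x ∈ ψ.source := h.mem_codChart_source
  have hw : ∀ v ∈ φ.target, ψ (f (φ.symm v)) = (h.equiv v).1 := fun v hv ↦ by
    have hv' : v ∈ (h.domChart.extend 𝓘(ℝ, E)).target := by simpa [φ] using hv
    simpa using h.writtenInCharts hv'
  have hsx : s (ψ (f x)) = φ x := by
    have := hw (φ x) (φ.map_source hx)
    rw [φ.left_inv hx] at this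
    simp [s, this]
  have hsmooth : ContMDiffAt 𝓘(ℝ, F) 𝓘(ℝ, E) ∞ (fun y ↦ s (ψ y)) (f x) :=
    hs.contMDiff.contMDiffAt.comp _
      (contMDiffAt_of_mem_maximalAtlas h.codChart_mem_maximalAtlas hfx)
  have htgt : ∀ᶠ y in 𝓝 (f x), s (ψ y) ∈ φ.target :=
    hsmooth.continuousAt.eventually_mem
      (φ.open_target.mem_nhds (by rw [hsx]; exact φ.map_source hx))
  refine ⟨fun y ↦ φ.symm (s (ψ y)), by simp [hsx, φ.left_inv hx], ?_, ?_⟩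
  · refine ContMDiffAt.comp (f x) (g := φ.symm) (I' := 𝓘(ℝ, E)) ?_ hsmooth
    exact contMDiffAt_symm_of_mem_maximalAtlas h.domChart_mem_maximalAtlas
      (by rw [hsx]; exact φ.map_source hx)
  · filter_upwards [htgt, ψ.open_source.mem_nhds hfx] with y hy hyψ
    have h1 := hw _ hy
    have h2 : f (φ.symm (s (ψ y))) ∈ ψ.source := h.source_subset_preimage_source (φ.map_target hy)
    apply ψ.injOn h2 hyψ
    rw [h1]
    simp [s]

end SmoothMaps

/-! ### Induced Riemannian structures on locally parametrized subsets. -/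

section Induced

open Manifold Set Topology Function Bundle

variable {E : Type} [NormedAddCommGroup E] [NormedSpace ℝ E]

/-- By compactness of the unit sphere the form has a positive minimum `m` there, so `B v v ≥ m‖v‖²`.
A Riemannian metric has this boundedness as one of its fields. -/
theorem isVonNBounded_of_pos {F : Type*} [NormedAddCommGroup F] [NormedSpace ℝ F]
    [FiniteDimensional ℝ F] (B : F →L[ℝ] F →L[ℝ] ℝ) (hB : ∀ v, v ≠ 0 → 0 < B v v) :
    Bornology.IsVonNBounded ℝ {v | B v v < 1} := by
  rcases (Metric.sphere (0 : F) 1).eq_empty_or_nonempty with h | h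
  · have h0 : ∀ v : F, v = 0 := by
      intro v
      by_contra hv
      have : ‖v‖⁻¹ • v ∈ Metric.sphere (0 : F) 1 := by simp [norm_smul, hv]
      simp [h] at this
    refine (NormedSpace.isVonNBounded_ball ℝ F 1).subset fun v _ ↦ by simp [h0 v]
  · obtain ⟨w, hw, hmin⟩ := (isCompact_sphere (0 : F) 1).exists_isMinOn h
      (f := fun v ↦ B v v) (B.continuous.clm_apply continuous_id).continuousOn
    have hw0 : w ≠ 0 := by
      rintro rfl
      simp at hw
    set m := B w w
    have hm : 0 < m := hB w hw0
    -- With this radius no square root is needed: outside it both `‖v‖ > 1` and `m‖v‖ > 1`, so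
    -- `m‖v‖² > 1`.
    refine (NormedSpace.isVonNBounded_closedBall ℝ F (max 1 (1 / m))).subset fun v hv ↦ ?_
    rw [mem_closedBall_zero_iff]
    by_contra! hlt
    have hv1 : 1 < ‖v‖ := (le_max_left _ _).trans_lt hlt
    have hv2 : 1 / m < ‖v‖ := (le_max_right _ _).trans_lt hlt
    have hv0 : ‖v‖ ≠ 0 := by positivity
    have hmem : ‖v‖⁻¹ • v ∈ Metric.sphere (0 : F) 1 := by
      simp [norm_smul, norm_ne_zero_iff.1 hv0]
    have h1 : m ≤ ‖v‖⁻¹ * (‖v‖⁻¹ * B v v) := by simpa using hmin hmem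
    have h2 : m * ‖v‖ * ‖v‖ ≤ B v v := by
      have := mul_le_mul_of_nonneg_right h1 (by positivity : 0 ≤ ‖v‖ * ‖v‖)
      calc m * ‖v‖ * ‖v‖ = m * (‖v‖ * ‖v‖) := by ring
        _ ≤ _ := this
        _ = B v v := by field_simp
    have h3 : 1 < m * ‖v‖ := by
      rw [div_lt_iff₀ hm] at hv2
      linarith
    have h4 : B v v < 1 := hv
    nlinarith

/-- A smooth map with injective differential to a normed space pulls back a smooth family of
bilinear forms which is positive definite on tangent vectors to a Riemannian metric. -/
theorem exists_riemannianMetric_pullback {d : ℕ} {M : Type} [TopologicalSpace M]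
    [ChartedSpace (EuclideanSpace ℝ (Fin d)) M] [IsManifold (𝓡 d) ∞ M] {ι : M → E}
    (hι : ContMDiff (𝓡 d) 𝓘(ℝ, E) ∞ ι) {W : Set E} (hW : IsOpen W) (hιW : ∀ x, ι x ∈ W)
    (G : E → E →L[ℝ] E →L[ℝ] ℝ) (hG : ContDiffOn ℝ ∞ G W)
    (hsymm : ∀ x u v, G (ι x) u v = G (ι x) v u)
    (hpos : ∀ (x : M) (u : TangentSpace (𝓡 d) x), u ≠ 0 →
      0 < G (ι x) (mfderiv (𝓡 d) 𝓘(ℝ, E) ι x u) (mfderiv (𝓡 d) 𝓘(ℝ, E) ι x u)) :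
    ∃ g : ContMDiffRiemannianMetric (𝓡 d) ∞ (EuclideanSpace ℝ (Fin d))
      (fun x : M ↦ TangentSpace (𝓡 d) x), ∀ (x : M) (u v : TangentSpace (𝓡 d) x),
      g.inner x u v = G (ι x) (mfderiv (𝓡 d) 𝓘(ℝ, E) ι x u) (mfderiv (𝓡 d) 𝓘(ℝ, E) ι x v) := by
  let A : ∀ x : M, TangentSpace (𝓡 d) x →L[ℝ] E := fun x ↦ mfderiv (𝓡 d) 𝓘(ℝ, E) ι x
  let A' : M → (EuclideanSpace ℝ (Fin d) →L[ℝ] E) := A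
  let B' : M → (EuclideanSpace ℝ (Fin d) →L[ℝ] EuclideanSpace ℝ (Fin d) →L[ℝ] ℝ) :=
    fun x ↦ (G (ι x)).bilinearComp (A' x) (A' x)
  obtain ⟨B, hB⟩ : ∃ B : ∀ x : M, TangentSpace (𝓡 d) x →L[ℝ] TangentSpace (𝓡 d) x →L[ℝ] ℝ,
    ∀ x u v, B x u v = G (ι x) (A x u) (A x v) :=
    ⟨B', fun x u v ↦ rfl⟩
  have hBpos : ∀ x u, u ≠ 0 → 0 < B x u u := fun x u hu ↦ (hB x u u).symm ▸ hpos x u hu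
  have hBsymm : ∀ x u v, B x u v = B x v u := fun x u v ↦ by rw [hB, hB, hsymm]
  have hbdd : ∀ x, Bornology.IsVonNBounded ℝ {v : TangentSpace (𝓡 d) x | B x v v < 1} :=
    fun x ↦ isVonNBounded_of_pos (F := EuclideanSpace ℝ (Fin d)) (B x) (hBpos x)
  refine ⟨{ inner := B
            symm := hBsymm
            pos := hBpos
            isVonNBounded := hbdd
            contMDiff := ?_ }, hB⟩
  intro x₀
  rw [contMDiffAt_section]
  -- In a trivialization the metric is `G ∘ ι` precomposed in both arguments with the differential
  -- of `ι` in tangent coordinates, and each ingredient is smooth.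
  have hA : ContMDiffAt (𝓡 d) 𝓘(ℝ, EuclideanSpace ℝ (Fin d) →L[ℝ] E) ∞
      (inTangentCoordinates (𝓡 d) 𝓘(ℝ, E) id ι (fun x ↦ mfderiv (𝓡 d) 𝓘(ℝ, E) ι x) x₀) x₀ :=
    (hι x₀).mfderiv_const (by simp)
  have hGι : ContMDiffAt (𝓡 d) 𝓘(ℝ, E →L[ℝ] E →L[ℝ] ℝ) ∞ (fun x ↦ G (ι x)) x₀ :=
    ((hG.contDiffAt (hW.mem_nhds (hιW x₀))).contMDiffAt).comp x₀ (hι x₀)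
  have h1 := hGι.clm_comp hA
  have h2 : ContMDiffAt (𝓡 d) 𝓘(ℝ, (E →L[ℝ] ℝ) →L[ℝ] (EuclideanSpace ℝ (Fin d) →L[ℝ] ℝ)) ∞
      (fun x ↦ (ContinuousLinearMap.compL ℝ (EuclideanSpace ℝ (Fin d)) E ℝ).flip
        (inTangentCoordinates (𝓡 d) 𝓘(ℝ, E) id ι (fun x ↦ mfderiv (𝓡 d) 𝓘(ℝ, E) ι x) x₀ x)) x₀ :=
    (ContinuousLinearMap.contMDiff _).contMDiffAt.comp x₀ hA
  refine (h2.clm_comp h1).congr_of_eventuallyEq ?_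
  filter_upwards [(trivializationAt (EuclideanSpace ℝ (Fin d)) (TangentSpace (𝓡 d))
    x₀).open_baseSet.mem_nhds (mem_baseSet_trivializationAt _ _ x₀)] with x hx
  ext u v
  have hx' : x ∈ (trivializationAt (EuclideanSpace ℝ (Fin d) →L[ℝ] ℝ)
      (fun x ↦ TangentSpace (𝓡 d) x →L[ℝ] ℝ) x₀).baseSet := by
    rw [hom_trivializationAt_baseSet]
    exact ⟨hx, by simp⟩
  have hT : ∀ w, inTangentCoordinates (𝓡 d) 𝓘(ℝ, E) id ι (fun x ↦ mfderiv (𝓡 d) 𝓘(ℝ, E) ι x) x₀ x w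
      = A x ((trivializationAt (EuclideanSpace ℝ (Fin d)) (TangentSpace (𝓡 d)) x₀).symmL ℝ x w) := by
    intro w
    simp [ContinuousLinearMap.inCoordinates, inTangentCoordinates]
    rfl
  simp only [hom_trivializationAt_apply, ContinuousLinearMap.inCoordinates,
    ContinuousLinearMap.comp_apply, Trivialization.continuousLinearMapAt_apply,
    Trivialization.coe_linearMapAt_of_mem _ hx', ContinuousLinearMap.flip_apply,
    ContinuousLinearMap.compL_apply, hT]
  simp [hB]

/-- `S` is locally parametrized, by smooth maps which have a smooth left inverse defined on an
open subset of the ambient space. -/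
def IsLocallyParametrized (d : ℕ) (S : Set E) : Prop :=
  ∀ p ∈ S, ∃ (U : Set E) (V : Set (EuclideanSpace ℝ (Fin d))) (l : E → EuclideanSpace ℝ (Fin d))
    (ψ : EuclideanSpace ℝ (Fin d) → E), IsOpen U ∧ p ∈ U ∧ IsOpen V ∧ ContDiffOn ℝ ∞ l U ∧
    ContDiffOn ℝ ∞ ψ V ∧ MapsTo ψ V (S ∩ U) ∧ MapsTo l (S ∩ U) V ∧ (∀ v ∈ V, l (ψ v) = v) ∧
    ∀ q ∈ S ∩ U, ψ (l q) = q

variable {d : ℕ} {M : Type} [TopologicalSpace M]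

/-- The chart is `l ∘ ι`, with inverse `ψ` read in `M`. The last clause records that it is the
restriction of a smooth map of the ambient space; transition maps are smooth for this reason. -/
theorem IsLocallyParametrized.exists_chart {ι : M → E} (hι : IsEmbedding ι)
    (h : IsLocallyParametrized d (range ι)) (x : M) :
    ∃ e : OpenPartialHomeomorph M (EuclideanSpace ℝ (Fin d)), x ∈ e.source ∧
      ContDiffOn ℝ ∞ (ι ∘ e.symm) e.target ∧ ∃ (l : E → EuclideanSpace ℝ (Fin d)) (U : Set E),
      IsOpen U ∧ ContDiffOn ℝ ∞ l U ∧ ∀ y ∈ e.source, ι y ∈ U ∧ e y = l (ι y) := by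
  obtain ⟨U, V, l, ψ, hU, hxU, hV, hl, hψ, hψV, hlS, hlψ, hψl⟩ := h (ι x) (mem_range_self x)
  have : Nonempty M := ⟨x⟩
  have hinv : ∀ v ∈ V, ι (invFun ι (ψ v)) = ψ v := fun v hv ↦ invFun_eq (hψV hv).1
  let e : OpenPartialHomeomorph M (EuclideanSpace ℝ (Fin d)) :=
    { toFun := l ∘ ι
      invFun := invFun ι ∘ ψ
      source := ι ⁻¹' U
      target := V
      map_source' := fun y hy ↦ hlS ⟨mem_range_self y, hy⟩
      map_target' := fun v hv ↦ by
        simp only [comp_apply, mem_preimage, hinv v hv]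
        exact (hψV hv).2
      left_inv' := fun y hy ↦ by
        simp only [comp_apply, hψl _ ⟨mem_range_self y, hy⟩]
        exact leftInverse_invFun hι.injective y
      right_inv' := fun v hv ↦ by simp only [comp_apply, hinv v hv, hlψ v hv]
      open_source := hU.preimage hι.continuous
      open_target := hV
      continuousOn_toFun := hl.continuousOn.comp hι.continuous.continuousOn fun y hy ↦ hy
      continuousOn_invFun := by
        rw [hι.isInducing.continuousOn_iff]
        exact hψ.continuousOn.congr fun v hv ↦ hinv v hv }
  exact ⟨e, hxU, hψ.congr fun v hv ↦ hinv v hv, l, U, hU, hl, fun y hy ↦ ⟨hy, rfl⟩⟩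

/-- A locally parametrized subset of a normed space is a smoothly immersed manifold. -/
theorem IsLocallyParametrized.exists_chartedSpace {ι : M → E} (hι : IsEmbedding ι)
    (h : IsLocallyParametrized d (range ι)) :
    ∃ _ : ChartedSpace (EuclideanSpace ℝ (Fin d)) M, IsManifold (𝓡 d) ∞ M ∧
      ContMDiff (𝓡 d) 𝓘(ℝ, E) ∞ ι ∧ ∀ x, Injective (mfderiv (𝓡 d) 𝓘(ℝ, E) ι x) := by
  choose e hxe hιe l U hU hl hel using h.exists_chart hι
  let C : ChartedSpace (EuclideanSpace ℝ (Fin d)) M :=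
    { atlas := range e
      chartAt := e
      mem_chart_source := hxe
      chart_mem_atlas := mem_range_self }
  have hM : IsManifold (𝓡 d) ∞ M := by
    refine isManifold_of_contDiffOn _ _ _ ?_
    rintro _ _ ⟨x, rfl⟩ ⟨y, rfl⟩
    have : ContDiffOn ℝ ∞ (l y ∘ (ι ∘ (e x).symm)) ((e x).symm.trans (e y)).source := by
      refine (hl y).comp ((hιe x).mono (by simp)) fun v hv ↦ (hel y _ ?_).1
      simpa using hv.2
    refine (this.congr fun v hv ↦ ?_).mono (by simp)
    exact (hel y _ (by simpa using hv.2)).2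
  have hC : ∀ x, chartAt (EuclideanSpace ℝ (Fin d)) x = e x := fun _ ↦ rfl
  have hsmooth : ContMDiff (𝓡 d) 𝓘(ℝ, E) ∞ ι := by
    intro x
    have h1 : ContMDiffOn (𝓡 d) 𝓘(ℝ, E) ∞ ((ι ∘ (e x).symm) ∘ e x) (e x).source :=
      (hιe x).contMDiffOn.comp (contMDiffOn_chart (x := x)) fun y hy ↦ (e x).map_source hy
    refine (h1.congr fun y hy ↦ ?_).contMDiffAt ((e x).open_source.mem_nhds (hxe x))
    simp [(e x).left_inv hy]
  refine ⟨C, hM, hsmooth, fun x ↦ ?_⟩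
  obtain ⟨-, hx, -, A, hA, hA'⟩ := hsmooth.exists_local x
  have h1 : HasFDerivAt (ι ∘ (e x).symm) A (e x x) := hA'
  have h2 : HasFDerivAt (l x) (fderiv ℝ (l x) (ι x)) ((ι ∘ (e x).symm) (e x x)) := by
    simp only [comp_apply, (e x).left_inv (hxe x)]
    exact (((hl x).contDiffAt ((hU x).mem_nhds (hel x x (hxe x)).1)).differentiableAt
      (by simp)).hasFDerivAt
  -- Near the base point `l x` inverts the parametrization, so by the chain rule its derivative is a
  -- left inverse of `A`.
  have h3 : HasFDerivAt (l x ∘ (ι ∘ (e x).symm)) (ContinuousLinearMap.id ℝ _) (e x x) := by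
    refine (hasFDerivAt_id (e x x)).congr_of_eventuallyEq ?_
    filter_upwards [(e x).open_target.mem_nhds ((e x).map_source (hxe x))] with v hv
    have := (hel x _ ((e x).map_target hv)).2
    simp only [comp_apply, id, ← this, (e x).right_inv hv]
  have h4 := (h2.comp _ h1).unique h3
  have : Injective A := LeftInverse.injective (g := fderiv ℝ (l x) (ι x))
    fun u ↦ DFunLike.congr_fun h4 u
  exact hA ▸ this

variable [FiniteDimensional ℝ E]

/-- A smooth map with injective differential which is a topological embedding is a smooth
embedding. -/
theorem ContMDiff.isSmoothEmbedding [ChartedSpace (EuclideanSpace ℝ (Fin d)) M]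
    [IsManifold (𝓡 d) ∞ M] {ι : M → E} (hι : ContMDiff (𝓡 d) 𝓘(ℝ, E) ∞ ι)
    (hinj : ∀ x, Injective (mfderiv (𝓡 d) 𝓘(ℝ, E) ι x)) (he : IsEmbedding ι) :
    IsSmoothEmbedding (𝓡 d) 𝓘(ℝ, E) ∞ ι := by
  refine ⟨IsImmersionOfComplement.isImmersion
    (F := EuclideanSpace ℝ (Fin (Module.finrank ℝ E - d))) fun x ↦ ?_, he⟩
  refine hι.isImmersionAtOfComplement (hinj x) ?_
  let A : EuclideanSpace ℝ (Fin d) →L[ℝ] E := mfderiv (𝓡 d) 𝓘(ℝ, E) ι x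
  have h := LinearMap.finrank_le_finrank_of_injective (f := A.toLinearMap) (hinj x)
  simp only [finrank_euclideanSpace, Fintype.card_fin] at h ⊢
  omega

/-- An embedding with locally parametrized range induces a Riemannian structure. -/
theorem IsLocallyParametrized.exists_isInduced {ι : M → E} (hι : IsEmbedding ι)
    (h : IsLocallyParametrized d (range ι)) {W : Set E} (hW : IsOpen W) (hιW : ∀ x, ι x ∈ W)
    (G : E → E →L[ℝ] E →L[ℝ] ℝ) (hG : ContDiffOn ℝ ∞ G W)
    (hsymm : ∀ x u v, G (ι x) u v = G (ι x) v u) (hpos : ∀ x u, u ≠ 0 → 0 < G (ι x) u u) :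
    ∃ R : RiemannianStructure d M, R.IsInduced ι (fun p u v ↦ G p u v) := by
  obtain ⟨_, hM, hsmooth, hinj⟩ := h.exists_chartedSpace hι
  obtain ⟨g, hg⟩ := exists_riemannianMetric_pullback hsmooth hW hιW G hG hsymm
    fun x u hu ↦ hpos x _ ((map_ne_zero_iff _ (hinj x)).2 hu)
  exact ⟨⟨_, hM, g⟩, hsmooth.isSmoothEmbedding hinj hι, hg⟩

end Induced

/-! ### Calculus of Riemannian structures: horizontal vectors, scaled isometries, Riemannian
submersions. -/

namespace RiemannianStructure

open Manifold Set Topology Function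

variable {d e m : ℕ} {M N X : Type} [TopologicalSpace M] [TopologicalSpace N] [TopologicalSpace X]
  {E F : Type} [NormedAddCommGroup E] [NormedSpace ℝ E] [NormedAddCommGroup F] [NormedSpace ℝ F]

/-- Smoothness of a map between Riemannian manifolds. -/
def Smooth (R : RiemannianStructure d M) (S : RiemannianStructure e N) (f : M → N) : Prop :=
  letI := R.charted
  letI := S.charted
  ContMDiff (𝓡 d) (𝓡 e) ∞ f

/-- Smoothness of a map to a normed space. -/
def SmoothTo (R : RiemannianStructure d M) (f : M → E) : Prop :=
  letI := R.charted
  ContMDiff (𝓡 d) 𝓘(ℝ, E) ∞ f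

/-- The differential of a map between Riemannian manifolds. -/
noncomputable def differential (R : RiemannianStructure d M) (S : RiemannianStructure e N)
    (f : M → N) (x : M) : EuclideanSpace ℝ (Fin d) →L[ℝ] EuclideanSpace ℝ (Fin e) :=
  letI := R.charted
  letI := S.charted
  mfderiv (𝓡 d) (𝓡 e) f x

/-- The differential of a map to a normed space. -/
noncomputable def differentialTo (R : RiemannianStructure d M) (f : M → E) (x : M) :
    EuclideanSpace ℝ (Fin d) →L[ℝ] E :=
  letI := R.charted
  mfderiv (𝓡 d) 𝓘(ℝ, E) f x

/-- The metric, as a function on the model space. -/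
noncomputable def form (R : RiemannianStructure d M) (x : M) :
    EuclideanSpace ℝ (Fin d) →L[ℝ] EuclideanSpace ℝ (Fin d) →L[ℝ] ℝ :=
  letI := R.charted
  letI := R.isManifold
  R.metric.inner x

variable {R : RiemannianStructure d M} {S : RiemannianStructure e N} {T : RiemannianStructure m X}

theorem form_symm (R : RiemannianStructure d M) (x : M) (u v : EuclideanSpace ℝ (Fin d)) :
    R.form x u v = R.form x v u :=
  let := R.charted
  let := R.isManifold
  R.metric.symm x u v

theorem form_pos (R : RiemannianStructure d M) (x : M) {u : EuclideanSpace ℝ (Fin d)}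
    (hu : u ≠ 0) : 0 < R.form x u u :=
  let := R.charted
  let := R.isManifold
  R.metric.pos x u hu

theorem Smooth.continuous {f : M → N} (hf : R.Smooth S f) : Continuous f :=
  let := R.charted
  let := S.charted
  ContMDiff.continuous (I := 𝓡 d) (I' := 𝓡 e) hf

theorem Smooth.comp {f : M → N} {g : N → X} (hg : S.Smooth T g) (hf : R.Smooth S f) :
    R.Smooth T (g ∘ f) :=
  let := R.charted
  let := S.charted
  let := T.charted
  ContMDiff.comp (I := 𝓡 d) (I' := 𝓡 e) (I'' := 𝓡 m) hg hf

theorem SmoothTo.comp {f : M → N} {g : N → E} (hg : S.SmoothTo g) (hf : R.Smooth S f) :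
    R.SmoothTo (g ∘ f) :=
  let := R.charted
  let := S.charted
  ContMDiff.comp (I := 𝓡 d) (I' := 𝓡 e) hg hf

theorem SmoothTo.contDiffOn_comp {f : M → E} {g : E → F} {U : Set E} (hg : ContDiffOn ℝ ∞ g U)
    (hU : IsOpen U) (hf : R.SmoothTo f) (h : ∀ x, f x ∈ U) : R.SmoothTo (g ∘ f) := by
  let := R.charted
  intro x
  exact (hg.contDiffAt (hU.mem_nhds (h x))).contMDiffAt.comp x (hf x)

theorem SmoothTo.contDiff_comp {f : M → E} {g : E → F} (hg : ContDiff ℝ ∞ g)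
    (hf : R.SmoothTo f) : R.SmoothTo (g ∘ f) :=
  hf.contDiffOn_comp hg.contDiffOn isOpen_univ fun _ ↦ mem_univ _

theorem differential_comp {f : M → N} {g : N → X} (hg : S.Smooth T g) (hf : R.Smooth S f) (x : M) :
    R.differential T (g ∘ f) x = S.differential T g (f x) ∘L R.differential S f x :=
  let := R.charted
  let := S.charted
  let := T.charted
  mfderiv_comp (I := 𝓡 d) (I' := 𝓡 e) (I'' := 𝓡 m) x ((hg _).mdifferentiableAt (by simp))
    ((hf _).mdifferentiableAt (by simp))

theorem differentialTo_comp {f : M → N} {g : N → E} (hg : S.SmoothTo g) (hf : R.Smooth S f)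
    (x : M) : R.differentialTo (g ∘ f) x = S.differentialTo g (f x) ∘L R.differential S f x :=
  let := R.charted
  let := S.charted
  mfderiv_comp (I := 𝓡 d) (I' := 𝓡 e) x ((hg _).mdifferentiableAt (by simp))
    ((hf _).mdifferentiableAt (by simp))

theorem differentialTo_contDiff_comp {f : M → E} {g : E → F} (hg : ContDiff ℝ ∞ g)
    (hf : R.SmoothTo f) (x : M) :
    R.differentialTo (g ∘ f) x = fderiv ℝ g (f x) ∘L R.differentialTo f x := by
  let := R.charted
  have h := mfderiv_comp (I := 𝓡 d) (I' := 𝓘(ℝ, E)) (I'' := 𝓘(ℝ, F)) x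
    (hg.contMDiff.contMDiffAt.mdifferentiableAt (by simp)) ((hf x).mdifferentiableAt (by simp))
  rw [mfderiv_eq_fderiv] at h
  exact h

theorem differential_id (x : M) : R.differential R id x = ContinuousLinearMap.id ℝ _ :=
  let := R.charted
  mfderiv_id (I := 𝓡 d)

/-- Every tangent vector is the velocity of a curve. -/
theorem exists_curve (R : RiemannianStructure d M) (x : M) (u : EuclideanSpace ℝ (Fin d)) :
    ∃ c : ℝ → M, c 0 = x ∧ ∀ {E : Type} [NormedAddCommGroup E] [NormedSpace ℝ E] (f : M → E),
      R.SmoothTo f → HasDerivAt (f ∘ c) (R.differentialTo f x u) 0 := by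
  let := R.charted
  let := R.isManifold
  -- A straight line in the chart. It may leave the target of the chart for large `t`, but only its
  -- germ at 0 matters.
  refine ⟨fun t ↦ (chartAt (EuclideanSpace ℝ (Fin d)) x).symm (chartAt _ x x + t • u), by simp, ?_⟩
  intro E _ _ f hf
  obtain ⟨-, -, -, A, hA, hA'⟩ := ContMDiff.exists_local hf x
  have h1 : HasDerivAt (fun t : ℝ ↦ chartAt (EuclideanSpace ℝ (Fin d)) x x + t • u) u 0 := by
    simpa using ((hasDerivAt_id (0 : ℝ)).smul_const u).const_add
      (chartAt (EuclideanSpace ℝ (Fin d)) x x)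
  have h2 := HasFDerivAt.comp_hasDerivAt (0 : ℝ) (l := f ∘ (chartAt _ x).symm) (l' := A)
    (by simp only [zero_smul, add_zero]; exact hA') h1
  rw [hA] at h2
  exact h2

variable {ι : M → E} {G : E → E → E → ℝ}

theorem IsInduced.smoothTo (h : R.IsInduced ι G) : R.SmoothTo ι :=
  let := R.charted
  let := R.isManifold
  IsSmoothEmbedding.contMDiff h.1

theorem IsInduced.isEmbedding (h : R.IsInduced ι G) : IsEmbedding ι :=
  let := R.charted
  let := R.isManifold
  IsSmoothEmbedding.isEmbedding h.1

theorem IsInduced.form_eq (h : R.IsInduced ι G) (x : M) (u v : EuclideanSpace ℝ (Fin d)) :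
    R.form x u v = G (ι x) (R.differentialTo ι x u) (R.differentialTo ι x v) :=
  h.2 x u v

/-- An immersion reflects smoothness of continuous maps, and a topological embedding reflects
continuity. Smoothness into a model is thus checked on matrices. -/
theorem IsInduced.smooth_iff (h : R.IsInduced ι G) {f : N → M} :
    S.Smooth R f ↔ S.SmoothTo (ι ∘ f) := by
  let := R.charted
  let := R.isManifold
  let := S.charted
  let := S.isManifold
  refine ⟨fun hf ↦ h.smoothTo.comp hf, fun hf ↦ ?_⟩
  have hc : Continuous f := h.isEmbedding.continuous_iff.2 (ContMDiff.continuous (I := 𝓡 e) hf)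
  exact (ContMDiff.iff_comp_isImmersion (I := 𝓡 e) (IsSmoothEmbedding.isImmersion h.1)).2 ⟨hc, hf⟩

/-- A curve which is smooth in the ambient space has a velocity. -/
theorem IsInduced.exists_velocity (h : R.IsInduced ι G) {c : ℝ → M} (hc : ContDiff ℝ ∞ (ι ∘ c)) :
    ∃ u : EuclideanSpace ℝ (Fin d), ∀ {E : Type} [NormedAddCommGroup E] [NormedSpace ℝ E]
      (f : M → E), R.SmoothTo f → HasDerivAt (f ∘ c) (R.differentialTo f (c 0) u) 0 := by
  let := R.charted
  let := R.isManifold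
  have hcont : Continuous c := h.isEmbedding.continuous_iff.2 hc.continuous
  have hsm : ContMDiff 𝓘(ℝ, ℝ) (𝓡 d) ∞ c :=
    (ContMDiff.iff_comp_isImmersion (IsSmoothEmbedding.isImmersion h.1)).2 ⟨hcont, hc.contMDiff⟩
  let A : ℝ →L[ℝ] EuclideanSpace ℝ (Fin d) := mfderiv 𝓘(ℝ, ℝ) (𝓡 d) c 0
  refine ⟨A 1, fun {E} _ _ f hf ↦ ?_⟩
  have hfc : MDifferentiableAt 𝓘(ℝ, ℝ) 𝓘(ℝ, E) (f ∘ c) 0 :=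
    (ContMDiff.comp (I := 𝓘(ℝ, ℝ)) (I' := 𝓡 d) (I'' := 𝓘(ℝ, E)) hf hsm 0).mdifferentiableAt
      (by simp)
  have h1 := mfderiv_comp (I := 𝓘(ℝ, ℝ)) (I' := 𝓡 d) (I'' := 𝓘(ℝ, E)) (0 : ℝ)
    ((hf (c 0)).mdifferentiableAt (by simp)) ((hsm 0).mdifferentiableAt (by simp))
  rw [mfderiv_eq_fderiv] at h1
  have h2 : fderiv ℝ (f ∘ c) 0 = R.differentialTo f (c 0) ∘L A := h1
  have h3 := hfc.differentiableAt.hasFDerivAt.hasDerivAt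
  rw [h2] at h3
  exact h3

/-- Positivity of the metric forces this: a nonzero vector killed by the differential would have
length zero. -/
theorem IsInduced.differentialTo_injective (h : R.IsInduced ι G)
    (hG : ∀ p v, G p 0 v = 0) (x : M) : Injective (R.differentialTo ι x) := by
  rw [injective_iff_map_eq_zero]
  intro u hu
  by_contra hne
  have := R.form_pos x hne
  rw [h.form_eq, hu, hG] at this
  exact lt_irrefl _ this

/-- The form may be changed away from pairs of tangent vectors. -/
theorem IsInduced.congr {G' : E → E → E → ℝ} (h : R.IsInduced ι G)
    (hG : ∀ x u v, G (ι x) (R.differentialTo ι x u) (R.differentialTo ι x v) =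
      G' (ι x) (R.differentialTo ι x u) (R.differentialTo ι x v)) : R.IsInduced ι G' :=
  ⟨h.1, fun x u v ↦ (h.2 x u v).trans (hG x u v)⟩

theorem isScaledIsometry_of_smooth {c : ℝ} {f : M → N} {g : N → M} (hf : R.Smooth S f)
    (hg : S.Smooth R g) (hgf : LeftInverse g f) (hfg : RightInverse g f)
    (h : ∀ x u v, S.form (f x) (R.differential S f x u) (R.differential S f x v) =
      c * R.form x u v) : R.IsScaledIsometry S c f :=
  let := R.charted
  let := S.charted
  ⟨⟨{ toFun := f, invFun := g, left_inv := hgf, right_inv := hfg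
      contMDiff_toFun := hf, contMDiff_invFun := hg }, rfl⟩, h⟩

theorem IsScaledIsometry.exists_smooth_inverse {c : ℝ} {f : M → N}
    (h : R.IsScaledIsometry S c f) : R.Smooth S f ∧ ∃ g : N → M, S.Smooth R g ∧
      LeftInverse g f ∧ RightInverse g f := by
  let := R.charted
  let := S.charted
  obtain ⟨⟨Φ, hΦ⟩, -⟩ := h
  subst hΦ
  exact ⟨Φ.contMDiff_toFun, Φ.symm, Φ.contMDiff_invFun, Φ.left_inv, Φ.right_inv⟩

theorem IsScaledIsometry.form_eq {c : ℝ} {f : M → N} (h : R.IsScaledIsometry S c f) (x : M)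
    (u v : EuclideanSpace ℝ (Fin d)) :
    S.form (f x) (R.differential S f x u) (R.differential S f x v) = c * R.form x u v :=
  h.2 x u v

theorem differential_leftInverse {f : M → N} {g : N → M} (hf : R.Smooth S f) (hg : S.Smooth R g)
    (hgf : LeftInverse g f) (x : M) (u : EuclideanSpace ℝ (Fin d)) :
    S.differential R g (f x) (R.differential S f x u) = u := by
  have h := differential_comp hg hf x
  rw [hgf.comp_eq_id, differential_id] at h
  exact (DFunLike.congr_fun h u).symm

theorem IsScaledIsometry.exists_symm {c : ℝ} (hc : c ≠ 0) {f : M → N}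
    (h : R.IsScaledIsometry S c f) : ∃ g, S.IsScaledIsometry R c⁻¹ g := by
  obtain ⟨hf, g, hg, hgf, hfg⟩ := h.exists_smooth_inverse
  refine ⟨g, isScaledIsometry_of_smooth hg hf hfg hgf fun y u v ↦ ?_⟩
  have h1 := h.form_eq (g y) (S.differential R g y u) (S.differential R g y v)
  rw [differential_leftInverse hg hf hfg, differential_leftInverse hg hf hfg, hfg y] at h1
  rw [h1, inv_mul_cancel_left₀ hc]

theorem IsScaledIsometry.trans {c c' : ℝ} {f : M → N} {g : N → X} (h : R.IsScaledIsometry S c f)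
    (h' : S.IsScaledIsometry T c' g) : R.IsScaledIsometry T (c' * c) (g ∘ f) := by
  obtain ⟨hf, f', hf', hff', hff''⟩ := h.exists_smooth_inverse
  obtain ⟨hg, g', hg', hgg', hgg''⟩ := h'.exists_smooth_inverse
  refine isScaledIsometry_of_smooth (hg.comp hf) (hf'.comp hg') (fun x ↦ by simp [hgg' _, hff' _])
    (fun x ↦ by simp [hff'' _, hgg'' _]) fun x u v ↦ ?_
  rw [differential_comp hg hf]
  simp only [ContinuousLinearMap.comp_apply, comp_apply]
  rw [h'.form_eq, h.form_eq, mul_assoc]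

theorem IsScaledIsometry.refl (R : RiemannianStructure d M) : R.IsScaledIsometry R 1 id := by
  let := R.charted
  refine isScaledIsometry_of_smooth (g := id) (contMDiff_id (I := 𝓡 d)) (contMDiff_id (I := 𝓡 d))
    (fun _ ↦ rfl) (fun _ ↦ rfl) fun x u v ↦ ?_
  simp [differential_id]

/-- Two embedded manifolds which correspond to each other under smooth maps of the ambient spaces
are isometric up to a constant, if their metrics correspond. -/
theorem IsInduced.isScaledIsometry {κ : N → F} {H : F → F → F → ℝ} (hR : R.IsInduced ι G)
    (hS : S.IsInduced κ H) {f : M → N} {g : N → M} {a : E → F} {b : F → E} (ha : ContDiff ℝ ∞ a)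
    (hb : ContDiff ℝ ∞ b) (hf : ∀ x, κ (f x) = a (ι x)) (hg : ∀ y, ι (g y) = b (κ y))
    (hba : LeftInverse b a) (hab : RightInverse b a) {c : ℝ}
    (h : ∀ p u v, H (a p) (fderiv ℝ a p u) (fderiv ℝ a p v) = c * G p u v) :
    R.IsScaledIsometry S c f := by
  have hf' : κ ∘ f = a ∘ ι := funext hf
  have hg' : ι ∘ g = b ∘ κ := funext hg
  have hfs : R.Smooth S f := hS.smooth_iff.2 (hf' ▸ hR.smoothTo.contDiff_comp ha)
  have hgs : S.Smooth R g := hR.smooth_iff.2 (hg' ▸ hS.smoothTo.contDiff_comp hb)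
  refine isScaledIsometry_of_smooth hfs hgs
    (fun x ↦ hR.isEmbedding.injective (by rw [hg, hf, hba]))
    (fun y ↦ hS.isEmbedding.injective (by rw [hf, hg, hab])) fun x u v ↦ ?_
  have h1 := differentialTo_comp hS.smoothTo hfs x
  rw [hf', differentialTo_contDiff_comp ha hR.smoothTo] at h1
  have h2 : ∀ w, S.differentialTo κ (f x) (R.differential S f x w) =
      fderiv ℝ a (ι x) (R.differentialTo ι x w) := fun w ↦ (DFunLike.congr_fun h1 w).symm
  rw [hS.form_eq, h2, h2, hf, h, hR.form_eq]

/-- Horizontal lifts exist. -/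
theorem exists_isHorizontal (R : RiemannianStructure d M) (S : RiemannianStructure e N) (f : M → N)
    (x : M) (u : EuclideanSpace ℝ (Fin d)) :
    ∃ v, R.IsHorizontal S f x v ∧ R.differential S f x v = R.differential S f x u := by
  let B : LinearMap.BilinForm ℝ (EuclideanSpace ℝ (Fin d)) :=
    LinearMap.mk₂ ℝ (fun u v ↦ R.form x u v) (by simp) (by simp) (by simp) (by simp)
  let K := LinearMap.ker (R.differential S f x).toLinearMap
  have hB : B.IsRefl := fun u v huv ↦ (R.form_symm x v u).trans huv
  -- The metric stays definite on the kernel of the differential, so the kernel has an orthogonal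
  -- complement. The lift is the component of `u` in it.
  have hK : (B.restrict K).Nondegenerate := by
    refine ⟨fun u hu ↦ ?_, fun u hu ↦ ?_⟩ <;>
    · by_contra hne
      have := R.form_pos x (u := u) (by simpa using hne)
      exact this.ne' (hu u)
  have hcompl := LinearMap.BilinForm.isCompl_orthogonal_of_restrict_nondegenerate hB hK
  obtain ⟨k, hk, v, hv, rfl⟩ := Submodule.mem_sup.1 (hcompl.sup_eq_top ▸ Submodule.mem_top (x := u))
  refine ⟨v, fun w hw ↦ (R.form_symm x v w).trans (hv w hw), ?_⟩
  have hk' : R.differential S f x k = 0 := hk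
  rw [map_add, hk', zero_add]

theorem isHorizontal_iff {f : M → N} {x : M} {u : EuclideanSpace ℝ (Fin d)} :
    R.IsHorizontal S f x u ↔ ∀ w, R.differential S f x w = 0 → R.form x u w = 0 := Iff.rfl

/-- Horizontality depends only on the kernel of the differential, and a map with a smooth left
inverse has injective differential. So `π` and `φ ∘ π` have the same horizontal vectors. -/
theorem isHorizontal_comp_iff {f : M → N} {g : N → X} (hf : R.Smooth S f) (hg : S.Smooth T g)
    {g' : X → N} (hg' : T.Smooth S g') (hgg' : LeftInverse g' g) {x : M}
    {u : EuclideanSpace ℝ (Fin d)} :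
    R.IsHorizontal T (g ∘ f) x u ↔ R.IsHorizontal S f x u := by
  simp only [isHorizontal_iff, differential_comp hg hf, ContinuousLinearMap.comp_apply]
  have : ∀ w, S.differential T g (f x) w = 0 ↔ w = 0 := fun w ↦ by
    refine ⟨fun hw ↦ ?_, fun hw ↦ by simp [hw]⟩
    rw [← differential_leftInverse hg hg' hgg' (f x) w, hw, map_zero]
  simp only [this]

/-- A smooth submersion between Riemannian manifolds. -/
def Submersion (R : RiemannianStructure d M) (S : RiemannianStructure e N) (f : M → N) : Prop :=
  R.Smooth S f ∧ ∀ x, Surjective (R.differential S f x)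

theorem Submersion.isSubmersion {f : M → N} (hf : R.Submersion S f) :
    letI := R.charted
    letI := S.charted
    IsSubmersion (𝓡 d) (𝓡 e) ∞ f := by
  let := R.charted
  let := R.isManifold
  let := S.charted
  let := S.isManifold
  exact ContMDiff.isSubmersion hf.1 hf.2

theorem IsRiemannianSubmersion.smooth {f : M → N} (hf : R.IsRiemannianSubmersion S f) :
    R.Smooth S f := by
  let := R.charted
  let := R.isManifold
  let := S.charted
  let := S.isManifold
  exact hf.1.contMDiff

/-- A map which is smooth after composition with a submersion is smooth. -/
theorem smooth_of_comp {f : M → N} {g : N → X}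
    (hf : letI := R.charted
      letI := S.charted
      IsSubmersion (𝓡 d) (𝓡 e) ∞ f) (hsurj : Surjective f) (h : R.Smooth T (g ∘ f)) :
    S.Smooth T g := by
  let := R.charted
  let := S.charted
  let := T.charted
  intro y
  obtain ⟨x, rfl⟩ := hsurj y
  obtain ⟨σ, hσ, hσs, hσ'⟩ := hf.exists_localSection x
  have h1 : ContMDiffAt (𝓡 e) (𝓡 m) ∞ ((g ∘ f) ∘ σ) (f x) := by
    refine ContMDiffAt.comp (f x) (I' := 𝓡 d) ?_ hσs
    exact h _
  refine h1.congr_of_eventuallyEq ?_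
  filter_upwards [hσ'] with y hy
  simp [hy]

/-- A local section through `x` writes each point near `f x` as the image of a point near `x`. -/
theorem Submersion.isOpenMap {f : M → N} (hf : R.Submersion S f) : IsOpenMap f := by
  let := R.charted
  let := S.charted
  rw [isOpenMap_iff_nhds_le]
  intro x s hs
  obtain ⟨σ, hσ, hσs, hσ'⟩ := hf.isSubmersion.exists_localSection x
  have h1 : ∀ᶠ y in 𝓝 (f x), σ y ∈ f ⁻¹' s :=
    hσs.continuousAt.eventually_mem (by rw [hσ]; exact hs)
  filter_upwards [h1, hσ'] with y hy hy'
  rw [← hy']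
  exact hy

/-- If a Riemannian submersion and a submersion which multiplies inner products of horizontal
vectors by a constant have the same fibres, then the induced bijection is an isometry up to that
constant. -/
theorem IsRiemannianSubmersion.isScaledIsometry {π : M → N} {φ : N → X} {c : ℝ}
    (hπ : R.IsRiemannianSubmersion S π) (hπs : Surjective π) (hψ : R.Submersion T (φ ∘ π))
    (hφ : Bijective φ)
    (h : ∀ x u v, R.IsHorizontal T (φ ∘ π) x u → R.IsHorizontal T (φ ∘ π) x v →
      T.form (φ (π x)) (R.differential T (φ ∘ π) x u) (R.differential T (φ ∘ π) x v) =
        c * R.form x u v) : S.IsScaledIsometry T c φ := by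
  obtain ⟨φ', hφ₁, hφ₂⟩ := bijective_iff_has_inverse.1 hφ
  have hs : S.Smooth T φ := smooth_of_comp hπ.1 hπs hψ.1
  have hs' : T.Smooth S φ' := by
    refine smooth_of_comp hψ.isSubmersion (hφ.2.comp hπs) ?_
    rw [← comp_assoc, hφ₁.comp_eq_id, id_comp]
    exact hπ.smooth
  refine isScaledIsometry_of_smooth hs hs' hφ₁ hφ₂ fun y u v ↦ ?_
  obtain ⟨x, rfl⟩ := hπs y
  have hd := differential_comp hs hπ.smooth x
  -- Surjectivity of `dπ` is deduced from that of `d(φ ∘ π)`: lift `dφ(w)`, take the horizontal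
  -- part, and cancel `dφ` by its left inverse.
  have hsurj : ∀ w, ∃ w', R.IsHorizontal S π x w' ∧ R.differential S π x w' = w := fun w ↦ by
    obtain ⟨w', hw'⟩ := hψ.2 x (S.differential T φ (π x) w)
    obtain ⟨w'', h1, h2⟩ := exists_isHorizontal R S π x w'
    refine ⟨w'', h1, ?_⟩
    rw [h2]
    have h3 := congrArg (T.differential S φ' (φ (π x))) hw'
    rw [hd, ContinuousLinearMap.comp_apply] at h3
    rwa [differential_leftInverse hs hs' hφ₁, differential_leftInverse hs hs' hφ₁] at h3
  obtain ⟨u, hu, rfl⟩ := hsurj u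
  obtain ⟨v, hv, rfl⟩ := hsurj v
  have h1 := h x u v ((isHorizontal_comp_iff hπ.smooth hs hs' hφ₁).2 hu)
    ((isHorizontal_comp_iff hπ.smooth hs hs' hφ₁).2 hv)
  rw [hd] at h1
  have h2 : S.form (π x) (R.differential S π x u) (R.differential S π x v) = R.form x u v :=
    hπ.2 x u v hu hv
  rw [h2]
  exact h1

/-- The converse of `IsRiemannianSubmersion.isScaledIsometry`. -/
theorem IsScaledIsometry.isRiemannianSubmersion {π : M → N} {φ : N → X} {c : ℝ} (hc : c ≠ 0)
    (hφ : S.IsScaledIsometry T c φ) (hψ : R.Submersion T (φ ∘ π))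
    (h : ∀ x u v, R.IsHorizontal T (φ ∘ π) x u → R.IsHorizontal T (φ ∘ π) x v →
      T.form (φ (π x)) (R.differential T (φ ∘ π) x u) (R.differential T (φ ∘ π) x v) =
        c * R.form x u v) : R.IsRiemannianSubmersion S π := by
  obtain ⟨hs, φ', hs', hφ₁, hφ₂⟩ := hφ.exists_smooth_inverse
  have hπ : R.Smooth S π := by
    have := hs'.comp hψ.1
    rwa [← comp_assoc, hφ₁.comp_eq_id, id_comp] at this
  have hd := fun x ↦ differential_comp hs hπ x
  have hπsub : R.Submersion S π := by
    refine ⟨hπ, fun x w ↦ ?_⟩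
    obtain ⟨w', hw'⟩ := hψ.2 x (S.differential T φ (π x) w)
    refine ⟨w', ?_⟩
    have h3 := congrArg (T.differential S φ' (φ (π x))) hw'
    rw [hd, ContinuousLinearMap.comp_apply] at h3
    rwa [differential_leftInverse hs hs' hφ₁, differential_leftInverse hs hs' hφ₁] at h3
  refine ⟨hπsub.isSubmersion, fun x u v hu hv ↦ ?_⟩
  have h1 := h x u v ((isHorizontal_comp_iff hπ hs hs' hφ₁).2 hu)
    ((isHorizontal_comp_iff hπ hs hs' hφ₁).2 hv)
  rw [hd] at h1
  exact mul_left_cancel₀ hc ((hφ.form_eq _ _ _).symm.trans h1)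

end RiemannianStructure

theorem RiemannianMfd.IsometricUpToConstant.of_common {d : ℕ} {M N I : RiemannianMfd d}
    (h : M.IsometricUpToConstant I) (h' : N.IsometricUpToConstant I) :
    M.IsometricUpToConstant N := by
  let := M.top
  let := N.top
  let := I.top
  obtain ⟨c, hc, f, hf⟩ := h
  obtain ⟨c', hc', f', hf'⟩ := h'
  obtain ⟨g, hg⟩ := hf'.exists_symm hc'.ne'
  exact ⟨c'⁻¹ * c, by positivity, g ∘ f, hf.trans hg⟩

/-! ### The matrix exponential. -/

section MatrixExp

attribute [local instance] Matrix.linftyOpNormedRing Matrix.linftyOpNormedAlgebra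

variable {n : Type*} [Fintype n] [DecidableEq n]

/-- The exponential is differentiated under a submultiplicative norm, while the manifolds of
matrices use the entrywise sup norm. A statement about a single entry does not depend on this
choice. -/
theorem Matrix.contDiff_exp_smul_apply (X : Matrix n n ℝ) (i j : n) :
    ContDiff ℝ ∞ fun t : ℝ ↦ NormedSpace.exp (t • X) i j := by
  have : CompleteSpace (Matrix n n ℝ) := FiniteDimensional.complete ℝ _
  have h : ContDiff ℝ ∞ fun t : ℝ ↦ NormedSpace.exp (t • X) := by
    rw [contDiff_iff_contDiffAt]
    intro t
    exact (NormedSpace.exp_analytic (𝕂 := ℝ) (t • X)).contDiffAt.comp t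
      (contDiff_id.smul contDiff_const).contDiffAt
  exact (Matrix.entryLinearMap ℝ ℝ i j).toContinuousLinearMap.contDiff.comp h

theorem Matrix.hasDerivAt_exp_smul_apply (X : Matrix n n ℝ) (i j : n) :
    HasDerivAt (fun t : ℝ ↦ NormedSpace.exp (t • X) i j) (X i j) 0 := by
  have : CompleteSpace (Matrix n n ℝ) := FiniteDimensional.complete ℝ _
  have h := (Matrix.entryLinearMap ℝ ℝ i j).toContinuousLinearMap.hasFDerivAt.comp_hasDerivAt
    (0 : ℝ) (hasDerivAt_exp_smul_const (𝕂 := ℝ) X 0)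
  rw [zero_smul, NormedSpace.exp_zero, one_mul] at h
  exact h

end MatrixExp

/-! ### Differentiation of matrix-valued functions. -/

section MatrixCalculus

attribute [local instance] Matrix.normedAddCommGroup Matrix.normedSpace

variable {E : Type*} [NormedAddCommGroup E] [NormedSpace ℝ E] {m n p : Type*} [Fintype m]
  [Fintype n] [Fintype p]

theorem contDiffOn_matrix_iff {f : E → Matrix m n ℝ} {s : Set E} :
    ContDiffOn ℝ ∞ f s ↔ ∀ i j, ContDiffOn ℝ ∞ (fun x ↦ f x i j) s :=
  contDiffOn_pi.trans (forall_congr' fun _ ↦ contDiffOn_pi)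

theorem ContDiffOn.matrix_mul {f : E → Matrix m n ℝ} {g : E → Matrix n p ℝ} {s : Set E}
    (hf : ContDiffOn ℝ ∞ f s) (hg : ContDiffOn ℝ ∞ g s) :
    ContDiffOn ℝ ∞ (fun x ↦ f x * g x) s := by
  rw [contDiffOn_matrix_iff] at *
  intro i j
  simp only [Matrix.mul_apply]
  exact ContDiffOn.sum fun l _ ↦ (hf i l).mul (hg l j)

theorem ContDiffOn.matrix_transpose {f : E → Matrix m n ℝ} {s : Set E}
    (hf : ContDiffOn ℝ ∞ f s) : ContDiffOn ℝ ∞ (fun x ↦ (f x)ᵀ) s := by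
  rw [contDiffOn_matrix_iff] at *
  exact fun i j ↦ hf j i

theorem ContDiffOn.matrix_det [DecidableEq n] {f : E → Matrix n n ℝ} {s : Set E}
    (hf : ContDiffOn ℝ ∞ f s) : ContDiffOn ℝ ∞ (fun x ↦ (f x).det) s := by
  rw [contDiffOn_matrix_iff] at hf
  simp only [Matrix.det_apply']
  exact ContDiffOn.sum fun σ _ ↦ contDiffOn_const.mul (contDiffOn_prod fun i _ ↦ hf _ _)

/-- Cramer's rule: the inverse is the adjugate divided by the determinant, both polynomial in the
entries. -/
theorem ContDiffOn.matrix_inv [DecidableEq n] {f : E → Matrix n n ℝ} {s : Set E}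
    (hf : ContDiffOn ℝ ∞ f s) (h : ∀ x ∈ s, (f x).det ≠ 0) :
    ContDiffOn ℝ ∞ (fun x ↦ (f x)⁻¹) s := by
  simp only [Matrix.inv_def, Ring.inverse_eq_inv']
  refine (hf.matrix_det.inv h).smul ?_
  rw [contDiffOn_matrix_iff]
  intro i j
  simp only [Matrix.adjugate_apply]
  refine ContDiffOn.matrix_det ?_
  rw [contDiffOn_matrix_iff] at *
  intro a b
  by_cases hab : a = j
  · subst hab
    simpa using contDiffOn_const
  · simpa [Matrix.updateRow_ne hab] using hf a b

omit [Fintype m] in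
theorem hasDerivAt_matrix_iff {f : ℝ → Matrix m n ℝ} {f' : Matrix m n ℝ} {t : ℝ} :
    HasDerivAt f f' t ↔ ∀ i j, HasDerivAt (fun s ↦ f s i j) (f' i j) t :=
  hasDerivAt_pi.trans (forall_congr' fun _ ↦ hasDerivAt_pi)

omit [Fintype m] in
theorem HasDerivAt.matrix_mul {f : ℝ → Matrix m n ℝ} {g : ℝ → Matrix n p ℝ} {f' : Matrix m n ℝ}
    {g' : Matrix n p ℝ} {t : ℝ} (hf : HasDerivAt f f' t) (hg : HasDerivAt g g' t) :
    HasDerivAt (fun s ↦ f s * g s) (f' * g t + f t * g') t := by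
  rw [hasDerivAt_matrix_iff] at *
  intro i j
  simp only [Matrix.mul_apply, Matrix.add_apply, ← Finset.sum_add_distrib]
  exact HasDerivAt.fun_sum fun l _ ↦ (hf i l).mul (hg l j)

theorem HasDerivAt.matrix_transpose {f : ℝ → Matrix m n ℝ} {f' : Matrix m n ℝ} {t : ℝ}
    (hf : HasDerivAt f f' t) : HasDerivAt (fun s ↦ (f s)ᵀ) f'ᵀ t := by
  rw [hasDerivAt_matrix_iff] at *
  exact fun i j ↦ hf j i

/-- The one-parameter group of a matrix. -/
theorem Matrix.exists_oneParameterGroup [DecidableEq n] (X : Matrix n n ℝ) :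
    ∃ c : ℝ → Matrix n n ℝ, c 0 = 1 ∧ ContDiff ℝ ∞ c ∧ HasDerivAt c X 0 ∧ (∀ t, IsUnit (c t)) ∧
      (Xᵀ = -X → ∀ t, (c t)ᵀ * c t = 1) ∧ ∀ J, Commute J X → ∀ t, Commute J (c t) := by
  refine ⟨fun t ↦ NormedSpace.exp (t • X), by simp, ?_, ?_, fun t ↦ Matrix.isUnit_exp _,
    fun hX t ↦ ?_, fun J hJ t ↦ (hJ.smul_right t).exp_right⟩
  · rw [← contDiffOn_univ, contDiffOn_matrix_iff]
    exact fun i j ↦ (Matrix.contDiff_exp_smul_apply X i j).contDiffOn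
  · rw [hasDerivAt_matrix_iff]
    exact Matrix.hasDerivAt_exp_smul_apply X
  -- For skew `X` the transpose of `exp(tX)` is `exp(-tX)`, its inverse.
  · rw [← Matrix.exp_transpose, Matrix.transpose_smul, hX, smul_neg, Matrix.exp_neg]
    exact Matrix.nonsing_inv_mul _ ((Matrix.isUnit_iff_isUnit_det _).1 (Matrix.isUnit_exp _))

end MatrixCalculus

/-! ### Sources of local parametrizations: ambient diffeomorphisms, open sets, regular level sets.
-/

section LocalParametrization

open Set

variable {E F : Type} [NormedAddCommGroup E] [NormedSpace ℝ E] [NormedAddCommGroup F]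
  [NormedSpace ℝ F] {d : ℕ}

theorem IsLocallyParametrized.preimage {S : Set E} (hS : IsLocallyParametrized d S) {a : E → F}
    {b : F → E} (ha : ContDiff ℝ ∞ a) (hb : ContDiff ℝ ∞ b) (hba : Function.LeftInverse b a)
    (hab : Function.RightInverse b a) : IsLocallyParametrized d (b ⁻¹' S) := by
  intro p hp
  obtain ⟨U, V, l, ψ, hU, hpU, hV, hl, hψ, hψV, hlS, hlψ, hψl⟩ := hS (b p) hp
  refine ⟨b ⁻¹' U, V, l ∘ b, a ∘ ψ, hU.preimage hb.continuous, hpU, hV,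
    hl.comp hb.contDiffOn fun _ h ↦ h, ha.comp_contDiffOn hψ, fun v hv ↦ ?_, fun q hq ↦ hlS hq,
    fun v hv ↦ ?_, fun q hq ↦ ?_⟩
  · simp only [Function.comp_apply, mem_inter_iff, mem_preimage, hba _]
    exact hψV hv
  · simp [hba _, hlψ v hv]
  · simp [hψl (b q) hq, hab _]

variable [FiniteDimensional ℝ E] [FiniteDimensional ℝ F]

theorem IsOpen.isLocallyParametrized {S : Set E} (hS : IsOpen S) :
    IsLocallyParametrized (Module.finrank ℝ E) S := by
  let T : E ≃L[ℝ] EuclideanSpace ℝ (Fin (Module.finrank ℝ E)) :=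
    ContinuousLinearEquiv.ofFinrankEq (by simp)
  intro p hp
  refine ⟨S, T.symm ⁻¹' S, T, T.symm, hS, hp, hS.preimage T.symm.continuous, T.contDiff.contDiffOn,
    T.symm.contDiff.contDiffOn, fun v hv ↦ ⟨hv, hv⟩, fun v hv ↦ ?_, fun v _ ↦ by simp,
    fun v _ ↦ by simp⟩
  simpa using hv.1

/-- A regular level set is locally parametrized. -/
theorem isLocallyParametrized_levelSet {f : E → F} (hf : ContDiff ℝ ∞ f)
    (hsurj : ∀ x, f x = 0 → Function.Surjective (fderiv ℝ f x)) :
    IsLocallyParametrized (Module.finrank ℝ E - Module.finrank ℝ F) {x | f x = 0} := by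
  intro x hx
  let C := EuclideanSpace ℝ (Fin (Module.finrank ℝ E - Module.finrank ℝ F))
  have hle := LinearMap.finrank_le_finrank_of_surjective (f := (fderiv ℝ f x).toLinearMap)
    (hsurj x hx)
  obtain ⟨T, hT⟩ := LinearMap.exists_equiv_of_surjective (C := C) (fderiv ℝ f x) (hsurj x hx)
    (by simp [C]; omega)
  -- Completing `f` by coordinates along the kernel of its differential gives a local diffeomorphism
  -- that carries the level set to the slice of points `(0, v)`.
  have hg : ContDiff ℝ ∞ fun y ↦ (f y, (T y).2) := hf.prodMk (by fun_prop)
  have hg' : HasFDerivAt (fun y ↦ (f y, (T y).2)) (T : E →L[ℝ] F × C) x := by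
    have h2 : HasFDerivAt (fun y ↦ (T y).2) ((ContinuousLinearMap.snd ℝ F C) ∘L
      (T : E →L[ℝ] F × C)) x :=
      ((ContinuousLinearMap.snd ℝ F C) ∘L (T : E →L[ℝ] F × C)).hasFDerivAt
    refine ((hf.differentiable (by simp) x).hasFDerivAt.prodMk h2).congr_fderiv ?_
    ext u
    · simp [hT]
    · simp
  obtain ⟨Φ, hxΦ, -, hΦ, hΦsymm⟩ := exists_openPartialHomeomorph_of_hasFDerivAt_equiv
    isOpen_univ (mem_univ x) hg.contDiffOn T hg'
  have key : ∀ v : C, ((0 : F), v) ∈ Φ.target → f (Φ.symm (0, v)) = 0 ∧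
      (T (Φ.symm (0, v))).2 = v := fun v hv ↦ by
    have := Φ.right_inv hv
    rw [hΦ, Prod.ext_iff] at this
    exact this
  have key' : ∀ y ∈ Φ.source, f y = 0 → ((0 : F), (T y).2) = Φ y := fun y _ hy ↦ by
    rw [hΦ, hy]
  refine ⟨Φ.source, (fun v : C ↦ ((0 : F), v)) ⁻¹' Φ.target, fun y ↦ (T y).2,
    fun v ↦ Φ.symm (0, v), Φ.open_source, hxΦ, Φ.open_target.preimage (by fun_prop),
    ContDiff.contDiffOn (by fun_prop),
    hΦsymm.comp (ContDiff.contDiffOn (by fun_prop)) fun v hv ↦ hv,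
    fun v hv ↦ ⟨(key v hv).1, Φ.map_target hv⟩, fun y hy ↦ ?_, fun v hv ↦ (key v hv).2,
    fun y hy ↦ ?_⟩
  · rw [mem_preimage, key' y hy.2 hy.1]
    exact Φ.map_source hy.2
  · simp only
    rw [key' y hy.2 hy.1, Φ.left_inv hy.2]

end LocalParametrization

/-! ### Algebra of orthogonal projections and involutions. -/

section MatrixAlgebra

variable {n k : ℕ}

theorem Matrix.mem_orthogonalGroup_iff_transpose_mul {V : Matrix (Fin n) (Fin n) ℝ} :
    V ∈ Matrix.orthogonalGroup (Fin n) ℝ ↔ Vᵀ * V = 1 :=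
  Matrix.mem_orthogonalGroup_iff' (Fin n) ℝ

theorem Matrix.mem_orthogonalGroup_iff_mul_transpose {V : Matrix (Fin n) (Fin n) ℝ} :
    V ∈ Matrix.orthogonalGroup (Fin n) ℝ ↔ V * Vᵀ = 1 :=
  Matrix.mem_orthogonalGroup_iff (Fin n) ℝ

theorem Matrix.eq_zero_of_trace_transpose_mul {m : Type*} [Fintype m] {p : Type*} [Fintype p]
    {A : Matrix m p ℝ} (h : (Aᵀ * A).trace = 0) : A = 0 := by
  rw [← Matrix.conjTranspose_eq_transpose_of_trivial] at h
  exact Matrix.trace_conjTranspose_mul_self_eq_zero_iff.1 h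

theorem Matrix.trace_transpose_mul_pos {m : Type*} [Fintype m] {p : Type*} [Fintype p]
    {A : Matrix m p ℝ} (h : A ≠ 0) : 0 < (Aᵀ * A).trace := by
  refine lt_of_le_of_ne ?_ fun h0 ↦ h (Matrix.eq_zero_of_trace_transpose_mul h0.symm)
  rw [← Matrix.conjTranspose_eq_transpose_of_trivial]
  exact (Matrix.posSemidef_conjTranspose_mul_self A).trace_nonneg

/-- Every orthogonal projection of rank `k` is conjugate to the standard one. -/
theorem exists_orthogonal_of_mem_projectionModel (hkn : k ≤ n) {P : Matrix (Fin n) (Fin n) ℝ}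
    (hP : P ∈ projectionModel n k) : ∃ V ∈ Matrix.orthogonalGroup (Fin n) ℝ,
      P = V * Matrix.diagonal (fun i : Fin n ↦ if (i : ℕ) < k then (1 : ℝ) else 0) * Vᵀ := by
  obtain ⟨h1, h2, h3⟩ := hP
  have hH : P.IsHermitian := by rwa [Matrix.IsHermitian, Matrix.conjTranspose_eq_transpose_of_trivial]
  let U : Matrix (Fin n) (Fin n) ℝ := hH.eigenvectorUnitary
  have hU : Uᵀ * U = 1 := Matrix.mem_orthogonalGroup_iff_transpose_mul.1 hH.eigenvectorUnitary.2
  have hU' : U * Uᵀ = 1 := mul_eq_one_comm.1 hU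
  have hspec : P = U * Matrix.diagonal hH.eigenvalues * Uᵀ := hH.spectral_theorem
  set ev := hH.eigenvalues
  have hD : Matrix.diagonal ev = Uᵀ * P * U := by
    rw [hspec]
    calc Matrix.diagonal ev = (Uᵀ * U) * Matrix.diagonal ev * (Uᵀ * U) := by simp [hU]
      _ = _ := by simp only [Matrix.mul_assoc]
  have hD2 : Matrix.diagonal ev * Matrix.diagonal ev = Matrix.diagonal ev := by
    calc Matrix.diagonal ev * Matrix.diagonal ev = Uᵀ * P * (U * Uᵀ) * P * U := by
          rw [hD]; simp only [Matrix.mul_assoc]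
      _ = Uᵀ * P ^ 2 * U := by rw [hU', pow_two]; simp only [Matrix.mul_assoc, Matrix.one_mul]
      _ = _ := by rw [h2, hD]
  -- Idempotence leaves only the eigenvalues 0 and 1, and the trace counts the ones. There are `k`
  -- of them, so a permutation moves them to the first `k` places.
  have hev : ∀ i, ev i = if ev i = 1 then 1 else 0 := fun i ↦ by
    have : ev i * ev i = ev i := by
      simpa using congrFun (congrFun hD2 i) i
    have h0 : ev i * (ev i - 1) = 0 := by rw [mul_sub, this, mul_one, sub_self]
    rcases mul_eq_zero.1 h0 with h | h
    · simp [h]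
    · simp [sub_eq_zero.1 h]
  have htr : ∑ i, ev i = k := by
    rw [← h3, ← Matrix.trace_diagonal, hD, Matrix.mul_assoc, Matrix.trace_mul_comm,
      Matrix.mul_assoc, hU', Matrix.mul_one]
  have hcard : Fintype.card {i // ev i = 1} = k := by
    rw [Finset.sum_congr rfl fun i _ ↦ hev i, Finset.sum_boole] at htr
    rw [Fintype.card_subtype]
    exact_mod_cast htr
  have hcard' : Fintype.card {i : Fin n // (i : ℕ) < k} = k := by
    rw [Fintype.card_subtype]
    simp [Fin.card_filter_val_lt, hkn]
  let τ : {i : Fin n // (i : ℕ) < k} ≃ {i // ev i = 1} :=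
    Fintype.equivOfCardEq (hcard'.trans hcard.symm)
  let σ : Equiv.Perm (Fin n) := τ.extendSubtype
  have hσ : ∀ i, ev (σ i) = if (i : ℕ) < k then 1 else 0 := fun i ↦ by
    split_ifs with hi
    · exact τ.extendSubtype_mem i hi
    · rw [hev, if_neg (τ.extendSubtype_not_mem i hi)]
  refine ⟨U.submatrix id σ, ?_, ?_⟩
  · rw [Matrix.mem_orthogonalGroup_iff_mul_transpose, Matrix.transpose_submatrix,
      Matrix.submatrix_mul_equiv, hU', Matrix.submatrix_id_id]
  · have : Matrix.diagonal (fun i : Fin n ↦ if (i : ℕ) < k then (1 : ℝ) else 0) =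
        (Matrix.diagonal ev).submatrix σ σ := by
      rw [Matrix.submatrix_diagonal_equiv]
      congr 1
      exact funext fun i ↦ (hσ i).symm
    rw [this, Matrix.transpose_submatrix, Matrix.submatrix_mul_equiv, Matrix.submatrix_mul_equiv,
      ← hspec, Matrix.submatrix_id_id]

/-- The range of an orthogonal projection of rank `k`, and its orthogonal complement, have
orthonormal bases. -/
theorem exists_frame_of_mem_projectionModel (hkn : k ≤ n) {P : Matrix (Fin n) (Fin n) ℝ}
    (hP : P ∈ projectionModel n k) : ∃ (Y : Matrix (Fin n) (Fin k) ℝ)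
      (Z : Matrix (Fin n) (Fin (n - k)) ℝ), Yᵀ * Y = 1 ∧ Zᵀ * Z = 1 ∧ Yᵀ * Z = 0 ∧ Zᵀ * Y = 0 ∧
        Y * Yᵀ + Z * Zᵀ = 1 ∧ P = Y * Yᵀ := by
  obtain ⟨V, hV, rfl⟩ := exists_orthogonal_of_mem_projectionModel hkn hP
  let e : Fin k ⊕ Fin (n - k) ≃ Fin n := finSumFinEquiv.trans (finCongr (Nat.add_sub_cancel' hkn))
  -- Reindexing splits the columns of `V`: the first `k` span the range of the projection, the
  -- others its orthogonal complement.
  let W := V.submatrix id e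
  have hW : W = Matrix.fromCols W.toCols₁ W.toCols₂ := (Matrix.fromCols_toCols W).symm
  have h1 : Wᵀ * W = 1 := by
    have := Matrix.mem_orthogonalGroup_iff_transpose_mul.1 hV
    rw [Matrix.transpose_submatrix, ← Matrix.submatrix_mul _ _ _ _ _ Function.bijective_id, this,
      Matrix.submatrix_one_equiv]
  have h2 : W * Wᵀ = 1 := by
    rw [Matrix.transpose_submatrix, Matrix.submatrix_mul_equiv,
      Matrix.mem_orthogonalGroup_iff_mul_transpose.1 hV, Matrix.submatrix_id_id]
  have h3 : V * Matrix.diagonal (fun i : Fin n ↦ if (i : ℕ) < k then (1 : ℝ) else 0) * Vᵀ =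
      W * (Matrix.fromBlocks 1 0 0 0 : Matrix (Fin k ⊕ Fin (n - k)) (Fin k ⊕ Fin (n - k)) ℝ) * Wᵀ := by
    have : (Matrix.fromBlocks 1 0 0 0 : Matrix (Fin k ⊕ Fin (n - k)) (Fin k ⊕ Fin (n - k)) ℝ) =
        (Matrix.diagonal (fun i : Fin n ↦ if (i : ℕ) < k then (1 : ℝ) else 0)).submatrix e e := by
      rw [Matrix.submatrix_diagonal_equiv, ← Matrix.diagonal_one, ← Matrix.diagonal_zero,
        Matrix.fromBlocks_diagonal]
      congr 1
      funext i
      rcases i with i | i <;> simp [e]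
    rw [this, Matrix.transpose_submatrix, Matrix.submatrix_mul_equiv, Matrix.submatrix_mul_equiv,
      Matrix.submatrix_id_id]
  rw [h3]
  rw [hW, Matrix.transpose_fromCols] at h1 h2 ⊢
  rw [Matrix.fromRows_mul_fromCols, ← Matrix.fromBlocks_one, Matrix.fromBlocks_inj] at h1
  rw [Matrix.fromCols_mul_fromRows] at h2
  refine ⟨W.toCols₁, W.toCols₂, h1.1, h1.2.2.2, h1.2.1, h1.2.2.1, h2, ?_⟩
  rw [Matrix.fromCols_mul_fromBlocks, Matrix.fromCols_mul_fromRows]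
  simp

/-- The orthogonal projection to the column space of a matrix with linearly independent columns. -/
noncomputable def columnProjection {m p : Type*} [Fintype m] [DecidableEq m] [Fintype p]
    (A : Matrix p m ℝ) : Matrix p p ℝ := A * (Aᵀ * A)⁻¹ * Aᵀ

theorem columnProjection_transpose {m p : Type*} [Fintype m] [DecidableEq m] [Fintype p]
    (A : Matrix p m ℝ) : (columnProjection A)ᵀ = columnProjection A := by
  simp [columnProjection, Matrix.transpose_nonsing_inv, Matrix.mul_assoc]

theorem columnProjection_mul_self {m p : Type*} [Fintype m] [DecidableEq m] [Fintype p]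
    {A : Matrix p m ℝ} (hA : IsUnit (Aᵀ * A).det) : columnProjection A * A = A := by
  rw [columnProjection, Matrix.mul_assoc, Matrix.mul_assoc, Matrix.nonsing_inv_mul _ hA,
    Matrix.mul_one]

theorem columnProjection_mem {A : Matrix (Fin n) (Fin k) ℝ} (hA : IsUnit (Aᵀ * A).det) :
    columnProjection A ∈ projectionModel n k := by
  refine ⟨columnProjection_transpose A, ?_, ?_⟩
  · rw [pow_two]
    nth_rw 2 [columnProjection]
    rw [← Matrix.mul_assoc, ← Matrix.mul_assoc, columnProjection_mul_self hA]
    rfl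
  · rw [columnProjection, Matrix.mul_assoc, Matrix.trace_mul_comm, Matrix.mul_assoc,
      Matrix.nonsing_inv_mul _ hA]
    simp

/-- A projection which fixes the columns of a matrix is the projection to the column space. -/
theorem eq_columnProjection {A : Matrix (Fin n) (Fin k) ℝ} (hA : IsUnit (Aᵀ * A).det)
    {P : Matrix (Fin n) (Fin n) ℝ} (hP : P ∈ projectionModel n k) (hPA : P * A = A) :
    P = columnProjection A := by
  obtain ⟨h1, h2, h3⟩ := columnProjection_mem hA
  have h4 : P * columnProjection A = columnProjection A := by
    rw [columnProjection, ← Matrix.mul_assoc, ← Matrix.mul_assoc, hPA]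
  have h5 : columnProjection A * P = columnProjection A := by
    have := congrArg Matrix.transpose h4
    rwa [Matrix.transpose_mul, h1, hP.1] at this
  -- With `C` the column projection, `PC = CP = C` gives `(P - C)ᵀ(P - C) = P - C`, whose trace is
  -- `k - k = 0`.
  rw [← sub_eq_zero]
  apply Matrix.eq_zero_of_trace_transpose_mul
  rw [Matrix.transpose_sub, h1, hP.1, sub_mul, mul_sub, mul_sub, h4, h5, ← pow_two, ← pow_two,
    hP.2.1, h2]
  simp [h3, hP.2.2]

theorem columnProjection_of_orthonormal {Y : Matrix (Fin n) (Fin k) ℝ} (hY : Yᵀ * Y = 1) :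
    columnProjection Y = Y * Yᵀ := by
  simp [columnProjection, hY]

theorem isUnit_det_one_add_transpose_mul {p m : Type*} [Fintype m] [DecidableEq m] [Fintype p]
    (B : Matrix p m ℝ) : IsUnit (1 + Bᵀ * B).det := by
  have h : (1 + Bᵀ * B).PosDef := by
    rw [← Matrix.conjTranspose_eq_transpose_of_trivial]
    exact Matrix.PosDef.one.add_posSemidef (Matrix.posSemidef_conjTranspose_mul_self B)
  exact h.det_pos.ne'.isUnit

/-- Two identities carry this: `(2P - 1)² = 4(P² - P) + 1` and `tr(2P - 1) = 2 tr P - n`. -/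
theorem mem_involutionModel_iff {Q : Matrix (Fin n) (Fin n) ℝ} :
    Q ∈ involutionModel n k ↔ (1 / 2 : ℝ) • (Q + 1) ∈ projectionModel n k := by
  have key : ∀ P : Matrix (Fin n) (Fin n) ℝ,
      (2 : ℝ) • P - 1 ∈ involutionModel n k ↔ P ∈ projectionModel n k := by
    intro P
    simp only [involutionModel, projectionModel, Set.mem_ofPred_eq]
    constructor
    · rintro ⟨h1, h2, h3⟩
      have hs : Pᵀ = P := by
        rw [Matrix.transpose_sub, Matrix.transpose_smul, Matrix.transpose_one] at h2
        exact smul_right_injective _ (two_ne_zero (α := ℝ)) (sub_left_injective h2)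
      refine ⟨hs, ?_, ?_⟩
      · rw [Matrix.mem_orthogonalGroup_iff_transpose_mul, h2] at h1
        have h4 : (4 : ℝ) • (P ^ 2 - P) = 0 := by
          have : ((2 : ℝ) • P - 1) * ((2 : ℝ) • P - 1) = (4 : ℝ) • (P ^ 2 - P) + 1 := by
            simp only [sub_mul, mul_sub, smul_mul_assoc, mul_smul_comm, pow_two, mul_one, one_mul]
            module
          rw [this] at h1
          simpa using h1
        have := (smul_eq_zero.1 h4).resolve_left (by norm_num)
        rwa [sub_eq_zero] at this
      · rw [Matrix.trace_sub, Matrix.trace_smul, Matrix.trace_one, Fintype.card_fin,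
          smul_eq_mul] at h3
        linarith
    · rintro ⟨h1, h2, h3⟩
      have hs : ((2 : ℝ) • P - 1)ᵀ = (2 : ℝ) • P - 1 := by
        rw [Matrix.transpose_sub, Matrix.transpose_smul, Matrix.transpose_one, h1]
      refine ⟨?_, hs, ?_⟩
      · rw [Matrix.mem_orthogonalGroup_iff_transpose_mul, hs]
        have : ((2 : ℝ) • P - 1) * ((2 : ℝ) • P - 1) = (4 : ℝ) • (P ^ 2 - P) + 1 := by
          simp only [sub_mul, mul_sub, smul_mul_assoc, mul_smul_comm, pow_two, mul_one, one_mul]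
          module
        rw [this, h2, sub_self, smul_zero, zero_add]
      · rw [Matrix.trace_sub, Matrix.trace_smul, Matrix.trace_one, Fintype.card_fin, h3, smul_eq_mul]
  rw [← key]
  simp

theorem two_smul_sub_one_mem_involutionModel {P : Matrix (Fin n) (Fin n) ℝ}
    (hP : P ∈ projectionModel n k) : (2 : ℝ) • P - 1 ∈ involutionModel n k := by
  rw [mem_involutionModel_iff]
  simpa using hP

end MatrixAlgebra

theorem LinearMap.contDiff_of_finiteDimensional {F V : Type*} [NormedAddCommGroup F]
    [NormedSpace ℝ F] [FiniteDimensional ℝ F] [NormedAddCommGroup V] [NormedSpace ℝ V]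
    (f : F →ₗ[ℝ] V) : ContDiff ℝ ∞ f :=
  (LinearMap.toContinuousLinearMap f).contDiff

/-- All metrics needed here depend on the base point linearly through a parameter `N p`: a constant
for the trace forms, `(AᵀA)⁻¹` for full-rank matrices. Smoothness of the metric then reduces to
smoothness of `N`. -/
theorem IsLocallyParametrized.exists_isInduced_trilinear {d : ℕ} {M E F : Type}
    [TopologicalSpace M] [NormedAddCommGroup E] [NormedSpace ℝ E] [FiniteDimensional ℝ E]
    [NormedAddCommGroup F] [NormedSpace ℝ F] [FiniteDimensional ℝ F] {ι : M → E}
    (hι : Topology.IsEmbedding ι) (h : IsLocallyParametrized d (Set.range ι)) {W : Set E}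
    (hW : IsOpen W) (hιW : ∀ x, ι x ∈ W) (t : F →ₗ[ℝ] E →ₗ[ℝ] E →ₗ[ℝ] ℝ) {N : E → F}
    (hN : ContDiffOn ℝ ∞ N W) (hsymm : ∀ x u v, t (N (ι x)) u v = t (N (ι x)) v u)
    (hpos : ∀ x u, u ≠ 0 → 0 < t (N (ι x)) u u) :
    ∃ R : RiemannianStructure d M, R.IsInduced ι (fun p u v ↦ t (N p) u v) := by
  let B : F →ₗ[ℝ] E →L[ℝ] E →L[ℝ] ℝ :=
    { toFun := fun N ↦ LinearMap.toContinuousLinearMap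
        ((LinearMap.toContinuousLinearMap : (E →ₗ[ℝ] ℝ) ≃ₗ[ℝ] (E →L[ℝ] ℝ)).toLinearMap ∘ₗ t N)
      map_add' := fun N N' ↦ by ext; simp
      map_smul' := fun c N ↦ by ext; simp }
  have hB : ContDiff ℝ ∞ B :=
    LinearMap.contDiff_of_finiteDimensional (V := E →L[ℝ] E →L[ℝ] ℝ) B
  exact h.exists_isInduced hι hW hιW (fun p ↦ B (N p)) (hB.comp_contDiffOn hN) hsymm hpos

/-! ### The matrix models as manifolds. -/

section MatrixManifolds

open Set

attribute [local instance] Matrix.normedAddCommGroup Matrix.normedSpace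

variable {n k : ℕ}

/-- Graph coordinates around `YYᵀ`: a nearby `k`-plane is the column space of `Y + ZB` for a unique
`B`, and `B` has `k(n - k)` entries. It is recovered from the projection `P` as `(ZᵀPY)(YᵀPY)⁻¹`,
which is smooth on the open set of matrices with `YᵀPY` invertible. -/
theorem isLocallyParametrized_projectionModel (hkn : k ≤ n) :
    IsLocallyParametrized (k * (n - k)) (projectionModel n k) := by
  intro P₀ hP₀
  obtain ⟨Y, Z, hYY, hZZ, hYZ, hZY, hsum, rfl⟩ := exists_frame_of_mem_projectionModel hkn hP₀
  let T : EuclideanSpace ℝ (Fin (k * (n - k))) ≃L[ℝ] Matrix (Fin (n - k)) (Fin k) ℝ :=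
    ContinuousLinearEquiv.ofFinrankEq (by simp [Module.finrank_matrix, mul_comm])
  let U : Set (Matrix (Fin n) (Fin n) ℝ) := {P | (Yᵀ * P * Y).det ≠ 0}
  let A : Matrix (Fin (n - k)) (Fin k) ℝ → Matrix (Fin n) (Fin k) ℝ := fun B ↦ Y + Z * B
  have hYA : ∀ B, Yᵀ * A B = 1 := fun B ↦ by
    simp [A, Matrix.mul_add, ← Matrix.mul_assoc, hYY, hYZ]
  have hZA : ∀ B, Zᵀ * A B = B := fun B ↦ by
    simp [A, Matrix.mul_add, ← Matrix.mul_assoc, hZZ, hZY]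
  have hAA : ∀ B, (A B)ᵀ * A B = 1 + Bᵀ * B := fun B ↦ by
    nth_rw 1 [show A B = Y + Z * B from rfl]
    rw [Matrix.transpose_add, Matrix.transpose_mul, Matrix.add_mul, Matrix.mul_assoc, hYA, hZA]
  have hAY : ∀ B, (A B)ᵀ * Y = 1 := fun B ↦ by
    rw [← Matrix.transpose_transpose Y, ← Matrix.transpose_mul, hYA, Matrix.transpose_one]
  have hdet : ∀ B, IsUnit ((A B)ᵀ * A B).det := fun B ↦ by
    rw [hAA]
    exact isUnit_det_one_add_transpose_mul B
  have hpY : ∀ B, Yᵀ * columnProjection (A B) * Y = ((A B)ᵀ * A B)⁻¹ := fun B ↦ by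
    rw [columnProjection, Matrix.mul_assoc, Matrix.mul_assoc, hAY, Matrix.mul_one,
      ← Matrix.mul_assoc, hYA, Matrix.one_mul]
  have hpZ : ∀ B, Zᵀ * columnProjection (A B) * Y = B * ((A B)ᵀ * A B)⁻¹ := fun B ↦ by
    rw [columnProjection, Matrix.mul_assoc, Matrix.mul_assoc, hAY, Matrix.mul_one,
      ← Matrix.mul_assoc, hZA]
  have hsandwich : ∀ {q : ℕ} (L : Matrix (Fin n) (Fin q) ℝ) (s : Set (Matrix (Fin n) (Fin n) ℝ)),
      ContDiffOn ℝ ∞ (fun P ↦ Lᵀ * P * Y) s := fun L s ↦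
    (contDiffOn_const.matrix_mul contDiffOn_id).matrix_mul contDiffOn_const
  have hAsmooth : ContDiffOn ℝ ∞ A univ :=
    contDiffOn_const.add (contDiffOn_const.matrix_mul contDiffOn_id)
  have hcp : ContDiffOn ℝ ∞ (fun B ↦ columnProjection (A B)) univ :=
    (hAsmooth.matrix_mul ((hAsmooth.matrix_transpose.matrix_mul hAsmooth).matrix_inv
      fun B _ ↦ (hdet B).ne_zero)).matrix_mul hAsmooth.matrix_transpose
  refine ⟨U, univ, fun P ↦ T.symm ((Zᵀ * P * Y) * (Yᵀ * P * Y)⁻¹),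
    fun v ↦ columnProjection (A (T v)), ?_, ?_, isOpen_univ, ?_, ?_, ?_, fun _ _ ↦ mem_univ _,
    ?_, ?_⟩
  · have h := (hsandwich Y univ).matrix_det.continuousOn
    rw [continuousOn_univ] at h
    exact isOpen_ne_fun h continuous_const
  · simp only [U, mem_ofPred_eq]
    rw [← Matrix.mul_assoc, hYY, Matrix.one_mul, hYY]
    simp
  · exact T.symm.contDiff.comp_contDiffOn
      ((hsandwich Z U).matrix_mul ((hsandwich Y U).matrix_inv fun P hP ↦ hP))
  · exact hcp.comp T.contDiff.contDiffOn fun _ _ ↦ mem_univ _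
  · intro v _
    refine ⟨columnProjection_mem (hdet _), ?_⟩
    simp only [U, mem_ofPred_eq, hpY]
    exact (Matrix.isUnit_nonsing_inv_det _ (hdet _)).ne_zero
  · intro v _
    beta_reduce
    rw [hpY, hpZ, Matrix.nonsing_inv_nonsing_inv _ (hdet _), Matrix.mul_assoc,
      Matrix.nonsing_inv_mul _ (hdet _), Matrix.mul_one, T.symm_apply_apply]
  · rintro P ⟨hP, hPU⟩
    beta_reduce
    rw [T.apply_symm_apply]
    set B := (Zᵀ * P * Y) * (Yᵀ * P * Y)⁻¹
    symm
    refine eq_columnProjection (hdet B) hP ?_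
    have hu : IsUnit (Yᵀ * P * Y).det := isUnit_iff_ne_zero.2 hPU
    -- Decomposing `PY` along `Y` and `Z` shows that `Y + ZB` equals `PY(YᵀPY)⁻¹`. So `P` fixes its
    -- columns, and this determines `P`.
    have h1 : A B * (Yᵀ * P * Y) = P * Y := by
      simp only [A, B]
      rw [Matrix.add_mul, Matrix.mul_assoc Z, Matrix.mul_assoc (Zᵀ * P * Y), Matrix.nonsing_inv_mul _ hu,
        Matrix.mul_one]
      calc Y * (Yᵀ * P * Y) + Z * (Zᵀ * P * Y) = (Y * Yᵀ + Z * Zᵀ) * (P * Y) := by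
            simp only [Matrix.add_mul, Matrix.mul_assoc]
        _ = P * Y := by rw [hsum, Matrix.one_mul]
    have h2 : A B = P * Y * (Yᵀ * P * Y)⁻¹ := by
      rw [← h1, Matrix.mul_assoc, Matrix.mul_nonsing_inv _ hu, Matrix.mul_one]
    rw [h2, ← Matrix.mul_assoc, ← Matrix.mul_assoc, ← pow_two, hP.2.1]

theorem isLocallyParametrized_involutionModel (hkn : k ≤ n) :
    IsLocallyParametrized (k * (n - k)) (involutionModel n k) := by
  have h := (isLocallyParametrized_projectionModel hkn).preimage
    (a := fun P ↦ (2 : ℝ) • P - 1) (b := fun Q ↦ (1 / 2 : ℝ) • (Q + 1)) (by fun_prop) (by fun_prop)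
    (fun P ↦ by simp) (fun Q ↦ by simp)
  convert h using 1
  ext Q
  exact mem_involutionModel_iff

/-- The equation `YᵀY = 1` is regular once its values are restricted to symmetric matrices. The
dimension stays existential since only that of the quotient matters. -/
theorem exists_isLocallyParametrized_stiefel (n k : ℕ) :
    ∃ d, IsLocallyParametrized d (stiefel n k) := by
  let K : Submodule ℝ (Matrix (Fin k) (Fin k) ℝ) :=
    { carrier := {S | Sᵀ = S}
      add_mem' := fun {S S'} h h' ↦ by
        simp only [mem_ofPred_eq] at *
        rw [Matrix.transpose_add, h, h']
      zero_mem' := Matrix.transpose_zero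
      smul_mem' := fun c S h ↦ by
        simp only [mem_ofPred_eq] at *
        rw [Matrix.transpose_smul, h] }
  let p : Matrix (Fin k) (Fin k) ℝ →ₗ[ℝ] K :=
    { toFun := fun S ↦ ⟨S + Sᵀ, by
        change (S + Sᵀ)ᵀ = S + Sᵀ
        rw [Matrix.transpose_add, Matrix.transpose_transpose, add_comm]⟩
      map_add' := fun S S' ↦ Subtype.ext (by simp; abel)
      map_smul' := fun c S ↦ Subtype.ext (by simp) }
  have hp : ∀ S, (p S : Matrix (Fin k) (Fin k) ℝ) = S + Sᵀ := fun S ↦ rfl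
  let g : Matrix (Fin n) (Fin k) ℝ → Matrix (Fin k) (Fin k) ℝ := fun Y ↦ Yᵀ * Y - 1
  have hg : ContDiff ℝ ∞ g := contDiffOn_univ.1
    ((contDiffOn_id.matrix_transpose.matrix_mul contDiffOn_id).sub contDiffOn_const)
  let f : Matrix (Fin n) (Fin k) ℝ → K := fun Y ↦ p (g Y)
  have hf : ContDiff ℝ ∞ f := p.toContinuousLinearMap.contDiff.comp hg
  have hgt : ∀ Y, (g Y)ᵀ = g Y := fun Y ↦ by simp [g]
  have hmem : ∀ Y, f Y = 0 ↔ Y ∈ stiefel n k := fun Y ↦ by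
    rw [← Subtype.coe_inj, hp, hgt, Submodule.coe_zero, ← two_smul ℝ, smul_eq_zero]
    simp [g, stiefel, sub_eq_zero]
  have hset : {Y | f Y = 0} = stiefel n k := ext hmem
  rw [← hset]
  refine ⟨_, isLocallyParametrized_levelSet hf fun Y hY ↦ ?_⟩
  have hYY : Yᵀ * Y = 1 := (hmem Y).1 hY
  rintro ⟨S, hS⟩
  have hS' : Sᵀ = S := hS
  -- In this direction `YᵀY` varies by `S/4 + S/4 = S/2`, and `p` doubles symmetric matrices.
  refine ⟨(1 / 4 : ℝ) • (Y * S), ?_⟩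
  have h1 : HasDerivAt (fun t : ℝ ↦ Y + t • ((1 / 4 : ℝ) • (Y * S))) ((1 / 4 : ℝ) • (Y * S)) 0 := by
    have h := ((hasDerivAt_id (0 : ℝ)).smul_const ((1 / 4 : ℝ) • (Y * S))).const_add Y
    rw [one_smul] at h
    exact h
  have h2 := (h1.matrix_transpose.matrix_mul h1).sub_const 1
  have h3 := p.toContinuousLinearMap.hasFDerivAt.comp_hasDerivAt (0 : ℝ) h2
  have h4 : HasFDerivAt f (fderiv ℝ f Y) (Y + (0 : ℝ) • ((1 / 4 : ℝ) • (Y * S))) := by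
    rw [zero_smul, add_zero]
    exact (hf.differentiable (by simp) Y).hasFDerivAt
  have h5 := (h4.comp_hasDerivAt (0 : ℝ) h1).unique h3
  have h6 : fderiv ℝ f Y ((1 / 4 : ℝ) • (Y * S)) = _ := h5
  refine h6.trans (Subtype.ext ?_)
  refine (hp _).trans ?_
  simp only [zero_smul, add_zero]
  have h7 : Yᵀ * (Y * S) = S := by rw [← Matrix.mul_assoc, hYY, Matrix.one_mul]
  simp only [Matrix.transpose_smul, Matrix.transpose_mul, Matrix.smul_mul, Matrix.mul_smul,
    Matrix.mul_assoc, hYY, hS', Matrix.mul_one, Matrix.transpose_add, h7]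
  module

/-- Over the reals `AᵀA` has the same rank as `A`, and a square matrix of full rank is invertible.
-/
theorem mem_fullRank_iff {A : Matrix (Fin n) (Fin k) ℝ} :
    A ∈ fullRank n k ↔ IsUnit (Aᵀ * A).det := by
  rw [fullRank, mem_ofPred_eq, ← Matrix.rank_transpose_mul_self, ← Matrix.isUnit_iff_isUnit_det]
  refine ⟨fun h ↦ ?_, fun h ↦ by rw [Matrix.rank_of_isUnit _ h, Fintype.card_fin]⟩
  rw [← Matrix.mulVec_surjective_iff_isUnit]
  have h' : LinearMap.range (Aᵀ * A).mulVecLin = ⊤ :=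
    Submodule.eq_top_of_finrank_eq (by rw [Module.finrank_fin_fun]; exact h)
  exact LinearMap.range_eq_top.1 h'

theorem isOpen_fullRank : IsOpen (fullRank n k) := by
  have h : fullRank n k = {A | (Aᵀ * A).det ≠ 0} := by
    ext A
    rw [mem_fullRank_iff, isUnit_iff_ne_zero]
    rfl
  rw [h]
  refine isOpen_ne_fun (continuousOn_univ.1 (ContDiffOn.continuousOn (𝕜 := ℝ) (n := ∞) ?_))
    continuous_const
  exact (contDiffOn_id.matrix_transpose.matrix_mul contDiffOn_id).matrix_det

/-- The trilinear form `tr(N Xᵀ Y)`. -/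
noncomputable def Matrix.traceForm (m p : Type) [Fintype m] [Fintype p] :
    Matrix m m ℝ →ₗ[ℝ] Matrix p m ℝ →ₗ[ℝ] Matrix p m ℝ →ₗ[ℝ] ℝ where
  toFun N := LinearMap.mk₂ ℝ (fun X Y ↦ (N * (Xᵀ * Y)).trace)
    (fun X X' Y ↦ by simp [Matrix.add_mul, Matrix.mul_add]) (fun c X Y ↦ by simp)
    (fun X Y Y' ↦ by simp [Matrix.mul_add]) (fun c X Y ↦ by simp)
  map_add' N N' := LinearMap.ext fun X ↦ LinearMap.ext fun Y ↦ by simp [Matrix.add_mul]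
  map_smul' c N := LinearMap.ext fun X ↦ LinearMap.ext fun Y ↦ by simp

theorem Matrix.traceForm_apply {m p : Type} [Fintype m] [Fintype p] (N : Matrix m m ℝ)
    (X Y : Matrix p m ℝ) : Matrix.traceForm m p N X Y = (N * (Xᵀ * Y)).trace := rfl

theorem Matrix.trace_mul_transpose_mul_comm {m p : Type*} [Fintype m] [Fintype p]
    {N : Matrix m m ℝ} (hN : Nᵀ = N) (X Y : Matrix p m ℝ) :
    (N * (Xᵀ * Y)).trace = (N * (Yᵀ * X)).trace := by
  rw [← Matrix.trace_transpose, Matrix.transpose_mul, Matrix.transpose_mul, hN,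
    Matrix.transpose_transpose, Matrix.trace_mul_comm]

/-- With `N = (AᵀA)⁻¹`, the identity `N(AᵀA)N = N` turns the trace into the squared norm of `ANXᵀ`,
without a square root of `N`. Multiplying `ANXᵀ` by `Aᵀ` recovers `Xᵀ`, so it is nonzero. -/
theorem trace_inv_mul_transpose_mul_pos {A X : Matrix (Fin n) (Fin k) ℝ}
    (hA : IsUnit (Aᵀ * A).det) (hX : X ≠ 0) : 0 < ((Aᵀ * A)⁻¹ * (Xᵀ * X)).trace := by
  set N := (Aᵀ * A)⁻¹ with hN_def
  have hN : Nᵀ = N := by simp [N, Matrix.transpose_nonsing_inv]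
  have h1 : (N * (Xᵀ * X)).trace = ((A * N * Xᵀ)ᵀ * (A * N * Xᵀ)).trace := by
    have : (A * N * Xᵀ)ᵀ * (A * N * Xᵀ) = X * (N * (Aᵀ * A) * N) * Xᵀ := by
      simp only [Matrix.transpose_mul, hN, Matrix.transpose_transpose, Matrix.mul_assoc]
    rw [this, hN_def, Matrix.nonsing_inv_mul _ hA, Matrix.one_mul, Matrix.mul_assoc,
      Matrix.trace_mul_comm X, Matrix.mul_assoc]
  rw [h1]
  refine Matrix.trace_transpose_mul_pos fun h ↦ hX ?_
  have h2 : Aᵀ * (A * N * Xᵀ) = Xᵀ := by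
    rw [← Matrix.mul_assoc, ← Matrix.mul_assoc, hN_def, Matrix.mul_nonsing_inv _ hA,
      Matrix.one_mul]
  rw [h, Matrix.mul_zero] at h2
  exact Matrix.transpose_eq_zero.1 h2.symm

end MatrixManifolds

/-! ### The maps to the involution model, their fibres and their surjectivity. -/

section InvolutionMaps

open Set Function

variable {n k : ℕ}

theorem signatureMatrix_eq_blockDiag (h : k ≤ n) : signatureMatrix n k = blockDiag h 1 (-1) := by
  have h1 : (-1 : Matrix (Fin (n - k)) (Fin (n - k)) ℝ) = Matrix.diagonal fun _ ↦ -1 := by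
    rw [← Matrix.diagonal_one, ← Matrix.diagonal_neg]
  rw [signatureMatrix, blockDiag, Matrix.coe_reindexAlgEquiv, Matrix.reindex_apply, h1,
    ← Matrix.diagonal_one, Matrix.fromBlocks_diagonal, Matrix.submatrix_diagonal_equiv]
  congr 1
  funext i
  obtain ⟨i, rfl⟩ := (finSumFinEquiv.trans (finCongr (Nat.add_sub_cancel' h))).surjective i
  rcases i with i | i <;> simp

theorem signatureMatrix_transpose (n k : ℕ) : (signatureMatrix n k)ᵀ = signatureMatrix n k :=
  Matrix.diagonal_transpose _

theorem signatureMatrix_mul_self (n k : ℕ) : signatureMatrix n k * signatureMatrix n k = 1 := by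
  rw [signatureMatrix, Matrix.diagonal_mul_diagonal, ← Matrix.diagonal_one]
  congr 1
  funext i
  split_ifs <;> simp

theorem signatureMatrix_trace (h : k ≤ n) : (signatureMatrix n k).trace = 2 * (k : ℝ) - n := by
  have h1 : (signatureMatrix n k).trace =
      (Matrix.fromBlocks (1 : Matrix (Fin k) (Fin k) ℝ) 0 0
        (-1 : Matrix (Fin (n - k)) (Fin (n - k)) ℝ)).trace := by
    rw [signatureMatrix_eq_blockDiag h, blockDiag, Matrix.coe_reindexAlgEquiv]
    simp only [Matrix.trace, Matrix.reindex_apply, Matrix.diag_apply, Matrix.submatrix_apply]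
    exact Equiv.sum_comp (finSumFinEquiv.trans (finCongr (Nat.add_sub_cancel' h))).symm
      fun i ↦ Matrix.fromBlocks (1 : Matrix (Fin k) (Fin k) ℝ) 0 0
        (-1 : Matrix (Fin (n - k)) (Fin (n - k)) ℝ) i i
  rw [h1, Matrix.trace, Fintype.sum_sum_type]
  simp [Nat.cast_sub h]
  ring

theorem signatureMatrix_eq_sub_one (n k : ℕ) : signatureMatrix n k =
    (2 : ℝ) • Matrix.diagonal (fun i : Fin n ↦ if (i : ℕ) < k then (1 : ℝ) else 0) - 1 := by
  rw [signatureMatrix, ← Matrix.diagonal_smul, ← Matrix.diagonal_one, Matrix.diagonal_sub]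
  congr 1
  funext i
  simp only [Pi.smul_apply, smul_eq_mul]
  split_ifs <;> norm_num

/-- Commuting with `diag(I, -I)` makes each off-diagonal block equal to its own negative; the
diagonal blocks inherit orthogonality. -/
theorem exists_eq_blockDiag_of_commute (h : k ≤ n) {V : Matrix (Fin n) (Fin n) ℝ}
    (hV : V ∈ Matrix.orthogonalGroup (Fin n) ℝ)
    (hc : signatureMatrix n k * V = V * signatureMatrix n k) :
    ∃ Q₁ ∈ Matrix.orthogonalGroup (Fin k) ℝ, ∃ Q₂ ∈ Matrix.orthogonalGroup (Fin (n - k)) ℝ,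
      V = blockDiag h Q₁ Q₂ := by
  let Φ := Matrix.reindexAlgEquiv ℝ ℝ (finSumFinEquiv.trans (finCongr (Nat.add_sub_cancel' h)))
  obtain ⟨W, rfl⟩ := Φ.surjective V
  rw [← Matrix.fromBlocks_toBlocks W] at *
  set a := W.toBlocks₁₁
  set b := W.toBlocks₁₂
  set c := W.toBlocks₂₁
  set d := W.toBlocks₂₂
  rw [signatureMatrix_eq_blockDiag h, blockDiag] at hc
  change Φ _ * Φ _ = Φ _ * Φ _ at hc
  rw [← map_mul, ← map_mul, Φ.injective.eq_iff, Matrix.fromBlocks_multiply,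
    Matrix.fromBlocks_multiply, Matrix.fromBlocks_inj] at hc
  simp only [Matrix.one_mul, Matrix.zero_mul, add_zero, Matrix.mul_zero, zero_add, Matrix.mul_neg,
    Matrix.mul_one, Matrix.neg_mul, true_and, and_true] at hc
  have hb : b = 0 := Matrix.ext fun i j ↦ self_eq_neg.1 (congrFun (congrFun hc.1 i) j)
  have hc' : c = 0 := Matrix.ext fun i j ↦ neg_eq_self.1 (congrFun (congrFun hc.2 i) j)
  rw [hb, hc'] at hV ⊢
  rw [Matrix.mem_orthogonalGroup_iff_transpose_mul] at hV
  have h1 : blockDiag h (aᵀ * a) (dᵀ * d) = blockDiag h 1 1 := by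
    rw [blockDiag_mul, ← blockDiag_transpose, blockDiag_one]
    exact hV
  have h2 := Matrix.fromBlocks_inj.1 (Φ.injective h1)
  exact ⟨a, Matrix.mem_orthogonalGroup_iff_transpose_mul.2 h2.1, d,
    Matrix.mem_orthogonalGroup_iff_transpose_mul.2 h2.2.2.2, rfl⟩

/-- The map `V ↦ V diag(I, -I) Vᵀ` to the involution model. -/
def orthogonalToInvolution (h : k ≤ n) (V : Matrix.orthogonalGroup (Fin n) ℝ) :
    involutionModel n k :=
  ⟨V.1 * signatureMatrix n k * V.1ᵀ, by
    have hV := Matrix.mem_orthogonalGroup_iff_transpose_mul.1 V.2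
    have hV' := Matrix.mem_orthogonalGroup_iff_mul_transpose.1 V.2
    have h1 : (V.1 * signatureMatrix n k * V.1ᵀ)ᵀ = V.1 * signatureMatrix n k * V.1ᵀ := by
      simp only [Matrix.transpose_mul, Matrix.transpose_transpose, signatureMatrix_transpose,
        Matrix.mul_assoc]
    refine ⟨?_, h1, ?_⟩
    · rw [Matrix.mem_orthogonalGroup_iff_transpose_mul, h1]
      calc V.1 * signatureMatrix n k * V.1ᵀ * (V.1 * signatureMatrix n k * V.1ᵀ) =
          V.1 * (signatureMatrix n k * (V.1ᵀ * V.1) * signatureMatrix n k) * V.1ᵀ := by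
            simp only [Matrix.mul_assoc]
        _ = 1 := by rw [hV, Matrix.mul_one, signatureMatrix_mul_self, Matrix.mul_one, hV']
    · rw [Matrix.trace_mul_comm, ← Matrix.mul_assoc, hV, Matrix.one_mul, signatureMatrix_trace h]⟩

/-- The map `Y ↦ 2YYᵀ - 1` to the involution model. -/
def stiefelToInvolution (Y : stiefel n k) : involutionModel n k :=
  ⟨(2 : ℝ) • (Y.1 * Y.1ᵀ) - 1, two_smul_sub_one_mem_involutionModel (by
    have hY : Y.1ᵀ * Y.1 = 1 := Y.2
    rw [← columnProjection_of_orthonormal hY]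
    exact columnProjection_mem (by simp [hY]))⟩

/-- The map which sends a matrix to the reflection in its column space. -/
noncomputable def fullRankToInvolution (A : fullRank n k) : involutionModel n k :=
  ⟨(2 : ℝ) • columnProjection A.1 - 1,
    two_smul_sub_one_mem_involutionModel (columnProjection_mem (mem_fullRank_iff.1 A.2))⟩

theorem stiefel_subset_fullRank : stiefel n k ⊆ fullRank n k := fun Y hY ↦ by
  have hY : Yᵀ * Y = 1 := hY
  rw [mem_fullRank_iff, hY]
  simp

theorem two_smul_sub_one_injective : Injective fun P : Matrix (Fin n) (Fin n) ℝ ↦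
    (2 : ℝ) • P - 1 := fun _ _ h ↦
  smul_right_injective _ (two_ne_zero (α := ℝ)) (sub_left_injective h)

/-- `VJVᵀ = V'JV'ᵀ` says that `V⁻¹V'` commutes with `J`, and the centralizer of `J` in `O(n)` is the
block subgroup. -/
theorem orthogonalToInvolution_eq_iff (h : k ≤ n) {V V' : Matrix.orthogonalGroup (Fin n) ℝ} :
    orthogonalToInvolution h V = orthogonalToInvolution h V' ↔ V⁻¹ * V' ∈ blockSubgroup h := by
  have hV := Matrix.mem_orthogonalGroup_iff_transpose_mul.1 V.2
  have hV' := Matrix.mem_orthogonalGroup_iff_transpose_mul.1 V'.2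
  have hVt := Matrix.mem_orthogonalGroup_iff_mul_transpose.1 V.2
  have hV't := Matrix.mem_orthogonalGroup_iff_mul_transpose.1 V'.2
  have hcoe : ((V⁻¹ * V' : Matrix.orthogonalGroup (Fin n) ℝ) : Matrix (Fin n) (Fin n) ℝ) =
    V.1ᵀ * V'.1 := rfl
  set J := signatureMatrix n k with hJ
  constructor
  · intro he
    have he : V.1 * J * V.1ᵀ = V'.1 * J * V'.1ᵀ := congrArg Subtype.val he
    refine exists_eq_blockDiag_of_commute h (V⁻¹ * V').2 ?_
    rw [hcoe, ← hJ]
    calc J * (V.1ᵀ * V'.1) = (V.1ᵀ * V.1) * J * V.1ᵀ * V'.1 := by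
          rw [hV, Matrix.one_mul, Matrix.mul_assoc]
      _ = V.1ᵀ * (V.1 * J * V.1ᵀ) * V'.1 := by simp only [Matrix.mul_assoc]
      _ = V.1ᵀ * V'.1 * J * (V'.1ᵀ * V'.1) := by rw [he]; simp only [Matrix.mul_assoc]
      _ = V.1ᵀ * V'.1 * J := by rw [hV', Matrix.mul_one]
  · rintro ⟨Q₁, hQ₁, Q₂, hQ₂, hQ⟩
    rw [hcoe] at hQ
    set D := blockDiag h Q₁ Q₂ with hD
    have h1 : V'.1 = V.1 * D := by rw [← hQ, ← Matrix.mul_assoc, hVt, Matrix.one_mul]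
    have h2 : D * J * Dᵀ = J := by
      rw [hJ, signatureMatrix_eq_blockDiag h, hD, blockDiag_transpose, ← blockDiag_mul,
        ← blockDiag_mul, Matrix.mul_one, Matrix.mul_neg, Matrix.mul_one, Matrix.neg_mul,
        Matrix.mem_orthogonalGroup_iff_mul_transpose.1 hQ₁,
        Matrix.mem_orthogonalGroup_iff_mul_transpose.1 hQ₂]
    apply Subtype.ext
    change V.1 * J * V.1ᵀ = V'.1 * J * V'.1ᵀ
    rw [h1, Matrix.transpose_mul]
    calc V.1 * J * V.1ᵀ = V.1 * (D * J * Dᵀ) * V.1ᵀ := by rw [h2]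
      _ = _ := by simp only [Matrix.mul_assoc]

theorem orthogonalToInvolution_surjective (h : k ≤ n) :
    Surjective (orthogonalToInvolution h) := by
  rintro ⟨Q, hQ⟩
  obtain ⟨V, hV, hVQ⟩ := exists_orthogonal_of_mem_projectionModel h (mem_involutionModel_iff.1 hQ)
  refine ⟨⟨V, hV⟩, Subtype.ext ?_⟩
  change V * signatureMatrix n k * Vᵀ = Q
  have h1 : Q = (2 : ℝ) • ((1 / 2 : ℝ) • (Q + 1)) - 1 := by simp
  rw [h1, hVQ, signatureMatrix_eq_sub_one, Matrix.mul_sub, Matrix.sub_mul, Matrix.mul_one,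
    Matrix.mem_orthogonalGroup_iff_mul_transpose.1 hV, Matrix.mul_smul, Matrix.smul_mul]

/-- If the projections agree, then `Y' = Y'Y'ᵀY' = Y(YᵀY')`, and `YᵀY'` is the required orthogonal
matrix. -/
theorem stiefelToInvolution_eq_iff {Y Y' : stiefel n k} :
    stiefelToInvolution Y = stiefelToInvolution Y' ↔
      ∃ Q ∈ Matrix.orthogonalGroup (Fin k) ℝ, Y'.1 = Y.1 * Q := by
  have hY : Y.1ᵀ * Y.1 = 1 := Y.2
  have hY' : Y'.1ᵀ * Y'.1 = 1 := Y'.2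
  constructor
  · intro he
    have he : Y.1 * Y.1ᵀ = Y'.1 * Y'.1ᵀ := two_smul_sub_one_injective (congrArg Subtype.val he)
    have h1 : Y'.1 = Y.1 * (Y.1ᵀ * Y'.1) := by
      rw [← Matrix.mul_assoc, he, Matrix.mul_assoc, hY', Matrix.mul_one]
    refine ⟨Y.1ᵀ * Y'.1, Matrix.mem_orthogonalGroup_iff_transpose_mul.2 ?_, h1⟩
    rw [Matrix.transpose_mul, Matrix.transpose_transpose, Matrix.mul_assoc, ← h1, hY']
  · rintro ⟨Q, hQ, h⟩
    apply Subtype.ext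
    change (2 : ℝ) • (Y.1 * Y.1ᵀ) - 1 = (2 : ℝ) • (Y'.1 * Y'.1ᵀ) - 1
    rw [h, Matrix.transpose_mul, Matrix.mul_assoc, ← Matrix.mul_assoc Q,
      Matrix.mem_orthogonalGroup_iff_mul_transpose.1 hQ, Matrix.one_mul]

theorem stiefelToInvolution_surjective (h : k ≤ n) :
    Surjective (stiefelToInvolution (n := n) (k := k)) := by
  rintro ⟨Q, hQ⟩
  obtain ⟨Y, -, hY, -, -, -, -, hYQ⟩ :=
    exists_frame_of_mem_projectionModel h (mem_involutionModel_iff.1 hQ)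
  refine ⟨⟨Y, hY⟩, Subtype.ext ?_⟩
  change (2 : ℝ) • (Y * Yᵀ) - 1 = Q
  rw [← hYQ]
  simp

theorem columnProjection_mul_right {A : Matrix (Fin n) (Fin k) ℝ} {X : Matrix (Fin k) (Fin k) ℝ}
    (hX : IsUnit X.det) : columnProjection (A * X) = columnProjection A := by
  have hXt : IsUnit Xᵀ.det := by rwa [Matrix.det_transpose]
  simp only [columnProjection, Matrix.transpose_mul]
  rw [show Xᵀ * Aᵀ * (A * X) = Xᵀ * ((Aᵀ * A) * X) by simp only [Matrix.mul_assoc],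
    Matrix.mul_inv_rev, Matrix.mul_inv_rev]
  calc A * X * (X⁻¹ * (Aᵀ * A)⁻¹ * Xᵀ⁻¹) * (Xᵀ * Aᵀ)
      = A * (X * X⁻¹) * (Aᵀ * A)⁻¹ * (Xᵀ⁻¹ * Xᵀ) * Aᵀ := by simp only [Matrix.mul_assoc]
    _ = A * (Aᵀ * A)⁻¹ * Aᵀ := by
      rw [Matrix.mul_nonsing_inv _ hX, Matrix.nonsing_inv_mul _ hXt, Matrix.mul_one,
        Matrix.mul_one]

theorem isUnit_det_of_mul_mem_fullRank {A : Matrix (Fin n) (Fin k) ℝ}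
    {X : Matrix (Fin k) (Fin k) ℝ} (h : A * X ∈ fullRank n k) : IsUnit X.det := by
  rw [mem_fullRank_iff, ← Matrix.mul_assoc, Matrix.det_mul] at h
  exact isUnit_of_mul_isUnit_right h

/-- If the column projections agree, the one built from `A` fixes `A'`, which displays `A'` as `A`
times `(AᵀA)⁻¹AᵀA'`. This factor is invertible because `A'` has full rank. -/
theorem fullRankToInvolution_eq_iff {A A' : fullRank n k} :
    fullRankToInvolution A = fullRankToInvolution A' ↔
      ∃ X : GL (Fin k) ℝ, A'.1 = A.1 * X.1 := by
  constructor
  · intro he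
    have he : columnProjection A.1 = columnProjection A'.1 :=
      two_smul_sub_one_injective (congrArg Subtype.val he)
    have h1 : A'.1 = A.1 * ((A.1ᵀ * A.1)⁻¹ * A.1ᵀ * A'.1) := by
      conv_lhs => rw [← columnProjection_mul_self (mem_fullRank_iff.1 A'.2), ← he,
        columnProjection]
      simp only [Matrix.mul_assoc]
    have h2 : IsUnit ((A.1ᵀ * A.1)⁻¹ * A.1ᵀ * A'.1).det :=
      isUnit_det_of_mul_mem_fullRank (h1 ▸ A'.2)
    exact ⟨Matrix.nonsingInvUnit _ h2, h1⟩
  · rintro ⟨X, h⟩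
    apply Subtype.ext
    change (2 : ℝ) • columnProjection A.1 - 1 = (2 : ℝ) • columnProjection A'.1 - 1
    rw [h, columnProjection_mul_right ((Matrix.isUnit_iff_isUnit_det _).1 X.isUnit)]

/-- This makes the value independent of the chosen factorization. The square factor need not be
assumed invertible: the full rank of `A` forces it. -/
theorem fullRankToInvolution_of_eq_mul {A : fullRank n k} {Y : stiefel n k}
    {X : Matrix (Fin k) (Fin k) ℝ} (h : A.1 = Y.1 * X) :
    (fullRankToInvolution A).1 = (2 : ℝ) • (Y.1 * Y.1ᵀ) - 1 := by
  change (2 : ℝ) • columnProjection A.1 - 1 = _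
  rw [h, columnProjection_mul_right (isUnit_det_of_mul_mem_fullRank (h ▸ A.2)),
    columnProjection_of_orthonormal Y.2]

theorem fullRankToInvolution_surjective (h : k ≤ n) :
    Surjective (fullRankToInvolution (n := n) (k := k)) := fun Q ↦ by
  obtain ⟨Y, rfl⟩ := stiefelToInvolution_surjective h Q
  exact ⟨⟨Y.1, stiefel_subset_fullRank Y.2⟩,
    Subtype.ext (fullRankToInvolution_of_eq_mul (Y := Y) (X := 1) (Matrix.mul_one _).symm)⟩

end InvolutionMaps

/-! ### Construction of quotient metrics; horizontality against fibre curves. -/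

section QuotientMetric

open Set Function Topology RiemannianStructure

variable {d e : ℕ} {M N X E F : Type} [TopologicalSpace M] [TopologicalSpace N]
  [TopologicalSpace X] [NormedAddCommGroup E] [NormedSpace ℝ E] [NormedAddCommGroup F]
  [NormedSpace ℝ F]

/-- The metric of `N`, divided by `c`, is transported along `φ`. This requires `φ` to be a
homeomorphism: it is continuous because `π` is a quotient map, and open because the submersion `φ ∘
π` is. Then `φ` scales the metric by `c` by construction. -/
theorem RiemannianStructure.exists_isRiemannianSubmersion [FiniteDimensional ℝ E]
    {R : RiemannianStructure e X} {I : RiemannianStructure d N} {κ : N → E}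
    {b : E →ₗ[ℝ] E →ₗ[ℝ] ℝ} (hbs : ∀ u v, b u v = b v u) (hbp : ∀ u, u ≠ 0 → 0 < b u u)
    (hI : I.IsInduced κ fun _ u v ↦ b u v) (hκ : IsLocallyParametrized d (range κ)) {π : X → M}
    (hπ : IsQuotientMap π) {φ : M → N} (hφ : Bijective φ) (hψ : R.Submersion I (φ ∘ π)) {c : ℝ}
    (hc : 0 < c)
    (h : ∀ x u v, R.IsHorizontal I (φ ∘ π) x u → R.IsHorizontal I (φ ∘ π) x v →
      I.form (φ (π x)) (R.differential I (φ ∘ π) x u) (R.differential I (φ ∘ π) x v) =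
        c * R.form x u v) :
    ∃ S : RiemannianStructure d M, R.IsRiemannianSubmersion S π := by
  have hcont : Continuous φ := hπ.continuous_iff.2 hψ.1.continuous
  have hopen : IsOpenMap φ := fun U hU ↦ by
    rw [← image_preimage_eq U hπ.surjective, ← image_comp]
    exact hψ.isOpenMap _ (hU.preimage hπ.continuous)
  have hemb : IsEmbedding (κ ∘ φ) := hI.isEmbedding.comp
    (IsOpenEmbedding.of_continuous_injective_isOpenMap hcont hφ.1 hopen).isEmbedding
  obtain ⟨S, hS⟩ := IsLocallyParametrized.exists_isInduced_trilinear hemb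
    (by rwa [hφ.2.range_comp]) isOpen_univ (fun _ ↦ mem_univ _) (LinearMap.toSpanSingleton ℝ _ b)
    (N := fun _ ↦ c⁻¹) contDiffOn_const (fun x u v ↦ by simp [hbs u v]) fun x u hu ↦ by
      simpa using mul_pos (inv_pos.2 hc) (hbp u hu)
  refine ⟨S, IsScaledIsometry.isRiemannianSubmersion hc.ne' (hS.isScaledIsometry hI
    (f := φ) (g := (Equiv.ofBijective φ hφ).symm) contDiff_id contDiff_id (fun _ ↦ rfl)
    (fun y ↦ congrArg κ (Equiv.ofBijective_apply_symm_apply φ hφ y)) (fun _ ↦ rfl) (fun _ ↦ rfl)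
    fun p u v ↦ ?_) hψ h⟩
  simp [hc.ne']

/-- A horizontal vector is orthogonal to the velocities of curves in the fibres. -/
theorem RiemannianStructure.IsHorizontal.apply_velocity {R : RiemannianStructure d M}
    {I : RiemannianStructure e N} {ι : M → E} {κ : N → F} {G : E → E → E → ℝ} {H : F → F → F → ℝ}
    (hR : R.IsInduced ι G) (hI : I.IsInduced κ H) (hH : ∀ p v, H p 0 v = 0) {ψ : M → N}
    (hψ : R.Smooth I ψ) {c : ℝ → M} {u : EuclideanSpace ℝ (Fin d)} {v : E}
    (hu : R.IsHorizontal I ψ (c 0) u) (hc : ContDiff ℝ ∞ (ι ∘ c)) (hcψ : ∀ t, ψ (c t) = ψ (c 0))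
    (hv : HasDerivAt (ι ∘ c) v 0) : G (ι (c 0)) (R.differentialTo ι (c 0) u) v = 0 := by
  obtain ⟨w, hw⟩ := hR.exists_velocity hc
  have h1 : R.differentialTo ι (c 0) w = v := (hw ι hR.smoothTo).unique hv
  have h2 : R.differentialTo (κ ∘ ψ) (c 0) w = 0 := by
    refine (hw _ (hI.smoothTo.comp hψ)).unique ?_
    have : (κ ∘ ψ) ∘ c = fun _ ↦ κ (ψ (c 0)) := funext fun t ↦ congrArg κ (hcψ t)
    rw [this]
    exact hasDerivAt_const _ _
  rw [differentialTo_comp hI.smoothTo hψ] at h2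
  have h3 : R.differential I ψ (c 0) w = 0 :=
    hI.differentialTo_injective hH _ (by rw [map_zero]; exact h2)
  rw [← h1, ← hR.form_eq]
  exact isHorizontal_iff.1 hu w h3

theorem RiemannianStructure.IsInduced.form_differential {R : RiemannianStructure d M}
    {I : RiemannianStructure e N} {κ : N → F} {H : F → F → F → ℝ} (hI : I.IsInduced κ H)
    {ψ : M → N} (hψ : R.Smooth I ψ) (x : M) (u v : EuclideanSpace ℝ (Fin d)) :
    I.form (ψ x) (R.differential I ψ x u) (R.differential I ψ x v) =
      H (κ (ψ x)) (R.differentialTo (κ ∘ ψ) x u) (R.differentialTo (κ ∘ ψ) x v) := by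
  rw [hI.form_eq, differentialTo_comp hI.smoothTo hψ]
  rfl

end QuotientMetric

/-! ### Existence of the matrix metrics; equivariant maps are submersions. -/

section MatrixModels

open Set Function Topology RiemannianStructure

attribute [local instance] Matrix.normedAddCommGroup Matrix.normedSpace

variable {d e n k : ℕ} {M : Type} [TopologicalSpace M]

theorem RiemannianStructure.differentialTo_transpose {R : RiemannianStructure d M}
    {ι : M → Matrix (Fin n) (Fin n) ℝ} (hι : R.SmoothTo ι) (h : ∀ x, (ι x)ᵀ = ι x) (x : M)
    (u : EuclideanSpace ℝ (Fin d)) : (R.differentialTo ι x u)ᵀ = R.differentialTo ι x u := by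
  obtain ⟨c, -, hc⟩ := R.exists_curve x u
  refine (hc ι hι).matrix_transpose.unique ?_
  convert hc ι hι using 1
  exact funext fun t ↦ h _

/-- Tangent vectors to a set of symmetric matrices are symmetric, so on them the indefinite form
`tr(XY)` agrees with the positive definite `tr(XᵀY)`. -/
theorem RiemannianStructure.isInduced_trace_iff {R : RiemannianStructure d M}
    {ι : M → Matrix (Fin n) (Fin n) ℝ} (h : ∀ x, (ι x)ᵀ = ι x) :
    R.IsInduced ι (fun _ X Y ↦ (X * Y).trace) ↔ R.IsInduced ι (fun _ X Y ↦ (Xᵀ * Y).trace) :=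
  ⟨fun hR ↦ hR.congr fun x u v ↦ by rw [differentialTo_transpose hR.smoothTo h],
    fun hR ↦ hR.congr fun x u v ↦ by rw [differentialTo_transpose hR.smoothTo h]⟩

theorem IsInvolutionMetric.isInduced {I : RiemannianStructure (k * (n - k)) (involutionModel n k)}
    (hI : IsInvolutionMetric I) : I.IsInduced (fun Q ↦ (Q : Matrix (Fin n) (Fin n) ℝ))
      (fun _ X Y ↦ (Xᵀ * Y).trace) :=
  (isInduced_trace_iff fun Q ↦ Q.2.2.1).1 hI

theorem Matrix.exists_isInduced_trace {p : ℕ} {ι : M → Matrix (Fin n) (Fin p) ℝ}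
    (hι : IsEmbedding ι) (h : IsLocallyParametrized d (range ι)) {c : ℝ} (hc : 0 < c) :
    ∃ R : RiemannianStructure d M, R.IsInduced ι (fun _ X Y ↦ c * (Xᵀ * Y).trace) := by
  obtain ⟨R, hR⟩ := h.exists_isInduced_trilinear hι isOpen_univ (fun _ ↦ mem_univ _)
    (Matrix.traceForm (Fin p) (Fin n)) (N := fun _ ↦ c • 1) contDiffOn_const
    (fun x u v ↦ Matrix.trace_mul_transpose_mul_comm (by simp) u v) (fun x u hu ↦ by
      simpa [Matrix.traceForm_apply] using mul_pos hc (Matrix.trace_transpose_mul_pos hu))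
  exact ⟨R, hR.congr fun x u v ↦ by simp [Matrix.traceForm_apply]⟩

theorem exists_isProjectionMetric (h : k ≤ n) :
    ∃ R, IsProjectionMetric (n := n) (k := k) R := by
  obtain ⟨R, hR⟩ := Matrix.exists_isInduced_trace (c := 1)
    (ι := fun P : projectionModel n k ↦ P.1) IsEmbedding.subtypeVal
    (by rw [Subtype.range_val]; exact isLocallyParametrized_projectionModel h) one_pos
  exact ⟨R, (isInduced_trace_iff fun P ↦ P.2.1).2 (hR.congr fun x u v ↦ one_mul _)⟩

theorem exists_isInvolutionMetric (h : k ≤ n) :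
    ∃ R, IsInvolutionMetric (n := n) (k := k) R := by
  obtain ⟨R, hR⟩ := Matrix.exists_isInduced_trace (c := 1)
    (ι := fun P : involutionModel n k ↦ P.1) IsEmbedding.subtypeVal
    (by rw [Subtype.range_val]; exact isLocallyParametrized_involutionModel h) one_pos
  exact ⟨R, (isInduced_trace_iff fun P ↦ P.2.2.1).2 (hR.congr fun x u v ↦ one_mul _)⟩

theorem exists_isInduced_orthogonalGroup (n : ℕ) :
    ∃ (d : ℕ) (T : RiemannianStructure d (Matrix.orthogonalGroup (Fin n) ℝ)),
      T.IsInduced (fun V ↦ (V : Matrix (Fin n) (Fin n) ℝ))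
        (fun _ X Y ↦ (1 / 2 : ℝ) * (Xᵀ * Y).trace) := by
  obtain ⟨d, hd⟩ := exists_isLocallyParametrized_stiefel n n
  have h : range (fun V : Matrix.orthogonalGroup (Fin n) ℝ ↦ V.1) = stiefel n n := by
    ext V
    refine ⟨?_, fun hV ↦ ⟨⟨V, Matrix.mem_orthogonalGroup_iff_transpose_mul.2 hV⟩, rfl⟩⟩
    rintro ⟨V, rfl⟩
    exact Matrix.mem_orthogonalGroup_iff_transpose_mul.1 V.2
  exact ⟨d, Matrix.exists_isInduced_trace IsEmbedding.subtypeVal (h ▸ hd) (by norm_num)⟩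

theorem exists_isInduced_stiefel (n k : ℕ) :
    ∃ (d : ℕ) (T : RiemannianStructure d (stiefel n k)),
      T.IsInduced (fun Y ↦ (Y : Matrix (Fin n) (Fin k) ℝ)) (fun _ X Y ↦ (Xᵀ * Y).trace) := by
  obtain ⟨d, hd⟩ := exists_isLocallyParametrized_stiefel n k
  obtain ⟨T, hT⟩ := Matrix.exists_isInduced_trace (c := 1) (ι := fun Y : stiefel n k ↦ Y.1)
    IsEmbedding.subtypeVal (by rwa [Subtype.range_val]) one_pos
  exact ⟨d, T, hT.congr fun x u v ↦ one_mul _⟩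

theorem contDiffOn_inv_transpose_mul_self :
    ContDiffOn ℝ ∞ (fun A : Matrix (Fin n) (Fin k) ℝ ↦ (Aᵀ * A)⁻¹) (fullRank n k) :=
  (contDiffOn_id.matrix_transpose.matrix_mul contDiffOn_id).matrix_inv
    fun _ hA ↦ (mem_fullRank_iff.1 hA).ne_zero

theorem exists_isInduced_fullRank (n k : ℕ) :
    ∃ (d : ℕ) (T : RiemannianStructure d (fullRank n k)),
      T.IsInduced (fun A ↦ (A : Matrix (Fin n) (Fin k) ℝ))
        (fun A X Y ↦ ((Aᵀ * A)⁻¹ * (Xᵀ * Y)).trace) := by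
  refine ⟨_, IsLocallyParametrized.exists_isInduced_trilinear IsEmbedding.subtypeVal
    (by rw [Subtype.range_val]; exact isOpen_fullRank.isLocallyParametrized) isOpen_fullRank
    (fun A ↦ A.2) (Matrix.traceForm (Fin k) (Fin n)) contDiffOn_inv_transpose_mul_self
    (fun A X Y ↦ Matrix.trace_mul_transpose_mul_comm ?_ X Y)
    fun A X hX ↦ trace_inv_mul_transpose_mul_pos (mem_fullRank_iff.1 A.2) hX⟩
  simp [Matrix.transpose_nonsing_inv]

/-- An equivariant smooth map to the involution model is a submersion. -/
theorem submersion_of_equivariant {p : ℕ} {R : RiemannianStructure e M}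
    {ι : M → Matrix (Fin n) (Fin p) ℝ}
    {G : Matrix (Fin n) (Fin p) ℝ → Matrix (Fin n) (Fin p) ℝ → Matrix (Fin n) (Fin p) ℝ → ℝ}
    (hR : R.IsInduced ι G) {I : RiemannianStructure (k * (n - k)) (involutionModel n k)}
    (hI : IsInvolutionMetric I) {ψ : M → involutionModel n k} (hψ : R.Smooth I ψ)
    (h : ∀ W : Matrix (Fin n) (Fin n) ℝ, Wᵀ * W = 1 → ∀ x, ∃ y, ι y = W * ι x ∧
      (ψ y).1 = W * (ψ x).1 * Wᵀ) : R.Submersion I ψ := by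
  refine ⟨hψ, fun x s ↦ ?_⟩
  let κ : involutionModel n k → Matrix (Fin n) (Fin n) ℝ := fun Q ↦ Q
  have hκ : I.SmoothTo κ := hI.smoothTo
  have hmul : ∀ Q : involutionModel n k, κ Q * κ Q = 1 := fun Q ↦ by
    have h1 := Matrix.mem_orthogonalGroup_iff_transpose_mul.1 Q.2.1
    rwa [Q.2.2.1] at h1
  set S := I.differentialTo κ (ψ x) s with hS
  set Q := κ (ψ x) with hQ
  have hSt : Sᵀ = S := differentialTo_transpose hκ (fun Q ↦ Q.2.2.1) _ _
  have hQt : Qᵀ = Q := (ψ x).2.2.1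
  -- Differentiating `Q² = 1` along a curve.
  have hSQ : S * Q + Q * S = 0 := by
    obtain ⟨c, hc0, hc⟩ := I.exists_curve (ψ x) s
    have h1 := (hc κ hκ).matrix_mul (hc κ hκ)
    have h2 : (fun t ↦ (κ ∘ c) t * (κ ∘ c) t) = fun _ ↦ 1 := funext fun t ↦ hmul _
    rw [h2] at h1
    have h3 := h1.unique (hasDerivAt_const _ _)
    simpa only [comp_apply, hc0] using h3
  have hQS : Q * S = -(S * Q) := (neg_eq_of_add_eq_zero_right hSQ).symm
  -- Since `S` and `Q` are symmetric and anticommute, `W` is skew, and `WQ - QW = S/2 + S/2 = S`.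
  -- Conjugation by `exp(tW)` therefore moves `Q` with velocity `S`, and equivariance lifts this
  -- orbit to `M`.
  let W := (1 / 2 : ℝ) • (S * Q)
  have hW : Wᵀ = -W := by
    simp only [W]
    rw [Matrix.transpose_smul, Matrix.transpose_mul, hSt, hQt, hQS, smul_neg]
  obtain ⟨g, hg0, hg, hg', -, hgt, -⟩ := Matrix.exists_oneParameterGroup W
  choose c hc hcψ using fun t ↦ h (g t) (hgt hW t) x
  have hc0 : c 0 = x := hR.isEmbedding.injective (by rw [hc, hg0, Matrix.one_mul])
  have hιc : ContDiff ℝ ∞ (ι ∘ c) := by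
    have : ι ∘ c = fun t ↦ g t * ι x := funext hc
    rw [this, ← contDiffOn_univ]
    exact hg.contDiffOn.matrix_mul contDiffOn_const
  obtain ⟨u, hu⟩ := hR.exists_velocity hιc
  rw [hc0] at hu
  have h1 := hu (κ ∘ ψ) (hκ.comp hψ)
  have h2 : (κ ∘ ψ) ∘ c = fun t ↦ g t * Q * (g t)ᵀ := funext hcψ
  rw [h2] at h1
  have h3 := h1.unique ((hg'.matrix_mul (hasDerivAt_const 0 Q)).matrix_mul hg'.matrix_transpose)
  have h4 : S * Q * Q = S := by rw [Matrix.mul_assoc, hmul, Matrix.mul_one]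
  rw [hg0, hW, Matrix.transpose_one, Matrix.mul_zero, add_zero, Matrix.mul_one, Matrix.one_mul,
    Matrix.mul_neg, Matrix.mul_smul, Matrix.smul_mul, h4, ← Matrix.mul_assoc, hQS, Matrix.neg_mul,
    h4, smul_neg, neg_neg, ← add_smul, differentialTo_comp hκ hψ] at h3
  norm_num at h3
  refine ⟨u, hI.isInduced.differentialTo_injective (by simp) (ψ x) ?_⟩
  exact h3

end MatrixModels

/-! ### Horizontal vectors and the constant 8. -/

section Horizontal

open Set Function Topology RiemannianStructure

attribute [local instance] Matrix.normedAddCommGroup Matrix.normedSpace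

variable {d n k : ℕ}

/-- `Λ = Ω + JΩJ` is twice the part of `Ω` that commutes with `J`. It is orthogonal to `Ω` by
hypothesis and to `JΩJ` after conjugating by `J`, hence to itself. -/
theorem signature_mul_eq_neg_of_trace {m : Type*} [Fintype m] [DecidableEq m] {J Ω : Matrix m m ℝ}
    (hJ : Jᵀ = J) (hJJ : J * J = 1) (hΩ : Ωᵀ = -Ω)
    (h : ∀ Λ : Matrix m m ℝ, Λᵀ = -Λ → Commute J Λ → (Ωᵀ * Λ).trace = 0) : J * Ω * J = -Ω := by
  have hJJ' : ∀ A : Matrix m m ℝ, J * (J * A) = A := fun A ↦ by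
    rw [← Matrix.mul_assoc, hJJ, Matrix.one_mul]
  let Λ := Ω + J * Ω * J
  have h1 : Λᵀ = -Λ := by
    simp only [Λ, Matrix.transpose_add, Matrix.transpose_mul, hJ, hΩ, Matrix.neg_mul,
      Matrix.mul_neg, Matrix.mul_assoc, neg_add]
  have h2 : Commute J Λ := by
    simp only [Λ, Commute, SemiconjBy, Matrix.mul_add, Matrix.add_mul, Matrix.mul_assoc, hJJ',
      hJJ, Matrix.mul_one]
    rw [add_comm]
  have h3 := h Λ h1 h2
  have h4 : ((J * Ω * J)ᵀ * Λ).trace = 0 := by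
    calc ((J * Ω * J)ᵀ * Λ).trace = (J * (Ωᵀ * (J * Λ))).trace := by
          simp only [Matrix.transpose_mul, hJ, Matrix.mul_assoc]
      _ = (Ωᵀ * (J * Λ * J)).trace := by rw [Matrix.trace_mul_comm]; simp only [Matrix.mul_assoc]
      _ = 0 := by rw [h2.eq, Matrix.mul_assoc, hJJ, Matrix.mul_one, h3]
  have h5 : Λ = 0 := Matrix.eq_zero_of_trace_transpose_mul (by
    nth_rw 1 [show Λ = Ω + J * Ω * J from rfl]
    rw [Matrix.transpose_add, Matrix.add_mul, Matrix.trace_add, h3, h4, add_zero])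
  exact (neg_eq_of_add_eq_zero_right h5).symm

/-- Skewness and anticommutation with `J` make the two summands of the derivative equal, so it is
`2HJVᵀ`. As `J` and `V` are orthogonal, the trace is `4 tr(HᵀK)`. -/
theorem trace_conjugation_derivative {m : Type*} [Fintype m] [DecidableEq m]
    {V J H K : Matrix m m ℝ} (hV : Vᵀ * V = 1) (hJ : Jᵀ = J) (hJJ : J * J = 1)
    (hH : (Vᵀ * H)ᵀ = -(Vᵀ * H)) (hK : (Vᵀ * K)ᵀ = -(Vᵀ * K)) (hJH : J * (Vᵀ * H) * J = -(Vᵀ * H))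
    (hJK : J * (Vᵀ * K) * J = -(Vᵀ * K)) :
    ((H * J * Vᵀ + V * J * Hᵀ)ᵀ * (K * J * Vᵀ + V * J * Kᵀ)).trace =
      8 * ((1 / 2 : ℝ) * (Hᵀ * K).trace) := by
  have hVt : V * Vᵀ = 1 := mul_eq_one_comm.1 hV
  have key : ∀ H : Matrix m m ℝ, (Vᵀ * H)ᵀ = -(Vᵀ * H) → J * (Vᵀ * H) * J = -(Vᵀ * H) →
      H * J * Vᵀ + V * J * Hᵀ = (2 : ℝ) • (H * J * Vᵀ) := fun H h1 h2 ↦ by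
    have h3 : J * Hᵀ = Vᵀ * H * J * Vᵀ := by
      have h4 : Hᵀ = -(Vᵀ * H) * Vᵀ := by
        rw [← h1, Matrix.transpose_mul, Matrix.transpose_transpose, Matrix.mul_assoc, hVt,
          Matrix.mul_one]
      have h5 : J * (Vᵀ * H) = -(Vᵀ * H * J) := by
        rw [← Matrix.neg_mul, ← h2, Matrix.mul_assoc _ J J, hJJ, Matrix.mul_one]
      rw [h4, Matrix.neg_mul, Matrix.mul_neg, ← Matrix.mul_assoc, h5, Matrix.neg_mul, neg_neg]
    rw [Matrix.mul_assoc V, h3, two_smul]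
    congr 1
    simp only [← Matrix.mul_assoc, hVt, Matrix.one_mul]
  have h1 : ((H * J * Vᵀ)ᵀ * (K * J * Vᵀ)).trace = (Hᵀ * K).trace := by
    calc ((H * J * Vᵀ)ᵀ * (K * J * Vᵀ)).trace = (V * (Jᵀ * (Hᵀ * K * J) * Vᵀ)).trace := by
          simp only [Matrix.transpose_mul, Matrix.transpose_transpose, Matrix.mul_assoc]
      _ = (Jᵀ * (Hᵀ * K * J)).trace := by
        rw [Matrix.trace_mul_comm, Matrix.mul_assoc, hV, Matrix.mul_one]
      _ = (Hᵀ * K).trace := by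
        rw [hJ, Matrix.trace_mul_comm, Matrix.mul_assoc, hJJ, Matrix.mul_one]
  rw [key H hH hJH, key K hK hJK, Matrix.transpose_smul, Matrix.smul_mul, Matrix.mul_smul,
    Matrix.trace_smul, Matrix.trace_smul, h1, smul_eq_mul, smul_eq_mul]
  ring

/-- The relations `AᵀH = 0` and `AᵀK = 0` kill the cross terms, and the two others each contribute
`tr(N HᵀK)`. Taking `N = 1` covers orthonormal columns. -/
theorem trace_columnProjection_derivative {m p : Type*} [Fintype m] [DecidableEq m] [Fintype p]
    {A H K : Matrix p m ℝ} {N : Matrix m m ℝ} (hN : Nᵀ = N) (hNA : N * (Aᵀ * A) = 1)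
    (hH : Aᵀ * H = 0) (hK : Aᵀ * K = 0) :
    (((2 : ℝ) • (H * N * Aᵀ + A * N * Hᵀ))ᵀ * ((2 : ℝ) • (K * N * Aᵀ + A * N * Kᵀ))).trace =
      8 * (N * (Hᵀ * K)).trace := by
  have hHt : Hᵀ * A = 0 := by
    rw [← Matrix.transpose_transpose (Hᵀ * A), Matrix.transpose_mul, Matrix.transpose_transpose, hH,
      Matrix.transpose_zero]
  have h1 : (H * N * Aᵀ + A * N * Hᵀ)ᵀ = A * N * Hᵀ + H * N * Aᵀ := by
    simp only [Matrix.transpose_add, Matrix.transpose_mul, Matrix.transpose_transpose, hN,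
      Matrix.mul_assoc]
  have h2 : (A * N * Hᵀ + H * N * Aᵀ) * (K * N * Aᵀ + A * N * Kᵀ) =
      A * (N * (Hᵀ * K) * N * Aᵀ) + H * (N * Kᵀ) := by
    calc (A * N * Hᵀ + H * N * Aᵀ) * (K * N * Aᵀ + A * N * Kᵀ) =
        A * (N * (Hᵀ * K) * N * Aᵀ) + A * N * (Hᵀ * A) * (N * Kᵀ) + H * N * (Aᵀ * K) * (N * Aᵀ) +
          H * (N * (Aᵀ * A)) * (N * Kᵀ) := by
          simp only [Matrix.add_mul, Matrix.mul_add, Matrix.mul_assoc]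
          abel
      _ = _ := by
        rw [hHt, hK, hNA]
        simp
  have h3 : (H * (N * Kᵀ)).trace = (N * (Hᵀ * K)).trace := by
    rw [Matrix.trace_mul_comm, Matrix.mul_assoc, Matrix.trace_mul_transpose_mul_comm hN]
  have h4 : (A * (N * (Hᵀ * K) * N * Aᵀ)).trace = (N * (Hᵀ * K)).trace := by
    rw [Matrix.trace_mul_comm, Matrix.mul_assoc, Matrix.mul_assoc, ← Matrix.mul_assoc N, hNA,
      Matrix.mul_one, Matrix.mul_assoc]
  rw [Matrix.transpose_smul, h1, Matrix.smul_mul, Matrix.mul_smul, h2, Matrix.trace_smul,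
    Matrix.trace_smul, Matrix.trace_add, h3, h4, smul_eq_mul, smul_eq_mul]
  ring

theorem orthogonalToInvolution_smooth (h : k ≤ n)
    {T : RiemannianStructure d (Matrix.orthogonalGroup (Fin n) ℝ)}
    (hT : T.IsInduced (fun V ↦ (V : Matrix (Fin n) (Fin n) ℝ))
      (fun _ X Y ↦ (1 / 2 : ℝ) * (Xᵀ * Y).trace))
    {I : RiemannianStructure (k * (n - k)) (involutionModel n k)} (hI : IsInvolutionMetric I) :
    T.Smooth I (orthogonalToInvolution h) := by
  refine hI.isInduced.smooth_iff.2 (hT.smoothTo.contDiff_comp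
    (g := fun V ↦ V * signatureMatrix n k * Vᵀ) ?_)
  rw [← contDiffOn_univ]
  exact (contDiffOn_id.matrix_mul contDiffOn_const).matrix_mul contDiffOn_id.matrix_transpose

theorem orthogonalToInvolution_submersion (h : k ≤ n)
    {T : RiemannianStructure d (Matrix.orthogonalGroup (Fin n) ℝ)}
    (hT : T.IsInduced (fun V ↦ (V : Matrix (Fin n) (Fin n) ℝ))
      (fun _ X Y ↦ (1 / 2 : ℝ) * (Xᵀ * Y).trace))
    {I : RiemannianStructure (k * (n - k)) (involutionModel n k)} (hI : IsInvolutionMetric I) :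
    T.Submersion I (orthogonalToInvolution h) := by
  refine submersion_of_equivariant hT hI (orthogonalToInvolution_smooth h hT hI) fun W hW V ↦
    ⟨⟨W, Matrix.mem_orthogonalGroup_iff_transpose_mul.2 hW⟩ * V, rfl, ?_⟩
  simp only [orthogonalToInvolution, Submonoid.coe_mul, Matrix.transpose_mul, Matrix.mul_assoc]

/-- The curves `x exp(tΛ)`, with `Λ` skew and commuting with `J`, stay in the fibre of `x`.
Orthogonality of a horizontal `H` to their velocities `xΛ` makes `xᵀH` anticommute with `J`. -/
theorem orthogonalToInvolution_form (h : k ≤ n)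
    {T : RiemannianStructure d (Matrix.orthogonalGroup (Fin n) ℝ)}
    (hT : T.IsInduced (fun V ↦ (V : Matrix (Fin n) (Fin n) ℝ))
      (fun _ X Y ↦ (1 / 2 : ℝ) * (Xᵀ * Y).trace))
    {I : RiemannianStructure (k * (n - k)) (involutionModel n k)} (hI : IsInvolutionMetric I)
    (x : Matrix.orthogonalGroup (Fin n) ℝ) (u v : EuclideanSpace ℝ (Fin d))
    (hu : T.IsHorizontal I (orthogonalToInvolution h) x u)
    (hv : T.IsHorizontal I (orthogonalToInvolution h) x v) :
    I.form (orthogonalToInvolution h x) (T.differential I (orthogonalToInvolution h) x u)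
      (T.differential I (orthogonalToInvolution h) x v) = 8 * T.form x u v := by
  have hψ := orthogonalToInvolution_smooth h hT hI
  let ι : Matrix.orthogonalGroup (Fin n) ℝ → Matrix (Fin n) (Fin n) ℝ := fun V ↦ V
  let κ : involutionModel n k → Matrix (Fin n) (Fin n) ℝ := fun Q ↦ Q
  set J := signatureMatrix n k with hJ
  have hJt : Jᵀ = J := signatureMatrix_transpose n k
  have hJJ : J * J = 1 := signatureMatrix_mul_self n k
  have hx : (ι x)ᵀ * ι x = 1 := Matrix.mem_orthogonalGroup_iff_transpose_mul.1 x.2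
  have hD : ∀ w, T.differentialTo (κ ∘ orthogonalToInvolution h) x w =
      T.differentialTo ι x w * J * (ι x)ᵀ + ι x * J * (T.differentialTo ι x w)ᵀ := fun w ↦ by
    obtain ⟨c, hc0, hc⟩ := T.exists_curve x w
    have h1 := hc ι hT.smoothTo
    have h2 := (h1.matrix_mul (hasDerivAt_const 0 J)).matrix_mul h1.matrix_transpose
    have h3 := (hc _ (hI.smoothTo.comp hψ)).unique h2
    simpa only [comp_apply, hc0, Matrix.mul_zero, add_zero] using h3
  have hskew : ∀ w, ((ι x)ᵀ * T.differentialTo ι x w)ᵀ = -((ι x)ᵀ * T.differentialTo ι x w) :=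
    fun w ↦ by
    obtain ⟨c, hc0, hc⟩ := T.exists_curve x w
    have h1 := hc ι hT.smoothTo
    have h2 := h1.matrix_transpose.matrix_mul h1
    have h3 : (fun t ↦ ((ι ∘ c) t)ᵀ * (ι ∘ c) t) = fun _ ↦ 1 :=
      funext fun t ↦ Matrix.mem_orthogonalGroup_iff_transpose_mul.1 (c t).2
    rw [h3] at h2
    have h4 := h2.unique (hasDerivAt_const _ _)
    simp only [comp_apply, hc0] at h4
    rw [Matrix.transpose_mul, Matrix.transpose_transpose]
    exact eq_neg_of_add_eq_zero_left h4
  have hhor : ∀ w, T.IsHorizontal I (orthogonalToInvolution h) x w →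
      J * ((ι x)ᵀ * T.differentialTo ι x w) * J = -((ι x)ᵀ * T.differentialTo ι x w) :=
    fun w hw ↦ by
    refine signature_mul_eq_neg_of_trace hJt hJJ (hskew w) fun Λ hΛ hΛJ ↦ ?_
    obtain ⟨g, hg0, hg, hg', -, hgt, hgJ⟩ := Matrix.exists_oneParameterGroup Λ
    let c : ℝ → Matrix.orthogonalGroup (Fin n) ℝ := fun t ↦
      x * ⟨g t, Matrix.mem_orthogonalGroup_iff_transpose_mul.2 (hgt hΛ t)⟩
    have hc : ∀ t, ι (c t) = ι x * g t := fun t ↦ rfl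
    have hc0 : c 0 = x := Subtype.ext (by rw [← Matrix.mul_one x.1, ← hg0]; rfl)
    have hcψ : ∀ t, orthogonalToInvolution h (c t) = orthogonalToInvolution h (c 0) := fun t ↦ by
      rw [hc0]
      apply Subtype.ext
      change ι x * g t * J * (ι x * g t)ᵀ = ι x * J * (ι x)ᵀ
      have h1 : g t * (g t)ᵀ = 1 := mul_eq_one_comm.1 (hgt hΛ t)
      rw [Matrix.mul_assoc (ι x), ← (hgJ J hΛJ t).eq, Matrix.transpose_mul]
      calc ι x * (J * g t) * ((g t)ᵀ * (ι x)ᵀ) = ι x * J * (g t * (g t)ᵀ) * (ι x)ᵀ := by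
            simp only [Matrix.mul_assoc]
        _ = ι x * J * (ι x)ᵀ := by rw [h1, Matrix.mul_one]
    have hιc : ContDiff ℝ ∞ (ι ∘ c) := contDiffOn_univ.1
      (contDiffOn_const.matrix_mul hg.contDiffOn)
    have h1 := IsHorizontal.apply_velocity (c := c) hT hI.isInduced (by simp) hψ
      (hc0.symm ▸ hw) hιc hcψ ((hasDerivAt_const 0 (ι x)).matrix_mul hg')
    rw [hc0, Matrix.zero_mul, zero_add] at h1
    have h2 : ((T.differentialTo ι x w)ᵀ * (ι x * Λ)).trace = 0 := by
      simpa using h1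
    rw [Matrix.transpose_mul, Matrix.transpose_transpose, Matrix.mul_assoc, h2]
  rw [hI.isInduced.form_differential hψ, hT.form_eq]
  change ((T.differentialTo (κ ∘ _) x u)ᵀ * T.differentialTo (κ ∘ _) x v).trace = _
  rw [hD, hD]
  exact trace_conjugation_derivative hx hJt hJJ (hskew u) (hskew v) (hhor u hu) (hhor v hv)

theorem stiefelToInvolution_smooth {T : RiemannianStructure d (stiefel n k)}
    (hT : T.IsInduced (fun Y ↦ (Y : Matrix (Fin n) (Fin k) ℝ)) (fun _ X Y ↦ (Xᵀ * Y).trace))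
    {I : RiemannianStructure (k * (n - k)) (involutionModel n k)} (hI : IsInvolutionMetric I) :
    T.Smooth I stiefelToInvolution := by
  refine hI.isInduced.smooth_iff.2 (hT.smoothTo.contDiff_comp
    (g := fun Y ↦ (2 : ℝ) • (Y * Yᵀ) - 1) ?_)
  rw [← contDiffOn_univ]
  exact ((contDiffOn_id.matrix_mul contDiffOn_id.matrix_transpose).const_smul (2 : ℝ)).sub
    contDiffOn_const

theorem stiefelToInvolution_submersion {T : RiemannianStructure d (stiefel n k)}
    (hT : T.IsInduced (fun Y ↦ (Y : Matrix (Fin n) (Fin k) ℝ)) (fun _ X Y ↦ (Xᵀ * Y).trace))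
    {I : RiemannianStructure (k * (n - k)) (involutionModel n k)} (hI : IsInvolutionMetric I) :
    T.Submersion I stiefelToInvolution := by
  refine submersion_of_equivariant hT hI (stiefelToInvolution_smooth hT hI) fun W hW Y ↦
    ⟨⟨W * Y.1, ?_⟩, rfl, ?_⟩
  · have hY : Y.1ᵀ * Y.1 = 1 := Y.2
    change (W * Y.1)ᵀ * (W * Y.1) = 1
    rw [Matrix.transpose_mul, Matrix.mul_assoc, ← Matrix.mul_assoc Wᵀ, hW, Matrix.one_mul, hY]
  · simp only [stiefelToInvolution, Matrix.transpose_mul, Matrix.mul_assoc, Matrix.mul_sub,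
      Matrix.sub_mul, Matrix.mul_smul, Matrix.smul_mul, Matrix.one_mul, mul_eq_one_comm.1 hW]

theorem stiefelToInvolution_form {T : RiemannianStructure d (stiefel n k)}
    (hT : T.IsInduced (fun Y ↦ (Y : Matrix (Fin n) (Fin k) ℝ)) (fun _ X Y ↦ (Xᵀ * Y).trace))
    {I : RiemannianStructure (k * (n - k)) (involutionModel n k)} (hI : IsInvolutionMetric I)
    (x : stiefel n k) (u v : EuclideanSpace ℝ (Fin d))
    (hu : T.IsHorizontal I stiefelToInvolution x u)
    (hv : T.IsHorizontal I stiefelToInvolution x v) :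
    I.form (stiefelToInvolution x) (T.differential I stiefelToInvolution x u)
      (T.differential I stiefelToInvolution x v) = 8 * T.form x u v := by
  have hψ := stiefelToInvolution_smooth hT hI
  let ι : stiefel n k → Matrix (Fin n) (Fin k) ℝ := fun V ↦ V
  let κ : involutionModel n k → Matrix (Fin n) (Fin n) ℝ := fun Q ↦ Q
  have hx : (ι x)ᵀ * ι x = 1 := x.2
  have hD : ∀ w, T.differentialTo (κ ∘ stiefelToInvolution) x w =
      (2 : ℝ) • (T.differentialTo ι x w * (1 : Matrix (Fin k) (Fin k) ℝ) * (ι x)ᵀ +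
        ι x * (1 : Matrix (Fin k) (Fin k) ℝ) * (T.differentialTo ι x w)ᵀ) := fun w ↦ by
    obtain ⟨c, hc0, hc⟩ := T.exists_curve x w
    have h1 := hc ι hT.smoothTo
    have h2 := ((h1.matrix_mul h1.matrix_transpose).const_smul (2 : ℝ)).sub_const 1
    have h3 := (hc _ (hI.smoothTo.comp hψ)).unique h2
    rw [Matrix.mul_one, Matrix.mul_one]
    simpa only [comp_apply, hc0] using h3
  have hhor : ∀ w, T.IsHorizontal I stiefelToInvolution x w →
      (ι x)ᵀ * T.differentialTo ι x w = 0 := fun w hw ↦ by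
    set H := T.differentialTo ι x w
    have hskew : ((ι x)ᵀ * H)ᵀ = -((ι x)ᵀ * H) := by
      obtain ⟨c, hc0, hc⟩ := T.exists_curve x w
      have h1 := hc ι hT.smoothTo
      have h2 := h1.matrix_transpose.matrix_mul h1
      have h3 : (fun t ↦ ((ι ∘ c) t)ᵀ * (ι ∘ c) t) = fun _ ↦ 1 := funext fun t ↦ (c t).2
      rw [h3] at h2
      have h4 := h2.unique (hasDerivAt_const _ _)
      simp only [comp_apply, hc0] at h4
      rw [Matrix.transpose_mul, Matrix.transpose_transpose]
      exact eq_neg_of_add_eq_zero_left h4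
    -- The skew matrix `Λ = YᵀH` itself generates the test curve: `Y exp(tΛ)` stays in the fibre,
    -- and orthogonality of `H` to `YΛ` says that `YᵀH` has norm zero.
    obtain ⟨g, hg0, hg, hg', -, hgt, -⟩ := Matrix.exists_oneParameterGroup ((ι x)ᵀ * H)
    let c : ℝ → stiefel n k := fun t ↦ ⟨ι x * g t, by
      change (ι x * g t)ᵀ * (ι x * g t) = 1
      rw [Matrix.transpose_mul, Matrix.mul_assoc, ← Matrix.mul_assoc (ι x)ᵀ, hx, Matrix.one_mul,
        hgt hskew]⟩
    have hc0 : c 0 = x := Subtype.ext (by rw [← Matrix.mul_one x.1, ← hg0])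
    have hcψ : ∀ t, stiefelToInvolution (c t) = stiefelToInvolution (c 0) := fun t ↦ by
      rw [hc0]
      exact (stiefelToInvolution_eq_iff.2
        ⟨g t, Matrix.mem_orthogonalGroup_iff_transpose_mul.2 (hgt hskew t), rfl⟩).symm
    have hιc : ContDiff ℝ ∞ (ι ∘ c) := contDiffOn_univ.1
      (contDiffOn_const.matrix_mul hg.contDiffOn)
    have h1 := IsHorizontal.apply_velocity (c := c) hT hI.isInduced (by simp) hψ
      (hc0.symm ▸ hw) hιc hcψ ((hasDerivAt_const 0 (ι x)).matrix_mul hg')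
    rw [hc0, Matrix.zero_mul, zero_add] at h1
    refine Matrix.eq_zero_of_trace_transpose_mul ?_
    rw [Matrix.transpose_mul, Matrix.transpose_transpose, Matrix.mul_assoc]
    exact h1
  rw [hI.isInduced.form_differential hψ, hT.form_eq]
  change ((T.differentialTo (κ ∘ _) x u)ᵀ * T.differentialTo (κ ∘ _) x v).trace = _
  rw [hD, hD, trace_columnProjection_derivative Matrix.transpose_one (by rw [hx, Matrix.one_mul])
    (hhor u hu) (hhor v hv), Matrix.one_mul]

theorem columnProjection_contDiffOn :
    ContDiffOn ℝ ∞ (columnProjection : Matrix (Fin n) (Fin k) ℝ → _) (fullRank n k) :=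
  (contDiffOn_id.matrix_mul contDiffOn_inv_transpose_mul_self).matrix_mul
    contDiffOn_id.matrix_transpose

theorem columnProjection_mul_left {A : Matrix (Fin n) (Fin k) ℝ} {W : Matrix (Fin n) (Fin n) ℝ}
    (hW : Wᵀ * W = 1) : columnProjection (W * A) = W * columnProjection A * Wᵀ := by
  have h : (W * A)ᵀ * (W * A) = Aᵀ * A := by
    rw [Matrix.transpose_mul, Matrix.mul_assoc, ← Matrix.mul_assoc Wᵀ, hW, Matrix.one_mul]
  rw [columnProjection, h, columnProjection]
  simp only [Matrix.transpose_mul, Matrix.mul_assoc]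

theorem fullRankToInvolution_smooth {T : RiemannianStructure d (fullRank n k)}
    (hT : T.IsInduced (fun A ↦ (A : Matrix (Fin n) (Fin k) ℝ))
      (fun A X Y ↦ ((Aᵀ * A)⁻¹ * (Xᵀ * Y)).trace))
    {I : RiemannianStructure (k * (n - k)) (involutionModel n k)} (hI : IsInvolutionMetric I) :
    T.Smooth I fullRankToInvolution := by
  refine hI.isInduced.smooth_iff.2 (SmoothTo.contDiffOn_comp
    (g := fun A ↦ (2 : ℝ) • columnProjection A - 1) ?_ isOpen_fullRank hT.smoothTo fun A ↦ A.2)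
  exact (columnProjection_contDiffOn.const_smul (2 : ℝ)).sub contDiffOn_const

theorem fullRankToInvolution_submersion {T : RiemannianStructure d (fullRank n k)}
    (hT : T.IsInduced (fun A ↦ (A : Matrix (Fin n) (Fin k) ℝ))
      (fun A X Y ↦ ((Aᵀ * A)⁻¹ * (Xᵀ * Y)).trace))
    {I : RiemannianStructure (k * (n - k)) (involutionModel n k)} (hI : IsInvolutionMetric I) :
    T.Submersion I fullRankToInvolution := by
  refine submersion_of_equivariant hT hI (fullRankToInvolution_smooth hT hI) fun W hW A ↦
    ⟨⟨W * A.1, ?_⟩, rfl, ?_⟩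
  · rw [mem_fullRank_iff, Matrix.transpose_mul, Matrix.mul_assoc, ← Matrix.mul_assoc Wᵀ, hW,
      Matrix.one_mul, ← mem_fullRank_iff]
    exact A.2
  · simp only [fullRankToInvolution, columnProjection_mul_left hW, Matrix.mul_sub,
      Matrix.sub_mul, Matrix.mul_smul, Matrix.smul_mul, Matrix.mul_one, mul_eq_one_comm.1 hW]

theorem fullRankToInvolution_form {T : RiemannianStructure d (fullRank n k)}
    (hT : T.IsInduced (fun A ↦ (A : Matrix (Fin n) (Fin k) ℝ))
      (fun A X Y ↦ ((Aᵀ * A)⁻¹ * (Xᵀ * Y)).trace))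
    {I : RiemannianStructure (k * (n - k)) (involutionModel n k)} (hI : IsInvolutionMetric I)
    (x : fullRank n k) (u v : EuclideanSpace ℝ (Fin d))
    (hu : T.IsHorizontal I fullRankToInvolution x u)
    (hv : T.IsHorizontal I fullRankToInvolution x v) :
    I.form (fullRankToInvolution x) (T.differential I fullRankToInvolution x u)
      (T.differential I fullRankToInvolution x v) = 8 * T.form x u v := by
  have hψ := fullRankToInvolution_smooth hT hI
  let ι : fullRank n k → Matrix (Fin n) (Fin k) ℝ := fun V ↦ V
  let κ : involutionModel n k → Matrix (Fin n) (Fin n) ℝ := fun Q ↦ Q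
  have hx : ∀ x : fullRank n k, IsUnit ((ι x)ᵀ * ι x).det := fun x ↦ mem_fullRank_iff.1 x.2
  set A := ι x with hA
  set N := (Aᵀ * A)⁻¹ with hN
  have hNt : Nᵀ = N := by simp [N, Matrix.transpose_nonsing_inv]
  have hNA : N * (Aᵀ * A) = 1 := Matrix.nonsing_inv_mul _ (hx x)
  have hhor : ∀ w, T.IsHorizontal I fullRankToInvolution x w →
      Aᵀ * T.differentialTo ι x w = 0 := fun w hw ↦ by
    set H := T.differentialTo ι x w
    -- The generator is chosen so that the metric pairing of `H` with the fibre velocity `A(AᵀHN)`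
    -- is the squared norm of `AᵀHN`.
    obtain ⟨g, hg0, hg, hg', hgu, -, -⟩ := Matrix.exists_oneParameterGroup (Aᵀ * H * N)
    let c : ℝ → fullRank n k := fun t ↦ ⟨A * g t, by
      have h1 := (Matrix.isUnit_iff_isUnit_det _).1 (hgu t)
      rw [mem_fullRank_iff, Matrix.transpose_mul, Matrix.mul_assoc, ← Matrix.mul_assoc Aᵀ,
        Matrix.det_mul, Matrix.det_mul, Matrix.det_transpose]
      exact h1.mul ((hx x).mul h1)⟩
    have hc0 : c 0 = x := Subtype.ext (by rw [← Matrix.mul_one x.1, ← hg0])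
    have hcψ : ∀ t, fullRankToInvolution (c t) = fullRankToInvolution (c 0) := fun t ↦ by
      rw [hc0]
      exact (fullRankToInvolution_eq_iff.2 ⟨(hgu t).unit, rfl⟩).symm
    have hιc : ContDiff ℝ ∞ (ι ∘ c) := contDiffOn_univ.1
      (contDiffOn_const.matrix_mul hg.contDiffOn)
    have h1 := IsHorizontal.apply_velocity (c := c) hT hI.isInduced (by simp) hψ
      (hc0.symm ▸ hw) hιc hcψ ((hasDerivAt_const 0 A).matrix_mul hg')
    rw [hc0, Matrix.zero_mul, zero_add] at h1
    have h2 : (N * (Hᵀ * (A * (Aᵀ * H * N)))).trace = 0 := h1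
    have h3 : Aᵀ * H * N = 0 := by
      refine Matrix.eq_zero_of_trace_transpose_mul ?_
      rw [← h2]
      simp only [Matrix.transpose_mul, Matrix.transpose_transpose, hNt, Matrix.mul_assoc]
    have h4 : Aᵀ * H * (N * (Aᵀ * A)) = 0 := by rw [← Matrix.mul_assoc, h3, Matrix.zero_mul]
    rwa [hNA, Matrix.mul_one] at h4
  have hD : ∀ w, T.IsHorizontal I fullRankToInvolution x w →
      T.differentialTo (κ ∘ fullRankToInvolution) x w =
      (2 : ℝ) • (T.differentialTo ι x w * N * Aᵀ + A * N * (T.differentialTo ι x w)ᵀ) :=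
    fun w hw ↦ by
    let P : fullRank n k → Matrix (Fin n) (Fin n) ℝ := columnProjection ∘ ι
    have hP : T.SmoothTo P :=
      SmoothTo.contDiffOn_comp columnProjection_contDiffOn isOpen_fullRank hT.smoothTo fun A ↦ A.2
    set H := T.differentialTo ι x w
    set D := T.differentialTo P x w
    obtain ⟨c, hc0, hc⟩ := T.exists_curve x w
    have h1 := hc ι hT.smoothTo
    have h2 := hc P hP
    -- The derivative `D` of the projection is found from `PA = A` and `P² = P`, without
    -- differentiating the inverse. Horizontality gives `PH = 0`, so `DA = H` and `DP = HNAᵀ`; then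
    -- `D = DP + PD`, and `PD` is the transpose of `DP`.
    have h3 : D * A + P x * H = H := by
      have h4 := h2.matrix_mul h1
      have h5 : (fun t ↦ (P ∘ c) t * (ι ∘ c) t) = ι ∘ c :=
        funext fun t ↦ columnProjection_mul_self (hx (c t))
      rw [h5] at h4
      have h6 := h4.unique h1
      simpa only [comp_apply, hc0] using h6
    have h4 : P x * H = 0 := by
      change A * N * Aᵀ * H = 0
      rw [Matrix.mul_assoc, hhor w hw, Matrix.mul_zero]
    rw [h4, add_zero] at h3
    have h5 : D * P x + P x * D = D := by
      have h6 := h2.matrix_mul h2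
      have h7 : (fun t ↦ (P ∘ c) t * (P ∘ c) t) = P ∘ c := funext fun t ↦ by
        have := (columnProjection_mem (hx (c t))).2.1
        rwa [pow_two] at this
      rw [h7] at h6
      have h8 := h6.unique h2
      simpa only [comp_apply, hc0] using h8
    have h6 : Dᵀ = D := differentialTo_transpose hP (fun _ ↦ columnProjection_transpose _) _ _
    have h7 : D * P x = H * N * Aᵀ := by
      change D * (A * N * Aᵀ) = _
      rw [← Matrix.mul_assoc, ← Matrix.mul_assoc, h3]
    have h8 : P x * D = A * N * Hᵀ := by
      have h9 := congrArg Matrix.transpose h7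
      rw [Matrix.transpose_mul, h6, show (P x)ᵀ = P x from columnProjection_transpose _] at h9
      rw [h9]
      simp only [Matrix.transpose_mul, Matrix.transpose_transpose, hNt, Matrix.mul_assoc]
    rw [← h7, ← h8, h5]
    have h9 := (h2.const_smul (2 : ℝ)).sub_const 1
    exact (hc _ (hI.smoothTo.comp hψ)).unique h9
  rw [hI.isInduced.form_differential hψ, hT.form_eq]
  change ((T.differentialTo (κ ∘ _) x u)ᵀ * T.differentialTo (κ ∘ _) x v).trace = _
  rw [hD u hu, hD v hv, trace_columnProjection_derivative hNt hNA (hhor u hu) (hhor v hv)]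

end Horizontal

/-! ### The quotient models: existence of their metrics and the scaled isometries. -/

section Quotients

open Set Function Topology RiemannianStructure

attribute [local instance] Matrix.normedAddCommGroup Matrix.normedSpace

variable {n k : ℕ}

/-- The map from the orthogonal model to the involution model. -/
def OrthogonalModel.toInvolution (h : k ≤ n) : OrthogonalModel h → involutionModel n k :=
  Quotient.lift (orthogonalToInvolution h) fun _ _ hV ↦
    (orthogonalToInvolution_eq_iff h).2 (QuotientGroup.leftRel_apply.1 hV)

/-- The map from the Stiefel model to the involution model. -/
def StiefelModel.toInvolution : StiefelModel n k → involutionModel n k :=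
  Quotient.lift stiefelToInvolution fun _ _ hY ↦ stiefelToInvolution_eq_iff.2 hY

/-- The map from the full-rank model to the involution model. -/
noncomputable def FullRankModel.toInvolution : FullRankModel n k → involutionModel n k :=
  Quotient.lift fullRankToInvolution fun _ _ hA ↦ fullRankToInvolution_eq_iff.2 hA

theorem OrthogonalModel.toInvolution_bijective (h : k ≤ n) :
    Bijective (OrthogonalModel.toInvolution h) := by
  refine ⟨?_, fun Q ↦ ?_⟩
  · rintro ⟨V⟩ ⟨V'⟩ he
    exact Quotient.sound (QuotientGroup.leftRel_apply.2 ((orthogonalToInvolution_eq_iff h).1 he))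
  · obtain ⟨V, rfl⟩ := orthogonalToInvolution_surjective h Q
    exact ⟨V, rfl⟩

theorem StiefelModel.toInvolution_bijective (h : k ≤ n) :
    Bijective (StiefelModel.toInvolution (n := n) (k := k)) := by
  refine ⟨?_, fun Q ↦ ?_⟩
  · rintro ⟨Y⟩ ⟨Y'⟩ he
    exact Quotient.sound (stiefelToInvolution_eq_iff.1 he)
  · obtain ⟨Y, rfl⟩ := stiefelToInvolution_surjective h Q
    exact ⟨⟦Y⟧, rfl⟩

theorem FullRankModel.toInvolution_bijective (h : k ≤ n) :
    Bijective (FullRankModel.toInvolution (n := n) (k := k)) := by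
  refine ⟨?_, fun Q ↦ ?_⟩
  · rintro ⟨A⟩ ⟨A'⟩ he
    exact Quotient.sound (fullRankToInvolution_eq_iff.1 he)
  · obtain ⟨A, rfl⟩ := fullRankToInvolution_surjective h Q
    exact ⟨⟦A⟧, rfl⟩

/-- The trace form `tr(Xᵀ Y)`. -/
noncomputable def Matrix.traceInner (n : ℕ) :
    Matrix (Fin n) (Fin n) ℝ →ₗ[ℝ] Matrix (Fin n) (Fin n) ℝ →ₗ[ℝ] ℝ :=
  Matrix.traceForm (Fin n) (Fin n) 1

theorem Matrix.traceInner_apply (X Y : Matrix (Fin n) (Fin n) ℝ) :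
    Matrix.traceInner n X Y = (Xᵀ * Y).trace := by
  rw [Matrix.traceInner, Matrix.traceForm_apply, Matrix.one_mul]

/-- A quotient of a manifold submersed onto the involution model carries the quotient metric. -/
theorem exists_isRiemannianSubmersion_of_involution (hkn : k ≤ n) {e : ℕ} {X M : Type}
    [TopologicalSpace X] [TopologicalSpace M] {R : RiemannianStructure e X}
    {I : RiemannianStructure (k * (n - k)) (involutionModel n k)} (hI : IsInvolutionMetric I)
    {π : X → M} (hπ : IsQuotientMap π) {φ : M → involutionModel n k} (hφ : Bijective φ)
    (hψ : R.Submersion I (φ ∘ π))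
    (h : ∀ x u v, R.IsHorizontal I (φ ∘ π) x u → R.IsHorizontal I (φ ∘ π) x v →
      I.form (φ (π x)) (R.differential I (φ ∘ π) x u) (R.differential I (φ ∘ π) x v) =
        8 * R.form x u v) :
    ∃ S : RiemannianStructure (k * (n - k)) M, R.IsRiemannianSubmersion S π := by
  refine exists_isRiemannianSubmersion (b := Matrix.traceInner n) (fun X Y ↦ ?_) (fun X hX ↦ ?_)
    (hI.isInduced.congr fun x u v ↦ (Matrix.traceInner_apply _ _).symm) ?_ hπ hφ hψ
    (by norm_num) h
  · exact Matrix.trace_mul_transpose_mul_comm Matrix.transpose_one X Y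
  · rw [Matrix.traceInner_apply]
    exact Matrix.trace_transpose_mul_pos hX
  · rw [Subtype.range_val]
    exact isLocallyParametrized_involutionModel hkn

theorem exists_isOrthogonalMetric (h : k ≤ n) : ∃ R, IsOrthogonalMetric h R := by
  obtain ⟨I, hI⟩ := exists_isInvolutionMetric h
  obtain ⟨d, T, hT⟩ := exists_isInduced_orthogonalGroup n
  obtain ⟨R, hR⟩ := exists_isRiemannianSubmersion_of_involution h hI
    (π := fun V : Matrix.orthogonalGroup (Fin n) ℝ ↦ (V : OrthogonalModel h))
    (QuotientGroup.isQuotientMap_mk _)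
    (OrthogonalModel.toInvolution_bijective h) (orthogonalToInvolution_submersion h hT hI)
    (orthogonalToInvolution_form h hT hI)
  exact ⟨R, d, T, hT, hR⟩

theorem exists_isStiefelMetric (h : k ≤ n) : ∃ R, IsStiefelMetric (n := n) (k := k) R := by
  obtain ⟨I, hI⟩ := exists_isInvolutionMetric h
  obtain ⟨d, T, hT⟩ := exists_isInduced_stiefel n k
  obtain ⟨R, hR⟩ := exists_isRiemannianSubmersion_of_involution h hI
    (π := fun Y ↦ (⟦Y⟧ : StiefelModel n k)) isQuotientMap_quotient_mk'
    (StiefelModel.toInvolution_bijective h) (stiefelToInvolution_submersion hT hI)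
    (stiefelToInvolution_form hT hI)
  exact ⟨R, d, T, hT, hR⟩

theorem exists_isFullRankMetric (h : k ≤ n) : ∃ R, IsFullRankMetric (n := n) (k := k) R := by
  obtain ⟨I, hI⟩ := exists_isInvolutionMetric h
  obtain ⟨d, T, hT⟩ := exists_isInduced_fullRank n k
  obtain ⟨R, hR⟩ := exists_isRiemannianSubmersion_of_involution h hI
    (π := fun A ↦ (⟦A⟧ : FullRankModel n k)) isQuotientMap_quotient_mk'
    (FullRankModel.toInvolution_bijective h) (fullRankToInvolution_submersion hT hI)
    (fullRankToInvolution_form hT hI)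
  exact ⟨R, d, T, hT, hR⟩

theorem IsOrthogonalMetric.isScaledIsometry {h : k ≤ n}
    {O : RiemannianStructure (k * (n - k)) (OrthogonalModel h)} (hO : IsOrthogonalMetric h O)
    {I : RiemannianStructure (k * (n - k)) (involutionModel n k)} (hI : IsInvolutionMetric I) :
    O.IsScaledIsometry I 8 (OrthogonalModel.toInvolution h) := by
  obtain ⟨d, T, hT, hπ⟩ := hO
  exact hπ.isScaledIsometry QuotientGroup.mk_surjective
    (orthogonalToInvolution_submersion h hT hI) (OrthogonalModel.toInvolution_bijective h)
    (orthogonalToInvolution_form h hT hI)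

theorem IsStiefelMetric.isScaledIsometry (h : k ≤ n)
    {S : RiemannianStructure (k * (n - k)) (StiefelModel n k)} (hS : IsStiefelMetric S)
    {I : RiemannianStructure (k * (n - k)) (involutionModel n k)} (hI : IsInvolutionMetric I) :
    S.IsScaledIsometry I 8 StiefelModel.toInvolution := by
  obtain ⟨d, T, hT, hπ⟩ := hS
  exact hπ.isScaledIsometry Quotient.mk_surjective (stiefelToInvolution_submersion hT hI)
    (StiefelModel.toInvolution_bijective h) (stiefelToInvolution_form hT hI)

theorem IsFullRankMetric.isScaledIsometry (h : k ≤ n)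
    {F : RiemannianStructure (k * (n - k)) (FullRankModel n k)} (hF : IsFullRankMetric F)
    {I : RiemannianStructure (k * (n - k)) (involutionModel n k)} (hI : IsInvolutionMetric I) :
    F.IsScaledIsometry I 8 FullRankModel.toInvolution := by
  obtain ⟨d, T, hT, hπ⟩ := hF
  exact hπ.isScaledIsometry Quotient.mk_surjective (fullRankToInvolution_submersion hT hI)
    (FullRankModel.toInvolution_bijective h) (fullRankToInvolution_form hT hI)

/-- The map `P ↦ 2P - 1` from the projection model to the involution model. -/
def projectionToInvolution (P : projectionModel n k) : involutionModel n k :=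
  ⟨(2 : ℝ) • P.1 - 1, two_smul_sub_one_mem_involutionModel P.2⟩

theorem IsProjectionMetric.isScaledIsometry
    {P : RiemannianStructure (k * (n - k)) (projectionModel n k)} (hP : IsProjectionMetric P)
    {I : RiemannianStructure (k * (n - k)) (involutionModel n k)} (hI : IsInvolutionMetric I) :
    P.IsScaledIsometry I 4 projectionToInvolution := by
  refine IsInduced.isScaledIsometry hP hI
    (g := fun Q ↦ ⟨(1 / 2 : ℝ) • (Q.1 + 1), mem_involutionModel_iff.1 Q.2⟩)
    (a := fun P ↦ (2 : ℝ) • P - 1) (b := fun Q ↦ (1 / 2 : ℝ) • (Q + 1)) (by fun_prop)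
    (by fun_prop) (fun _ ↦ rfl) (fun _ ↦ rfl) (fun P ↦ by simp) (fun Q ↦ by simp)
    fun p u v ↦ ?_
  have h : ∀ u, fderiv ℝ (fun P : Matrix (Fin n) (Fin n) ℝ ↦ (2 : ℝ) • P - 1) p u = (2 : ℝ) • u :=
    fun u ↦ by
    have h1 := ((hasFDerivAt_id (𝕜 := ℝ) p).const_smul (2 : ℝ)).sub_const 1
    exact congrArg (fun L ↦ L u) h1.fderiv
  refine (congrArg₂ (fun X Y : Matrix (Fin n) (Fin n) ℝ ↦ (X * Y).trace) (h u) (h v)).trans ?_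
  rw [Matrix.smul_mul, Matrix.mul_smul, Matrix.trace_smul, Matrix.trace_smul, smul_eq_mul,
    smul_eq_mul]
  ring

end Quotients

theorem proposition3p5 (n k : ℕ) (hk : 1 ≤ k) (hkn : k ≤ n) :
    -- each model carries its Riemannian structure
    ((∃ R, IsOrthogonalMetric hkn R) ∧ (∃ R, IsStiefelMetric (n := n) (k := k) R) ∧
      (∃ R, IsFullRankMetric (n := n) (k := k) R) ∧
      (∃ R, IsProjectionMetric (n := n) (k := k) R) ∧
      (∃ R, IsInvolutionMetric (n := n) (k := k) R)) ∧
    ∀ (O : RiemannianStructure (k * (n - k)) (OrthogonalModel hkn))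
      (S : RiemannianStructure (k * (n - k)) (StiefelModel n k))
      (F : RiemannianStructure (k * (n - k)) (FullRankModel n k))
      (P : RiemannianStructure (k * (n - k)) (projectionModel n k))
      (I : RiemannianStructure (k * (n - k)) (involutionModel n k)),
      IsOrthogonalMetric hkn O → IsStiefelMetric S → IsFullRankMetric F →
      IsProjectionMetric P → IsInvolutionMetric I →
      -- the change-of-coordinates maps to the involution model are isometries up to constants
      (∃ φ₁ : OrthogonalModel hkn → involutionModel n k,
        (∀ V : Matrix.orthogonalGroup (Fin n) ℝ, (φ₁ (V : OrthogonalModel hkn)).1 =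
          V.1 * signatureMatrix n k * V.1ᵀ) ∧
        O.IsScaledIsometry I 8 φ₁) ∧
      (∃ φ₂ : projectionModel n k → involutionModel n k,
        (∀ A : projectionModel n k, (φ₂ A).1 = (2 : ℝ) • A.1 - 1) ∧
        P.IsScaledIsometry I 4 φ₂) ∧
      (∃ φ₃ : StiefelModel n k → involutionModel n k,
        (∀ Y : stiefel n k, (φ₃ ⟦Y⟧).1 = (2 : ℝ) • (Y.1 * Y.1ᵀ) - 1) ∧
        S.IsScaledIsometry I 8 φ₃) ∧
      (∃ φ₄ : FullRankModel n k → involutionModel n k,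
        (∀ (A : fullRank n k) (Y : stiefel n k) (T : Matrix (Fin k) (Fin k) ℝ),
          A.1 = Y.1 * T → (φ₄ ⟦A⟧).1 = (2 : ℝ) • (Y.1 * Y.1ᵀ) - 1) ∧
        F.IsScaledIsometry I 8 φ₄) ∧
      -- any two of the five models are isometric up to a constant factor
      ∀ M ∈ ({⟨_, O⟩, ⟨_, S⟩, ⟨_, F⟩, ⟨_, P⟩, ⟨_, I⟩} : Set (RiemannianMfd (k * (n - k)))),
      ∀ N ∈ ({⟨_, O⟩, ⟨_, S⟩, ⟨_, F⟩, ⟨_, P⟩, ⟨_, I⟩} : Set (RiemannianMfd (k * (n - k)))),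
        M.IsometricUpToConstant N := by
  refine ⟨⟨exists_isOrthogonalMetric hkn, exists_isStiefelMetric hkn, exists_isFullRankMetric hkn,
    exists_isProjectionMetric hkn, exists_isInvolutionMetric hkn⟩, ?_⟩
  intro O S F P I hO hS hF hP hI
  have hO' := hO.isScaledIsometry hI
  have hS' := hS.isScaledIsometry hkn hI
  have hF' := hF.isScaledIsometry hkn hI
  have hP' := hP.isScaledIsometry hI
  refine ⟨⟨_, fun _ ↦ rfl, hO'⟩, ⟨_, fun _ ↦ rfl, hP'⟩, ⟨_, fun _ ↦ rfl, hS'⟩,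
    ⟨_, fun A Y T hA ↦ fullRankToInvolution_of_eq_mul hA, hF'⟩, ?_⟩
  have key : ∀ M ∈ ({⟨_, O⟩, ⟨_, S⟩, ⟨_, F⟩, ⟨_, P⟩, ⟨_, I⟩} : Set (RiemannianMfd (k * (n - k)))),
      M.IsometricUpToConstant ⟨_, I⟩ := by
    rintro M (rfl | rfl | rfl | rfl | rfl)
    · exact ⟨8, by norm_num, _, hO'⟩
    · exact ⟨8, by norm_num, _, hS'⟩
    · exact ⟨8, by norm_num, _, hF'⟩
    · exact ⟨4, by norm_num, _, hP'⟩
    · exact ⟨1, one_pos, _, RiemannianStructure.IsScaledIsometry.refl I⟩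
  exact fun M hM N hN ↦ (key M hM).of_common (key N hN)
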